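/- Let $\varphi:\mathbb R^3\to\mathbb R$ be $C^1$ and let $\varepsilon>0$. For functions $\lambda(t)\in\mathbb R$, $\gamma(t)\in\mathbb R^3$ of $t\in[0,1]$, step sizes $\tau_\lambda,\tau_\gamma>0$ and a relaxation parameter $\omega$, the relaxed update $(\lambda,\gamma)\mapsto(\lambda^+,\gamma^+)$ is $$\lambda^+=\frac{\lambda+\tau_\lambda\varphi(\gamma)}{1+\varepsilon\tau_\lambda},\qquad \tilde\lambda=\lambda^++\omega(\lambda^+-\lambda),\qquad \gamma^+=\gamma-\tau_\gamma\bigl(-\ddot\gamma+\tilde\lambda\,\nabla\varphi(\gamma)\bigr),$$ where the $\gamma$-update is performed at $t\in(0,1)$ and dots denote $t$-derivatives. For $\alpha\in\mathbb R$ and $p,q\in\mathbb R^3$ consider the PDE system for $\lambda(t,s),\gamma(t,s)$, with $'=\partial_s$, $$\lambda'=-\varepsilon\lambda+\varphi(\gamma),\qquad \gamma'=\ddot\gamma-\nabla\varphi(\gamma)\bigl((1-\alpha\varepsilon)\lambda+\alpha\varphi(\gamma)\bigr),\qquad(\ast)$$ with $\lambda(t,0)=\lambda_0(t)$, $\gamma(t,0)=\gamma_0(t)$,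 $\gamma(0,s)=p$, $\gamma(1,s)=q$. A pair $(\lambda,\gamma)$ is called regular if $\lambda,\gamma$ are continuous on $[0,1]\times[0,\infty)$, $\partial_s\lambda$ exists and is continuous on $[0,1]\times(0,\infty)$, and on $(0,1)\times(0,\infty)$ the function $\gamma$ is differentiable in $s$ and $C^2$ in $t$ with $\partial_s\gamma$, $\partial_t^2\gamma$ jointly continuous. A solution is a regular pair that satisfies the first equation for $t\in[0,1]$, $s>0$, the second for $t\in(0,1)$, $s>0$, and the initial and end point conditions. Then: 1. (The update as a discretization.) Put $h=\tau_\lambda/(1+\varepsilon\tau_\lambda)$ and $\alpha=(1+\omega)h$. The update is exactly the explicit Euler step of $(\ast)$ with time step $h$ for $\lambda$ and $\tau_\gamma$ for $\gamma$: $$\frac{\lambda^+-\lambda}{h}=-\varepsilon\lambda+\varphi(\gamma)\ \text{ on }[0,1],\qquad \frac{\gamma^+-\gamma}{\tau_\gamma}=\ddot\gamma-\nabla\varphi(\gamma)\bigl((1-\alpha\varepsilon)\lambda+\alpha\varphi(\gamma)\bigr)\ \text{ on }(0,1),$$ and each of these identities is equivalent to the corresponding line of the update. It is consistent: let $\alpha\in\mathbb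 R$, let $\tau_\lambda,\tau_\gamma\to0$ along sequences of positive numbers, and let $\omega$ vary with them so that $(1+\omega)h\to\alpha$. Then for every regular pair, writing $(\lambda^+,\gamma^+)(t,s)$ for the update of $(\lambda(\cdot,s),\gamma(\cdot,s))$ at $t$, $$\frac{\lambda(t,s+h)-\lambda^+(t,s)}{h}\to\lambda'-\bigl(-\varepsilon\lambda+\varphi(\gamma)\bigr),\qquad \frac{\gamma(t,s+\tau_\gamma)-\gamma^+(t,s)}{\tau_\gamma}\to\gamma'-\Bigl(\ddot\gamma-\nabla\varphi(\gamma)\bigl((1-\alpha\varepsilon)\lambda+\alpha\varphi(\gamma)\bigr)\Bigr),$$ locally uniformly on $[0,1]\times(0,\infty)$ and on $(0,1)\times(0,\infty)$ respectively. In particular, along solutions of $(\ast)$ the local truncation error of the update tends to $0$. 2. (Well-posedness.) If $\nabla\varphi$ is Lipschitz continuous on $\mathbb R^3$ and $\alpha>0$, then for all continuous $\lambda_0:[0,1]\to\mathbb R$ and $\gamma_0:[0,1]\to\mathbb R^3$ with $\gamma_0(0)=p$, $\gamma_0(1)=q$, the system $(\ast)$ has exactly one solution (on $[0,1]\times[0,\infty)$).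 3. (Equilibria.) Let $\alpha>0$. A pair $(\lambda^*(t),\gamma^*(t))$ is an equilibrium of $(\ast)$, i.e. the pair constant in $s$ is a solution with initial data $(\lambda^*,\gamma^*)$, if and only if $\lambda^*,\gamma^*$ are continuous on $[0,1]$, $\gamma^*$ is $C^2$ on $(0,1)$, $\gamma^*(0)=p$, $\gamma^*(1)=q$, and $$\varepsilon\lambda^*=\varphi(\gamma^*)\ \text{ on }[0,1],\qquad \ddot\gamma^*=\bigl((1-\alpha\varepsilon)\lambda^*+\alpha\varphi(\gamma^*)\bigr)\nabla\varphi(\gamma^*)\ \text{ on }(0,1).$$ -/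

import Mathlib

open Set Filter Topology

noncomputable section

/-- The ambient space `ℝ³` with its Euclidean structure. -/
abbrev R3 : Type := EuclideanSpace ℝ (Fin 3)

namespace GeodesicFlow

/-- Second derivative of a curve. It is only ever evaluated at points of the open interval
`(0, 1)`, so that the values of the curve outside `[0, 1]` play no role. -/
def secondDeriv (c : ℝ → R3) : ℝ → R3 := deriv (deriv c)

/-! ### The relaxed primal-dual update (one step `(lam, gam) ↦ (lam⁺, gam⁺)`) -/

/-- `lam⁺(t) = (lam(t) + τ_lam φ(gam(t))) / (1 + ε τ_lam)`. -/
def updateLam (φ : R3 → ℝ) (ε τl : ℝ) (lam : ℝ → ℝ) (gam : ℝ → R3) (t : ℝ) : ℝ :=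
  1 / (1 + ε * τl) * (lam t + τl * φ (gam t))

/-- The extrapolated multiplier `lam⁺(t) + ω (lam⁺(t) - lam(t))`. -/
def updateTilde (φ : R3 → ℝ) (ε ω τl : ℝ) (lam : ℝ → ℝ) (gam : ℝ → R3) (t : ℝ) : ℝ :=
  updateLam φ ε τl lam gam t + ω * (updateLam φ ε τl lam gam t - lam t)

/-- `gam⁺(t) = gam(t) - τ_gam (- gam̈(t) + tilde(t) ∇φ(gam(t)))`. -/
def updateGam (φ : R3 → ℝ) (ε ω τl τg : ℝ) (lam : ℝ → ℝ) (gam : ℝ → R3) (t : ℝ) : R3 :=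
  gam t - τg • (-secondDeriv gam t + updateTilde φ ε ω τl lam gam t • gradient φ (gam t))

/-! ### The PDE system -/

/-- Right-hand side of the first equation, `-ε lam + φ(gam)`. -/
def rhsLam (φ : R3 → ℝ) (ε : ℝ) (lam : ℝ → ℝ) (gam : ℝ → R3) (t : ℝ) : ℝ :=
  -ε * lam t + φ (gam t)

/-- Right-hand side of the second equation,
`gam̈ - ((1 - α ε) lam + α φ(gam)) ∇φ(gam)`. -/
def rhsGam (φ : R3 → ℝ) (ε α : ℝ) (lam : ℝ → ℝ) (gam : ℝ → R3) (t : ℝ) : R3 :=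
  secondDeriv gam t - ((1 - α * ε) * lam t + α * φ (gam t)) • gradient φ (gam t)

/-- Partial derivative in `s` of `u(t, s)`, at the point `p = (t, s)`. -/
def partialS {E : Type*} [NormedAddCommGroup E] [NormedSpace ℝ E] (u : ℝ → ℝ → E)
    (p : ℝ × ℝ) : E :=
  deriv (fun r => u p.1 r) p.2

/-- Regularity of a classical pair `(lam(t, s), gam(t, s))`, `t ∈ [0, 1]`, `s ≥ 0`: both functions
are continuous on `[0, 1] × [0, ∞)`; `lam` is `C¹` in `s` for `s > 0`; and `gam` is `C¹` in `s` and
`C²` in `t` on `(0, 1) × (0, ∞)`, with `∂_s gam` and `∂_t² gam` jointly continuous there. -/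
structure IsRegular (lam : ℝ → ℝ → ℝ) (gam : ℝ → ℝ → R3) : Prop where
  lam_cont : ContinuousOn (fun p : ℝ × ℝ => lam p.1 p.2) (Icc 0 1 ×ˢ Ici 0)
  gam_cont : ContinuousOn (fun p : ℝ × ℝ => gam p.1 p.2) (Icc 0 1 ×ˢ Ici 0)
  lam_diff : ∀ t ∈ Icc (0 : ℝ) 1, ∀ s ∈ Ioi (0 : ℝ), DifferentiableAt ℝ (fun r => lam t r) s
  lam_deriv_cont : ContinuousOn (partialS lam) (Icc 0 1 ×ˢ Ioi 0)
  gam_diff : ∀ t ∈ Ioo (0 : ℝ) 1, ∀ s ∈ Ioi (0 : ℝ), DifferentiableAt ℝ (fun r => gam t r) s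
  gam_deriv_cont : ContinuousOn (partialS gam) (Ioo 0 1 ×ˢ Ioi 0)
  gam_C2 : ∀ s ∈ Ioi (0 : ℝ), ContDiffOn ℝ 2 (fun t => gam t s) (Ioo 0 1)
  gam_second_cont :
    ContinuousOn (fun p : ℝ × ℝ => secondDeriv (fun t => gam t p.2) p.1) (Ioo 0 1 ×ˢ Ioi 0)

/-- `(lam, gam)` is a (global in time, classical) solution of the PDE system with initial data
`lam0`, `gam0` and with the end points of the curve kept at `p` and `q`. -/
structure IsSolution (φ : R3 → ℝ) (ε α : ℝ) (p q : R3) (lam0 : ℝ → ℝ) (gam0 : ℝ → R3)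
    (lam : ℝ → ℝ → ℝ) (gam : ℝ → ℝ → R3) : Prop where
  regular : IsRegular lam gam
  eq_lam : ∀ t ∈ Icc (0 : ℝ) 1, ∀ s ∈ Ioi (0 : ℝ),
    partialS lam (t, s) = rhsLam φ ε (fun x => lam x s) (fun x => gam x s) t
  eq_gam : ∀ t ∈ Ioo (0 : ℝ) 1, ∀ s ∈ Ioi (0 : ℝ),
    partialS gam (t, s) = rhsGam φ ε α (fun x => lam x s) (fun x => gam x s) t
  left_end : ∀ s ∈ Ici (0 : ℝ), gam 0 s = p
  right_end : ∀ s ∈ Ici (0 : ℝ), gam 1 s = q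
  init_lam : ∀ t ∈ Icc (0 : ℝ) 1, lam t 0 = lam0 t
  init_gam : ∀ t ∈ Icc (0 : ℝ) 1, gam t 0 = gam0 t

/-- An equilibrium: a pair whose constant extension in `s` is a solution. -/
def IsEquilibrium (φ : R3 → ℝ) (ε α : ℝ) (p q : R3) (lam : ℝ → ℝ) (gam : ℝ → R3) : Prop :=
  IsSolution φ ε α p q lam gam (fun t _ => lam t) (fun t _ => gam t)

end GeodesicFlow

end

/-!
# A relaxed primal-dual flow for constrained curves: consistency, well-posedness, equilibria

Clearing denominators turns both lines of the update into explicit Euler steps (`updateLam_eq`,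
`updateGam_eq`). Consistency then amounts to the locally uniform convergence of the difference
quotients of a regular pair (`tendstoLocallyUniformlyOn_slope`); the only further error, caused by
`(1 + ω) h ≠ α`, is `(1 + ω) h - α` times a continuous field. The description of the equilibria is
read off from the definitions.

For well-posedness the system is written as `lam' = A(lam, gam)`, `gam' = gam̈ + B(lam, gam)` with
`A` and `B` locally Lipschitz.

*Uniqueness* is a weak maximum principle. At a positive maximum of `e^{-ks}‖δ‖` or `e^{-ks}|η|`,
where `δ` and `η` are the differences of two solutions and `k` is large, the equations contradict
the first and second derivative tests (`eq_zero_of_parabolic`, `IsInterior.unique`).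

*Existence for bounded Lipschitz `A` and `B`.* After subtraction of the segment between the end
points the boundary values are zero, and odd `2`-periodic extension turns the Dirichlet problem
into one on the line. There the heat semigroup is convolution with the Gaussian kernel, and mild
solutions come from the contraction principle in a norm with exponential weight in time
(`exists_isMild`). Their sources are Hölder continuous of order `1/2` in time, away from time
zero, which makes the singular integral for the time derivative of the Duhamel term converge
(`hasDerivAt_duhamel_time`, `hasDerivAt_duhamel₁`). Hence mild solutions are classical, with time
derivative continuous up to the end points (`exists_isStrong`). Only the source has jumps, at the
integers.

*Global existence.* The nonlinearity is cut off outside a ball (`exists_truncation`), and an a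
priori bound shows that a large cutoff is never felt up to a prescribed time. With `c = 1 - αε`,
`f = φ(gam)` and `κ = c²/α + 1`, the energy `∫ ‖∂ₜgam‖² / 2 + c lam f + α f² / 2 + κ lam²` has a
zeroth order part that dominates `α f² / 4 + lam²`, because `α > 0`. The terms of its time
derivative that contain `∂ₛgam` add up to `-∫ ‖∂ₛgam‖²`, and those left over are quadratic in
`(lam, f)`. So the energy grows at most exponentially (`IsStrong.exists_hasDerivAt_energy`). In
one space dimension it bounds the curve uniformly, and with it `φ(gam)` and `lam`
(`IsStrong.norm_sub_le_exp`, `IsInterior.abs_lam_le`). The initial curve need not have finite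
energy; the estimate therefore starts at a positive time `s₀`, at which all flows with large
cutoff agree (`exists_isStrong_upto`).
-/

noncomputable section

namespace GeodesicFlow

open MeasureTheory

/-! ### The update as an Euler step, consistency, equilibria -/

theorem continuous_gradient {φ : R3 → ℝ} (hφ : ContDiff ℝ 1 φ) : Continuous (gradient φ) :=
  (InnerProductSpace.toDual ℝ R3).symm.continuous.comp (hφ.continuous_fderiv one_ne_zero)

theorem updateLam_eq (φ : R3 → ℝ) {ε τl : ℝ} (hε : 0 < ε) (hτ : 0 < τl) (lam : ℝ → ℝ)
    (gam : ℝ → R3) (t : ℝ) :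
    updateLam φ ε τl lam gam t = lam t + (τl / (1 + ε * τl)) * rhsLam φ ε lam gam t := by
  have h : (1 + ε * τl) ≠ 0 := by positivity
  unfold updateLam rhsLam
  field_simp
  ring

theorem updateGam_eq (φ : R3 → ℝ) {ε τl : ℝ} (hε : 0 < ε) (hτ : 0 < τl) (ω τg : ℝ) (lam : ℝ → ℝ)
    (gam : ℝ → R3) (t : ℝ) :
    updateGam φ ε ω τl τg lam gam t =
      gam t + τg • rhsGam φ ε ((1 + ω) * (τl / (1 + ε * τl))) lam gam t := by
  have h : updateTilde φ ε ω τl lam gam t =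
      (1 - (1 + ω) * (τl / (1 + ε * τl)) * ε) * lam t +
        (1 + ω) * (τl / (1 + ε * τl)) * φ (gam t) := by
    unfold updateTilde
    rw [updateLam_eq φ hε hτ]
    unfold rhsLam
    ring
  unfold updateGam rhsGam
  rw [h]
  module

/-- Difference quotients in `s` converge locally uniformly to a jointly continuous `∂ₛu`: by the
mean value inequality on segments that stay in a neighbourhood where `∂ₛu` varies little. -/
theorem tendstoLocallyUniformlyOn_slope {E : Type*} [NormedAddCommGroup E] [NormedSpace ℝ E]
    {u : ℝ → ℝ → E} {A : Set ℝ}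
    (hd : ∀ t ∈ A, ∀ s ∈ Ioi (0 : ℝ), DifferentiableAt ℝ (fun r => u t r) s)
    (hc : ContinuousOn (partialS u) (A ×ˢ Ioi 0))
    {h : ℕ → ℝ} (hpos : ∀ n, 0 < h n) (h0 : Tendsto h atTop (𝓝 0)) :
    TendstoLocallyUniformlyOn
      (fun n (x : ℝ × ℝ) => (h n)⁻¹ • (u x.1 (x.2 + h n) - u x.1 x.2))
      (partialS u) atTop (A ×ˢ Ioi 0) := by
  rw [Metric.tendstoLocallyUniformlyOn_iff]
  intro η hη x hx
  have hcx := hc x hx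
  rw [Metric.continuousWithinAt_iff] at hcx
  obtain ⟨δ, hδ, H⟩ := hcx (η / 3) (by positivity)
  refine ⟨Metric.ball x (δ / 2) ∩ (A ×ˢ Ioi 0), ?_, ?_⟩
  · rw [inter_comm]
    exact inter_mem_nhdsWithin _ (Metric.ball_mem_nhds x (by positivity))
  filter_upwards [h0.eventually_lt_const (show (0 : ℝ) < δ / 2 by positivity)] with n hn y hy
  obtain ⟨hy1, hyA, hy2⟩ := hy
  rw [Metric.mem_ball] at hy1
  have hy2' : 0 < y.2 := hy2
  have key : ‖(u y.1 (y.2 + h n) - (y.2 + h n) • partialS u x) -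
      (u y.1 y.2 - y.2 • partialS u x)‖ ≤ (η / 3) * ‖(y.2 + h n) - y.2‖ := by
    refine (convex_Icc y.2 (y.2 + h n)).norm_image_sub_le_of_norm_hasDerivWithin_le
      (f := fun r => u y.1 r - r • partialS u x)
      (f' := fun r => partialS u (y.1, r) - partialS u x) ?_ ?_
      (left_mem_Icc.2 (by linarith [hpos n])) (right_mem_Icc.2 (by linarith [hpos n]))
    · intro r hr
      have hr0 : 0 < r := hy2'.trans_le hr.1
      have := (hd y.1 hyA r hr0).hasDerivAt.sub ((hasDerivAt_id r).smul_const (partialS u x))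
      simp only [id, one_smul] at this
      exact this.hasDerivWithinAt
    · intro r hr
      have hr0 : 0 < r := hy2'.trans_le hr.1
      have hd1 : dist (y.1, r) x < δ := by
        rw [Prod.dist_eq, max_lt_iff] at hy1 ⊢
        refine ⟨by linarith [hy1.1], ?_⟩
        have h1 : dist r y.2 ≤ h n := by
          rw [Real.dist_eq, abs_of_nonneg (by linarith [hr.1])]; linarith [hr.2]
        linarith [dist_triangle r y.2 x.2, hy1.2]
      have := H (show (y.1, r) ∈ A ×ˢ Ioi 0 from ⟨hyA, hr0⟩) hd1
      rw [dist_eq_norm] at this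
      exact this.le
  have hyx := H (show y ∈ A ×ˢ Ioi 0 from ⟨hyA, hy2⟩) (by linarith)
  have key2 : dist ((h n)⁻¹ • (u y.1 (y.2 + h n) - u y.1 y.2)) (partialS u x) ≤ η / 3 := by
    rw [dist_eq_norm]
    have e : (h n)⁻¹ • (u y.1 (y.2 + h n) - u y.1 y.2) - partialS u x =
        (h n)⁻¹ • ((u y.1 (y.2 + h n) - (y.2 + h n) • partialS u x) -
      (u y.1 y.2 - y.2 • partialS u x)) := by
      have : (h n)⁻¹ * h n = 1 := inv_mul_cancel₀ (hpos n).ne'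
      have h2 : partialS u x = ((h n)⁻¹ * h n) • partialS u x := by rw [this, one_smul]
      nth_rewrite 1 [h2]
      module
    rw [e, norm_smul, norm_inv, Real.norm_of_nonneg (hpos n).le]
    rw [add_sub_cancel_left, Real.norm_of_nonneg (hpos n).le] at key
    calc (h n)⁻¹ * _ ≤ (h n)⁻¹ * (η / 3 * h n) := by gcongr; exact (inv_pos.2 (hpos n)).le
      _ = η / 3 := by field_simp [(hpos n).ne']
  calc dist (partialS u y) _ ≤ dist (partialS u y) (partialS u x) + dist (partialS u x) _ :=
        dist_triangle _ _ _
    _ < η / 3 + η / 3 + η / 3 := by rw [dist_comm (partialS u x)]; linarith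
    _ = η := by ring

theorem lam_consistent {φ : R3 → ℝ} {ε : ℝ} (hε : 0 < ε) {τl : ℕ → ℝ} (hτ : ∀ n, 0 < τl n)
    (hτ0 : Tendsto τl atTop (𝓝 0)) {lam : ℝ → ℝ → ℝ} {gam : ℝ → ℝ → R3}
    (hr : IsRegular lam gam) :
    TendstoLocallyUniformlyOn
      (fun n (x : ℝ × ℝ) =>
        (lam x.1 (x.2 + τl n / (1 + ε * τl n)) -
          updateLam φ ε (τl n) (fun t => lam t x.2) (fun t => gam t x.2) x.1) /
          (τl n / (1 + ε * τl n)))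
      (fun x => partialS lam x - rhsLam φ ε (fun t => lam t x.2) (fun t => gam t x.2) x.1)
      atTop (Icc 0 1 ×ˢ Ioi 0) := by
  have hpos : ∀ n, 0 < τl n / (1 + ε * τl n) := fun n => by have := hτ n; positivity
  have h0 : Tendsto (fun n => τl n / (1 + ε * τl n)) atTop (𝓝 0) := by
    have : Tendsto (fun n => τl n / (1 + ε * τl n)) atTop (𝓝 (0 / (1 + ε * 0))) :=
      hτ0.div ((hτ0.const_mul ε).const_add 1) (by simp)
    simpa using this
  have key := tendstoLocallyUniformlyOn_slope hr.lam_diff hr.lam_deriv_cont hpos h0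
  rw [Metric.tendstoLocallyUniformlyOn_iff] at key ⊢
  intro η hη x hx
  obtain ⟨t, ht, H⟩ := key η hη x hx
  refine ⟨t, ht, H.mono fun n hn y hy => ?_⟩
  have := hn y hy
  rw [dist_eq_norm] at this ⊢
  convert this using 2
  rw [updateLam_eq φ hε (hτ n), smul_eq_mul]
  set hh := τl n / (1 + ε * τl n)
  have := (hpos n).ne'
  change hh ≠ 0 at this
  field_simp
  ring

theorem gam_consistent {φ : R3 → ℝ} (hφ : ContDiff ℝ 1 φ) {ε : ℝ} (hε : 0 < ε) {α : ℝ}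
    {τl τg ω : ℕ → ℝ} (hτl : ∀ n, 0 < τl n)
    (hτ : ∀ n, 0 < τg n) (hτ0 : Tendsto τg atTop (𝓝 0))
    (hα : Tendsto (fun n => (1 + ω n) * (τl n / (1 + ε * τl n))) atTop (𝓝 α))
    {lam : ℝ → ℝ → ℝ} {gam : ℝ → ℝ → R3} (hr : IsRegular lam gam) :
    TendstoLocallyUniformlyOn
      (fun n (x : ℝ × ℝ) =>
        (τg n)⁻¹ • (gam x.1 (x.2 + τg n) -
          updateGam φ ε (ω n) (τl n) (τg n)
            (fun t => lam t x.2) (fun t => gam t x.2) x.1))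
      (fun x => partialS gam x - rhsGam φ ε α (fun t => lam t x.2) (fun t => gam t x.2) x.1)
      atTop (Ioo 0 1 ×ˢ Ioi 0) := by
  have key := tendstoLocallyUniformlyOn_slope hr.gam_diff hr.gam_deriv_cont hτ hτ0
  set α' : ℕ → ℝ := fun n => (1 + ω n) * (τl n / (1 + ε * τl n)) with hα'
  -- the two residuals differ by `(α' n - α)` times this continuous field
  set V : ℝ × ℝ → R3 := fun x =>
    (φ (gam x.1 x.2) - ε * lam x.1 x.2) • gradient φ (gam x.1 x.2) with hV
  have hsub : (Ioo 0 1 ×ˢ Ioi 0 : Set (ℝ × ℝ)) ⊆ Icc 0 1 ×ˢ Ici 0 :=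
    prod_mono Ioo_subset_Icc_self Ioi_subset_Ici_self
  have hVc : ContinuousOn V (Ioo 0 1 ×ˢ Ioi 0) := by
    have h1 := hr.gam_cont.mono hsub
    have h2 := hr.lam_cont.mono hsub
    exact ((hφ.continuous.comp_continuousOn h1).sub (continuousOn_const.mul h2)).smul
      ((continuous_gradient hφ).comp_continuousOn h1)
  rw [Metric.tendstoLocallyUniformlyOn_iff] at key ⊢
  intro η hη x hx
  obtain ⟨t, ht, H⟩ := key (η / 2) (half_pos hη) x hx
  have hVb : ∀ᶠ y in 𝓝[Ioo 0 1 ×ˢ Ioi 0] x, ‖V y‖ < ‖V x‖ + 1 :=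
    (hVc x hx).norm.eventually_lt_const (by linarith)
  refine ⟨_, inter_mem ht hVb, ?_⟩
  have hη2 : Tendsto (fun n => |α' n - α| * (‖V x‖ + 1)) atTop (𝓝 0) := by
    have : Tendsto (fun n => |α' n - α| * (‖V x‖ + 1)) atTop (𝓝 (|α - α| * (‖V x‖ + 1))) :=
      ((hα.sub_const α).abs).mul_const _
    simpa using this
  filter_upwards [H, hη2.eventually_lt_const (half_pos hη)] with n hn hn2 y hy
  have h1 := hn y hy.1
  have h2 : ‖V y‖ < ‖V x‖ + 1 := hy.2
  have e : (τg n)⁻¹ • (gam y.1 (y.2 + τg n) - updateGam φ ε (ω n) (τl n) (τg n)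
      (fun t => lam t y.2) (fun t => gam t y.2) y.1) =
      (τg n)⁻¹ • (gam y.1 (y.2 + τg n) - gam y.1 y.2) -
        rhsGam φ ε α (fun t => lam t y.2) (fun t => gam t y.2) y.1 + (α' n - α) • V y := by
    rw [updateGam_eq φ hε (hτl n), ← sub_sub, smul_sub, smul_smul, inv_mul_cancel₀ (hτ n).ne',
      one_smul]
    simp only [rhsGam, hV, hα']
    module
  rw [e, dist_eq_norm]
  rw [dist_eq_norm] at h1
  have e2 : partialS gam y - rhsGam φ ε α (fun t => lam t y.2) (fun t => gam t y.2) y.1 -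
      ((τg n)⁻¹ • (gam y.1 (y.2 + τg n) - gam y.1 y.2) -
        rhsGam φ ε α (fun t => lam t y.2) (fun t => gam t y.2) y.1 + (α' n - α) • V y) =
      (partialS gam y - (τg n)⁻¹ • (gam y.1 (y.2 + τg n) - gam y.1 y.2)) -
        (α' n - α) • V y := by abel
  rw [e2]
  calc _ ≤ ‖partialS gam y - (τg n)⁻¹ • (gam y.1 (y.2 + τg n) - gam y.1 y.2)‖ +
        ‖(α' n - α) • V y‖ := norm_sub_le _ _
    _ = ‖partialS gam y - (τg n)⁻¹ • (gam y.1 (y.2 + τg n) - gam y.1 y.2)‖ +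
        |α' n - α| * ‖V y‖ := by rw [norm_smul, Real.norm_eq_abs]
    _ < η / 2 + η / 2 := by
        refine add_lt_add_of_lt_of_le h1 (le_trans ?_ hn2.le)
        gcongr
    _ = η := by ring

theorem continuousOn_secondDeriv {c : ℝ → R3} (hc : ContDiffOn ℝ 2 c (Ioo 0 1)) :
    ContinuousOn (secondDeriv c) (Ioo 0 1) := by
  have h1 : ContDiffOn ℝ 1 (deriv c) (Ioo 0 1) :=
    ((contDiffOn_succ_iff_deriv_of_isOpen isOpen_Ioo (n := 1)).1
      (by rwa [one_add_one_eq_two])).2.2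
  exact ((contDiffOn_succ_iff_deriv_of_isOpen isOpen_Ioo (n := 0)).1
    (by simpa using h1)).2.2.continuousOn

theorem isEquilibrium_iff (φ : R3 → ℝ) (ε α : ℝ) (p q : R3) (lam : ℝ → ℝ) (gam : ℝ → R3) :
    IsEquilibrium φ ε α p q lam gam ↔
      (ContinuousOn lam (Icc 0 1) ∧ ContinuousOn gam (Icc 0 1) ∧
        ContDiffOn ℝ 2 gam (Ioo 0 1) ∧ gam 0 = p ∧ gam 1 = q ∧
        (∀ t ∈ Icc (0 : ℝ) 1, ε * lam t = φ (gam t)) ∧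
        (∀ t ∈ Ioo (0 : ℝ) 1, secondDeriv gam t =
          ((1 - α * ε) * lam t + α * φ (gam t)) • gradient φ (gam t))) := by
  have hS : ∀ {E : Type} [NormedAddCommGroup E] [NormedSpace ℝ E] (u : ℝ → E) (x : ℝ × ℝ),
      partialS (fun t _ => u t) x = 0 := fun u x => by simp [partialS]
  constructor
  · intro h
    have hm : ∀ t ∈ Icc (0 : ℝ) 1, (t, (0 : ℝ)) ∈ (Icc 0 1 ×ˢ Ici 0 : Set (ℝ × ℝ)) :=
      fun t ht => ⟨ht, self_mem_Ici⟩
    refine ⟨?_, ?_, h.regular.gam_C2 1 (mem_Ioi.2 one_pos), h.left_end 0 self_mem_Ici,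
      h.right_end 0 self_mem_Ici, ?_, ?_⟩
    · exact h.regular.lam_cont.comp (f := fun t : ℝ => (t, (0 : ℝ))) (by fun_prop) hm
    · exact h.regular.gam_cont.comp (f := fun t : ℝ => (t, (0 : ℝ))) (by fun_prop) hm
    · intro t ht
      have := h.eq_lam t ht 1 (mem_Ioi.2 one_pos)
      rw [hS] at this
      simp only [rhsLam] at this
      linarith
    · intro t ht
      have := h.eq_gam t ht 1 (mem_Ioi.2 one_pos)
      rw [hS] at this
      exact sub_eq_zero.1 this.symm
  · rintro ⟨h1, h2, h3, h4, h5, h6, h7⟩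
    refine ⟨⟨?_, ?_, ?_, ?_, ?_, ?_, fun _ _ => h3, ?_⟩, ?_, ?_, fun _ _ => h4, fun _ _ => h5,
      fun _ _ => rfl, fun _ _ => rfl⟩
    · exact h1.comp continuousOn_fst fun x hx => hx.1
    · exact h2.comp continuousOn_fst fun x hx => hx.1
    · intro t _ s _; exact differentiableAt_const _
    · exact continuousOn_const.congr fun x _ => hS lam x
    · intro t _ s _; exact differentiableAt_const _
    · exact continuousOn_const.congr fun x _ => hS gam x
    · exact (continuousOn_secondDeriv h3).comp continuousOn_fst fun x hx => hx.1
    · intro t ht s _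
      rw [hS]; simp only [rhsLam]; linarith [h6 t ht]
    · intro t ht s _
      rw [hS]; simp only [rhsGam]; rw [h7 t ht, sub_self]

/-! ### The maximum principle -/

section

/-- The necessary second derivative test at a local maximum. -/
theorem deriv_deriv_nonpos_of_isLocalMax {f : ℝ → ℝ} {x : ℝ} (h : IsLocalMax f x)
    (hc : ContinuousAt f x) : deriv (deriv f) x ≤ 0 := by
  by_contra! hpos
  have hmin := isLocalMin_of_deriv_deriv_pos hpos h.deriv_eq_zero hc
  have heq : f =ᶠ[𝓝 x] fun _ => f x := by
    filter_upwards [h, hmin] with y h1 h2 using le_antisymm h1 h2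
  have h2 : deriv (deriv f) x = 0 := by
    rw [heq.deriv.deriv_eq]; simp
  exact hpos.ne' h2

/-- A function on `[0, s]` that is maximal at the right end has a nonnegative derivative there. -/
theorem deriv_nonneg_of_le_left {f : ℝ → ℝ} {f' s : ℝ} (hs : 0 < s) (hf : HasDerivAt f f' s)
    (hmax : ∀ r ∈ Icc 0 s, f r ≤ f s) : 0 ≤ f' := by
  have h1 := (hasDerivWithinAt_iff_tendsto_slope' (s := Iio s) (by simp)).1
    (hf.hasDerivWithinAt (s := Iio s))
  refine ge_of_tendsto h1 ?_
  filter_upwards [Ioo_mem_nhdsLT hs] with r hr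
  rw [slope_def_field]
  exact div_nonneg_of_nonpos (by linarith [hmax r ⟨hr.1.le, hr.2.le⟩]) (by linarith [hr.2])

variable {E : Type*} [NormedAddCommGroup E] [InnerProductSpace ℝ E]

/-- Weak maximum principle for the difference of two solutions. The larger of `e^{-ks}‖del‖` and
`e^{-ks}|eta|` with `k > 2L` has no positive maximum: at such a maximum the inequality fails,
by the second derivative test for the component of `del` along its own value there. -/
theorem eq_zero_of_parabolic {S L : ℝ} (hL : 0 ≤ L)
    {eta : ℝ → ℝ → ℝ} {del : ℝ → ℝ → E}
    (heta : ContinuousOn (fun p : ℝ × ℝ => eta p.1 p.2) (Icc 0 1 ×ˢ Icc 0 S))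
    (hdel : ContinuousOn (fun p : ℝ × ℝ => del p.1 p.2) (Icc 0 1 ×ˢ Icc 0 S))
    (heta0 : ∀ t ∈ Icc (0 : ℝ) 1, eta t 0 = 0) (hdel0 : ∀ t ∈ Icc (0 : ℝ) 1, del t 0 = 0)
    (hleft : ∀ s ∈ Icc 0 S, del 0 s = 0) (hright : ∀ s ∈ Icc 0 S, del 1 s = 0)
    (heta' : ∀ t ∈ Icc (0 : ℝ) 1, ∀ s ∈ Ioc 0 S, ∃ e', HasDerivAt (eta t) e' s ∧
      |e'| ≤ L * (|eta t s| + ‖del t s‖))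
    (hdel' : ∀ t ∈ Ioo (0 : ℝ) 1, ∀ s ∈ Ioc 0 S, ∃ (ds dtt : E) (dt : ℝ → E),
      HasDerivAt (del t) ds s ∧ (∀ x ∈ Ioo (0 : ℝ) 1, HasDerivAt (fun y => del y s) (dt x) x) ∧
      HasDerivAt dt dtt t ∧ ‖ds - dtt‖ ≤ L * (|eta t s| + ‖del t s‖)) :
    ∀ t ∈ Icc (0 : ℝ) 1, ∀ s ∈ Icc 0 S, eta t s = 0 ∧ del t s = 0 := by
  intro t ht s hs
  set k : ℝ := 2 * L + 1 with hk
  set m : ℝ × ℝ → ℝ := fun p => Real.exp (-(k * p.2)) * max |eta p.1 p.2| ‖del p.1 p.2‖ with hm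
  have hmc : ContinuousOn m (Icc 0 1 ×ˢ Icc 0 S) :=
    (by fun_prop : ContinuousOn (fun p : ℝ × ℝ => Real.exp (-(k * p.2))) _).mul
      (heta.abs.sup hdel.norm)
  obtain ⟨⟨a, b⟩, ⟨ha, hb⟩, hmax⟩ := (isCompact_Icc.prod isCompact_Icc).exists_isMaxOn
    ⟨(t, s), ht, hs⟩ hmc
  simp only at ha hb
  suffices h : max |eta a b| ‖del a b‖ ≤ 0 by
    have h1 : m (t, s) ≤ m (a, b) := hmax (show (t, s) ∈ _ from ⟨ht, hs⟩)
    have h2 : m (a, b) ≤ 0 := mul_nonpos_of_nonneg_of_nonpos (Real.exp_pos _).le h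
    have h3 : max |eta t s| ‖del t s‖ ≤ 0 := by
      by_contra! h4
      have : 0 < m (t, s) := mul_pos (Real.exp_pos _) h4
      linarith
    exact ⟨abs_nonpos_iff.1 ((le_max_left _ _).trans h3),
      norm_le_zero_iff.1 ((le_max_right _ _).trans h3)⟩
  by_contra! hpos
  set M := max |eta a b| ‖del a b‖ with hM
  have hb0 : 0 < b := by
    rcases hb.1.eq_or_lt with h | h
    · rw [hM, ← h, heta0 a ha, hdel0 a ha] at hpos; simp at hpos
    · exact h
  have hle : ∀ r ∈ Icc 0 b, Real.exp (-(k * r)) * max |eta a r| ‖del a r‖ ≤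
      Real.exp (-(k * b)) * M := fun r hr =>
    hmax (show (a, r) ∈ _ from ⟨ha, hr.1, hr.2.trans hb.2⟩)
  -- a scalar function dominated by the maximum and touching it at `b` grows at least at rate `k`
  have touch : ∀ (f : ℝ → ℝ) (f' : ℝ), HasDerivAt f f' b → f b = M →
      (∀ r ∈ Icc 0 b, f r ≤ max |eta a r| ‖del a r‖) → k * M ≤ f' := by
    intro f f' hf hfb hfle
    have h1 : HasDerivAt (fun r => Real.exp (-(k * r)) * f r)
        (Real.exp (-(k * b)) * (-(k * 1)) * f b + Real.exp (-(k * b)) * f') b :=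
      (((hasDerivAt_id b).const_mul k).neg.exp).mul hf
    have h2 := deriv_nonneg_of_le_left hb0 h1 fun r hr => by
      rw [hfb]
      exact (mul_le_mul_of_nonneg_left (hfle r hr) (Real.exp_pos _).le).trans (hle r hr)
    have h3 : 0 ≤ Real.exp (-(k * b)) * (f' - k * M) := by rw [hfb] at h2; linarith
    have h4 := nonneg_of_mul_nonneg_right h3 (Real.exp_pos _)
    linarith
  have hbd : L * (|eta a b| + ‖del a b‖) < k * M := by
    have h1 : |eta a b| ≤ M := le_max_left _ _
    have h2 : ‖del a b‖ ≤ M := le_max_right _ _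
    nlinarith
  rcases le_total ‖del a b‖ |eta a b| with h | h
  · have hMe : M = |eta a b| := max_eq_left h
    obtain ⟨e', he, hle'⟩ := heta' a ha b ⟨hb0, hb.2⟩
    have hne : eta a b ≠ 0 := by rw [hMe] at hpos; exact abs_pos.1 hpos
    rcases hne.lt_or_gt with hneg | hpos'
    · have := touch (fun r => -eta a r) (-e') he.neg (by rw [hMe, abs_of_neg hneg])
        fun r _ => (neg_le_abs _).trans (le_max_left _ _)
      linarith [neg_le_abs e']
    · have := touch (fun r => eta a r) e' he (by rw [hMe, abs_of_pos hpos'])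
        fun r _ => (le_abs_self _).trans (le_max_left _ _)
      linarith [le_abs_self e']
  · have hMd : M = ‖del a b‖ := max_eq_right h
    have hane0 : 0 < a := by
      rcases ha.1.eq_or_lt with h' | h'
      · rw [hMd, ← h', hleft b hb] at hpos; simp at hpos
      · exact h'
    have hane1 : a < 1 := by
      rcases ha.2.eq_or_lt with h' | h'
      · rw [hMd, h', hright b hb] at hpos; simp at hpos
      · exact h'
    obtain ⟨ds, dtt, dt, h1, h2, h3, h4⟩ := hdel' a ⟨hane0, hane1⟩ b ⟨hb0, hb.2⟩
    set e : E := M⁻¹ • del a b with he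
    have hne : ‖e‖ = 1 := by
      rw [he, norm_smul, norm_inv, Real.norm_of_nonneg hpos.le, hMd, inv_mul_cancel₀]
      rw [← hMd]; exact hpos.ne'
    have hproj : ∀ v : E, inner ℝ e v ≤ ‖v‖ := fun v => by
      simpa [hne] using real_inner_le_norm e v
    have heM : inner ℝ e (del a b) = M := by
      rw [he, real_inner_smul_left, real_inner_self_eq_norm_sq, ← hMd]
      field_simp
    have hs1 : HasDerivAt (fun r => inner ℝ e (del a r)) (inner ℝ e ds) b :=
        (innerSL ℝ e).hasFDerivAt.comp_hasDerivAt b h1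
    have hkM := touch _ _ hs1 heM fun r _ => (hproj _).trans (le_max_right _ _)
    have hd1 : ∀ x ∈ Ioo (0 : ℝ) 1,
        HasDerivAt (fun y => inner ℝ e (del y b)) (inner ℝ e (dt x)) x := fun x hx =>
        (innerSL ℝ e).hasFDerivAt.comp_hasDerivAt x (h2 x hx)
    have hd2 : HasDerivAt (fun y => inner ℝ e (dt y)) (inner ℝ e dtt) a :=
        (innerSL ℝ e).hasFDerivAt.comp_hasDerivAt a h3
    have hlm : IsLocalMax (fun y => inner ℝ e (del y b)) a := by
      filter_upwards [Icc_mem_nhds hane0 hane1] with y hy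
      rw [heM]
      have h5 := hmax (show (y, b) ∈ _ from ⟨hy, hb⟩)
      have h6 : max |eta y b| ‖del y b‖ ≤ M :=
        le_of_mul_le_mul_left (show Real.exp (-(k * b)) * _ ≤ Real.exp (-(k * b)) * _ from h5)
          (Real.exp_pos _)
      exact (hproj _).trans ((le_max_right _ _).trans h6)
    have hdd := deriv_deriv_nonpos_of_isLocalMax hlm (hd1 a ⟨hane0, hane1⟩).continuousAt
    have hde : deriv (fun y => inner ℝ e (del y b)) =ᶠ[𝓝 a] fun y => inner ℝ e (dt y) := by
      filter_upwards [Ioo_mem_nhds hane0 hane1] with y hy using (hd1 y hy).deriv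
    rw [hde.deriv_eq, hd2.deriv] at hdd
    have h7 : inner ℝ e ds - inner ℝ e dtt ≤ ‖ds - dtt‖ := by
      rw [← inner_sub_right]; exact hproj _
    linarith

end

/-! ### Gaussian averages of bounded measurable functions -/

section

/-- The heat kernel on `ℝ` at time one. -/
def kap (z : ℝ) : ℝ := (√(4 * Real.pi))⁻¹ * Real.exp (-(1 / 4) * z ^ 2)

/-- The first derivative of `kap`. -/
def kap₁ (z : ℝ) : ℝ := -(z / 2) * kap z

/-- The second derivative of `kap`. -/
def kap₂ (z : ℝ) : ℝ := (z ^ 2 / 4 - 1 / 2) * kap z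

/-- A continuous weight with a Gaussian bound; the constants are those that fit `kap` and its
first two derivatives. -/
structure IsGaussWeight (w : ℝ → ℝ) : Prop where
  cont : Continuous w
  bound : ∀ z, |w z| ≤ 8 * Real.exp (-(1 / 8) * z ^ 2)

/-- The common bound `∫ 8 exp(-z²/8)` of the `L¹` norms of Gaussian weights. -/
def gaussMass : ℝ := ∫ z : ℝ, 8 * Real.exp (-(1 / 8) * z ^ 2)

theorem gaussMass_nonneg : 0 ≤ gaussMass := integral_nonneg fun z => by positivity

theorem integrable_gauss {b : ℝ} (hb : 0 < b) (B : ℝ) :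
    Integrable fun z : ℝ => B * Real.exp (-b * z ^ 2) :=
  (integrable_exp_neg_mul_sq hb).const_mul B

theorem kap_nonneg (z : ℝ) : 0 ≤ kap z := by unfold kap; positivity

theorem poly_mul_kap_le (z : ℝ) : (1 + z ^ 2) * kap z ≤ 8 * Real.exp (-(1 / 8) * z ^ 2) := by
  have h1 : (√(4 * Real.pi))⁻¹ ≤ 1 := by
    refine inv_le_one_of_one_le₀ (Real.one_le_sqrt.2 ?_)
    linarith [Real.pi_gt_three]
  have h2 : 1 + z ^ 2 ≤ 8 * Real.exp ((1 / 8) * z ^ 2) := by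
    linarith [Real.add_one_le_exp ((1 / 8) * z ^ 2), sq_nonneg z]
  have h3 : Real.exp (-(1 / 4) * z ^ 2) * Real.exp ((1 / 8) * z ^ 2) =
      Real.exp (-(1 / 8) * z ^ 2) := by rw [← Real.exp_add]; ring_nf
  unfold kap
  calc (1 + z ^ 2) * ((√(4 * Real.pi))⁻¹ * Real.exp (-(1 / 4) * z ^ 2))
      ≤ (8 * Real.exp ((1 / 8) * z ^ 2)) * (1 * Real.exp (-(1 / 4) * z ^ 2)) := by gcongr
    _ = 8 * Real.exp (-(1 / 8) * z ^ 2) := by rw [← h3]; ring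

theorem isGaussWeight_kap : IsGaussWeight kap where
  cont := by unfold kap; fun_prop
  bound z := by
    rw [abs_of_nonneg (kap_nonneg z)]
    refine le_trans ?_ (poly_mul_kap_le z)
    nlinarith [kap_nonneg z, mul_nonneg (sq_nonneg z) (kap_nonneg z)]

theorem isGaussWeight_kap₁ : IsGaussWeight kap₁ where
  cont := by unfold kap₁ kap; fun_prop
  bound z := by
    refine le_trans ?_ (poly_mul_kap_le z)
    rw [kap₁, abs_mul, abs_of_nonneg (kap_nonneg z)]
    refine mul_le_mul_of_nonneg_right ?_ (kap_nonneg z)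
    rw [abs_le]
    constructor <;> nlinarith [sq_nonneg (z + 1), sq_nonneg (z - 1)]

theorem isGaussWeight_kap₂ : IsGaussWeight kap₂ where
  cont := by unfold kap₂ kap; fun_prop
  bound z := by
    refine le_trans ?_ (poly_mul_kap_le z)
    rw [kap₂, abs_mul, abs_of_nonneg (kap_nonneg z)]
    refine mul_le_mul_of_nonneg_right ?_ (kap_nonneg z)
    rw [abs_le]
    constructor <;> nlinarith [sq_nonneg z]

theorem integral_kap : ∫ z, kap z = 1 := by
  unfold kap
  rw [integral_const_mul, integral_gaussian]
  have h : Real.pi / (1 / 4) = 4 * Real.pi := by ring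
  rw [h]
  exact inv_mul_cancel₀ (by positivity)

theorem hasDerivAt_kap (z : ℝ) : HasDerivAt kap (kap₁ z) z := by
  have h : HasDerivAt (fun z : ℝ => (√(4 * Real.pi))⁻¹ * Real.exp (-(1 / 4) * z ^ 2))
      ((√(4 * Real.pi))⁻¹ * (Real.exp (-(1 / 4) * z ^ 2) * (-(1 / 4) * (2 * z)))) z := by
    have := (((hasDerivAt_pow 2 z).const_mul (-(1 / 4) : ℝ)).exp).const_mul (√(4 * Real.pi))⁻¹
    simpa using this
  refine HasDerivAt.congr_deriv h ?_
  unfold kap₁ kap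
  ring

theorem hasDerivAt_kap₁ (z : ℝ) : HasDerivAt kap₁ (kap₂ z) z := by
  have h : HasDerivAt (fun z : ℝ => -(z / 2) * kap z) (-(1 / 2) * kap z + -(z / 2) * kap₁ z) z :=
    ((hasDerivAt_id z).div_const 2).neg.mul (hasDerivAt_kap z)
  refine HasDerivAt.congr_deriv h ?_
  unfold kap₂ kap₁
  ring

theorem kap_neg (z : ℝ) : kap (-z) = kap z := by simp [kap]

variable {E : Type*} [NormedAddCommGroup E] [NormedSpace ℝ E]

/-- The average `∫ w(z) g(x - ρ z) dz`. For `w = kap` and `ρ = √σ` this is the solution at time `σ`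
of the heat equation on the line with initial value `g`. -/
def gaussConv (w : ℝ → ℝ) (ρ : ℝ) (g : ℝ → E) (x : ℝ) : E := ∫ z, w z • g (x - ρ * z)

theorem gaussConv_eq {w : ℝ → ℝ} {ρ : ℝ} (hρ : 0 < ρ) (g : ℝ → E) (x : ℝ) :
    gaussConv w ρ g x = ∫ y, (ρ⁻¹ * w ((x - y) / ρ)) • g y := by
  have h1 : ∫ y, (ρ⁻¹ * w ((x - y) / ρ)) • g y = ∫ y, (ρ⁻¹ * w (y / ρ)) • g (x - y) := by
    rw [← integral_sub_left_eq_self _ volume x]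
    simp
  have h2 := Measure.integral_comp_mul_left (fun y => (ρ⁻¹ * w (y / ρ)) • g (x - y)) ρ
  rw [h1, gaussConv]
  rw [abs_of_pos (inv_pos.2 hρ)] at h2
  have h3 : ∫ y, (ρ⁻¹ * w (y / ρ)) • g (x - y) =
      ρ • ∫ z, (ρ⁻¹ * w (ρ * z / ρ)) • g (x - ρ * z) := by
    rw [h2, smul_smul, mul_inv_cancel₀ hρ.ne', one_smul]
  rw [h3, ← integral_smul]
  congr 1
  ext z
  rw [smul_smul, mul_div_cancel_left₀ _ hρ.ne', ← mul_assoc, mul_inv_cancel₀ hρ.ne', one_mul]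

theorem norm_gaussConv_le {w : ℝ → ℝ} (hw : IsGaussWeight w) {g : ℝ → E} {M : ℝ}
    (hg : ∀ y, ‖g y‖ ≤ M) (ρ x : ℝ) : ‖gaussConv w ρ g x‖ ≤ gaussMass * M := by
  have hM : 0 ≤ M := (norm_nonneg _).trans (hg 0)
  unfold gaussConv gaussMass
  rw [← integral_mul_const]
  refine norm_integral_le_of_norm_le ((integrable_gauss (by norm_num) 8).mul_const M)
    (ae_of_all _ fun z => ?_)
  rw [norm_smul, Real.norm_eq_abs]
  exact mul_le_mul (hw.bound z) (hg _) (norm_nonneg _) (by positivity)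

theorem gaussConv_zero (g : ℝ → E) [CompleteSpace E] (x : ℝ) : gaussConv kap 0 g x = g x := by
  simp only [gaussConv, zero_mul, sub_zero]
  rw [integral_smul_const, integral_kap, one_smul]

/-- A function that is odd about `a` has vanishing Gaussian averages at `a`. -/
theorem gaussConv_kap_eq_zero_of_odd {g : ℝ → E} {a : ℝ} (hg : ∀ y, g (a - y) = -g (a + y))
    (ρ : ℝ) : gaussConv kap ρ g a = 0 := by
  have h : gaussConv kap ρ g a = -gaussConv kap ρ g a := by
    conv_lhs => rw [gaussConv, ← integral_neg_eq_self]
    rw [gaussConv, ← integral_neg]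
    congr 1
    ext z
    rw [kap_neg, hg (ρ * z), smul_neg, neg_neg]
    ring_nf
  have h2 : (2 : ℝ) • gaussConv kap ρ g a = 0 := by
    rw [two_smul]; nth_rewrite 1 [h]; simp
  exact (smul_eq_zero.1 h2).resolve_left two_ne_zero

/-- Gaussian domination of rescaled weights, locally uniformly in position and scale. -/
theorem gaussWeight_dominated {w : ℝ → ℝ} (hw : IsGaussWeight w) {x₀ ρ₀ x ρ : ℝ} (hρ₀ : 0 < ρ₀)
    (hx : |x - x₀| < 1) (hρ : ρ ∈ Ioo (ρ₀ / 2) (2 * ρ₀)) (y : ℝ) :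
    |w ((x - y) / ρ)| ≤
      8 * Real.exp (1 / (32 * ρ₀ ^ 2)) * Real.exp (-(1 / (64 * ρ₀ ^ 2)) * (y - x₀) ^ 2) := by
  refine (hw.bound _).trans ?_
  rw [mul_assoc, ← Real.exp_add]
  have hρ0 : 0 < ρ := by linarith [hρ.1]
  gcongr
  have h1 : (y - x₀) ^ 2 ≤ 2 * (x - y) ^ 2 + 2 := by
    have := (abs_lt.1 hx)
    nlinarith [sq_nonneg ((x - y) + (x - x₀)), sq_nonneg ((x - y) - (x - x₀)),
      mul_nonneg (sub_nonneg.2 this.1.le) (sub_nonneg.2 this.2.le)]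
  have h2 : ((x - y) / ρ) ^ 2 ≥ (x - y) ^ 2 / (4 * ρ₀ ^ 2) := by
    rw [div_pow]
    gcongr
    nlinarith [hρ.2, hρ.1]
  have h3 : (x - y) ^ 2 / (4 * ρ₀ ^ 2) ≥ ((y - x₀) ^ 2 / 2 - 1) / (4 * ρ₀ ^ 2) := by
    gcongr; linarith
  have h4 : 1 / (32 * ρ₀ ^ 2) + -(1 / (64 * ρ₀ ^ 2)) * (y - x₀) ^ 2 =
      -(1 / 8) * (((y - x₀) ^ 2 / 2 - 1) / (4 * ρ₀ ^ 2)) := by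
    field_simp; ring
  rw [h4]; linarith

theorem integrable_dominant (x₀ : ℝ) {ρ₀ : ℝ} (hρ₀ : 0 < ρ₀) (C : ℝ) :
    Integrable fun y => C * Real.exp (-(1 / (64 * ρ₀ ^ 2)) * (y - x₀) ^ 2) :=
  (integrable_gauss (b := 1 / (64 * ρ₀ ^ 2)) (by positivity) C).comp_sub_right x₀

variable [MeasurableSpace E] [BorelSpace E] [SecondCountableTopology E]

theorem integrable_gaussConv {w : ℝ → ℝ} (hw : IsGaussWeight w) {g : ℝ → E} (hgm : Measurable g)
    {M : ℝ} (hg : ∀ y, ‖g y‖ ≤ M) (ρ x : ℝ) : Integrable fun z => w z • g (x - ρ * z) := by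
  refine ((integrable_gauss (b := 1 / 8) (by norm_num) 8).mul_const M).mono' ?_
    (ae_of_all _ fun z => ?_)
  · have := hw.cont.measurable
    exact Measurable.aestronglyMeasurable (by fun_prop)
  · rw [norm_smul, Real.norm_eq_abs]
    exact mul_le_mul (hw.bound z) (hg _) (norm_nonneg _) (by positivity)

theorem gaussConv_sub {w : ℝ → ℝ} (hw : IsGaussWeight w) {g₁ g₂ : ℝ → E}
    (hm₁ : Measurable g₁) (hm₂ : Measurable g₂) {M₁ M₂ : ℝ} (h₁ : ∀ y, ‖g₁ y‖ ≤ M₁)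
    (h₂ : ∀ y, ‖g₂ y‖ ≤ M₂) (ρ x : ℝ) :
    gaussConv w ρ (fun y => g₁ y - g₂ y) x = gaussConv w ρ g₁ x - gaussConv w ρ g₂ x := by
  unfold gaussConv
  rw [← integral_sub (integrable_gaussConv hw hm₁ h₁ ρ x) (integrable_gaussConv hw hm₂ h₂ ρ x)]
  simp only [smul_sub]

theorem stronglyMeasurable_gaussConv {w : ℝ → ℝ} (hw : IsGaussWeight w) {f : ℝ → ℝ → E}
    (hf : Measurable fun p : ℝ × ℝ => f p.1 p.2) {ρ : ℝ → ℝ} (hρ : Measurable ρ) (x : ℝ) :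
    StronglyMeasurable fun r => gaussConv w (ρ r) (fun y => f y r) x := by
  have hwm := hw.cont.measurable
  have : Measurable fun p : ℝ × ℝ => w p.2 • f (x - ρ p.1 * p.2) p.1 :=
    (hwm.comp measurable_snd).smul (hf.comp (by fun_prop :
      Measurable fun p : ℝ × ℝ => (x - ρ p.1 * p.2, p.1)))
  exact this.stronglyMeasurable.integral_prod_right'

/-- Gaussian averages depend continuously on position and (positive) scale. -/
theorem continuousAt_gaussConv {w : ℝ → ℝ} (hw : IsGaussWeight w) {g : ℝ → E} (hgm : Measurable g)
    {M : ℝ} (hg : ∀ y, ‖g y‖ ≤ M) (x₀ : ℝ) {ρ₀ : ℝ} (hρ₀ : 0 < ρ₀) :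
    ContinuousAt (fun p : ℝ × ℝ => gaussConv w p.2 g p.1) (x₀, ρ₀) := by
  have hM : 0 ≤ M := (norm_nonneg _).trans (hg 0)
  have hwm := hw.cont.measurable
  have hnear : ∀ᶠ p : ℝ × ℝ in 𝓝 (x₀, ρ₀), |p.1 - x₀| < 1 ∧ p.2 ∈ Ioo (ρ₀ / 2) (2 * ρ₀) := by
    have h1 : ∀ᶠ x in 𝓝 x₀, |x - x₀| < 1 := Metric.ball_mem_nhds x₀ one_pos
    have h2 : ∀ᶠ ρ in 𝓝 ρ₀, ρ ∈ Ioo (ρ₀ / 2) (2 * ρ₀) :=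
      Ioo_mem_nhds (by linarith) (by linarith)
    exact h1.prod_nhds h2
  have hc : ContinuousAt (fun p : ℝ × ℝ => ∫ y, (p.2⁻¹ * w ((p.1 - y) / p.2)) • g y) (x₀, ρ₀) := by
    refine continuousAt_of_dominated (bound := fun y => (2 / ρ₀ * (8 * Real.exp (1 / (32 * ρ₀ ^ 2))
      * M)) * Real.exp (-(1 / (64 * ρ₀ ^ 2)) * (y - x₀) ^ 2)) ?_ ?_ (integrable_dominant x₀ hρ₀ _)
      (ae_of_all _ fun y => ?_)
    · exact Eventually.of_forall fun p => Measurable.aestronglyMeasurable (by fun_prop)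
    · filter_upwards [hnear] with p hp
      refine ae_of_all _ fun y => ?_
      have hp0 : 0 < p.2 := by linarith [hp.2.1]
      rw [norm_smul, norm_mul, norm_inv, Real.norm_of_nonneg hp0.le, Real.norm_eq_abs]
      have h1 := gaussWeight_dominated hw hρ₀ hp.1 hp.2 y
      have h2 : p.2⁻¹ ≤ 2 / ρ₀ := by
        rw [inv_le_comm₀ hp0 (by positivity), inv_div]; exact hp.2.1.le
      calc p.2⁻¹ * |w ((p.1 - y) / p.2)| * ‖g y‖ ≤ 2 / ρ₀ * (8 * Real.exp (1 / (32 * ρ₀ ^ 2)) *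
            Real.exp (-(1 / (64 * ρ₀ ^ 2)) * (y - x₀) ^ 2)) * M := by
              gcongr; exact hg y
        _ = _ := by ring
    · have hwc := hw.cont.continuousAt (x := (x₀ - y) / ρ₀)
      have h1 : ContinuousAt (fun p : ℝ × ℝ => (p.1 - y) / p.2) (x₀, ρ₀) :=
        (by fun_prop : ContinuousAt (fun p : ℝ × ℝ => p.1 - y) (x₀, ρ₀)).div
          continuousAt_snd hρ₀.ne'
      exact ((continuousAt_snd.inv₀ hρ₀.ne').mul
        (ContinuousAt.comp (f := fun p : ℝ × ℝ => (p.1 - y) / p.2) hwc h1)).smul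
        continuousAt_const
  refine hc.congr ?_
  filter_upwards [hnear] with p hp
  rw [gaussConv_eq (by linarith [hp.2.1])]

/-- At scale zero the averages are continuous wherever the averaged function is. -/
theorem continuousAt_gaussConv_zero {w : ℝ → ℝ} (hw : IsGaussWeight w) {g : ℝ → E}
    (hgm : Measurable g) {M : ℝ} (hg : ∀ y, ‖g y‖ ≤ M) {x₀ : ℝ} (hgc : ContinuousAt g x₀) :
    ContinuousAt (fun p : ℝ × ℝ => gaussConv w p.2 g p.1) (x₀, 0) := by
  have hwm := hw.cont.measurable
  refine continuousAt_of_dominated (bound := fun z => 8 * Real.exp (-(1 / 8) * z ^ 2) * M) ?_ ?_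
    ((integrable_gauss (b := 1 / 8) (by norm_num) 8).mul_const M) (ae_of_all _ fun z => ?_)
  · exact Eventually.of_forall fun p => Measurable.aestronglyMeasurable (by fun_prop)
  · refine Eventually.of_forall fun p => ae_of_all _ fun z => ?_
    rw [norm_smul, Real.norm_eq_abs]
    exact mul_le_mul (hw.bound z) (hg _) (norm_nonneg _) (by positivity)
  · refine continuousAt_const.smul (ContinuousAt.comp' (g := g) ?_ (by fun_prop))
    simpa using hgc

theorem hasDerivAt_gaussConv {w w' : ℝ → ℝ} (hw : IsGaussWeight w) (hw' : IsGaussWeight w')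
    (hd : ∀ z, HasDerivAt w (w' z) z) {g : ℝ → E} (hgm : Measurable g)
    {M : ℝ} (hg : ∀ y, ‖g y‖ ≤ M) {ρ : ℝ} (hρ : 0 < ρ) (x₀ : ℝ) :
    HasDerivAt (fun x => gaussConv w ρ g x) (ρ⁻¹ • gaussConv w' ρ g x₀) x₀ := by
  have hM : 0 ≤ M := (norm_nonneg _).trans (hg 0)
  have hwm := hw.cont.measurable
  have hwm' := hw'.cont.measurable
  have hbase : ∀ {v : ℝ → ℝ}, IsGaussWeight v → ∀ x, |x - x₀| < 1 → ∀ y,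
      ‖(ρ⁻¹ * v ((x - y) / ρ)) • g y‖ ≤ (ρ⁻¹ * (8 * Real.exp (1 / (32 * ρ ^ 2)) * M)) *
        Real.exp (-(1 / (64 * ρ ^ 2)) * (y - x₀) ^ 2) := by
    intro v hv x hx y
    rw [norm_smul, norm_mul, norm_inv, Real.norm_of_nonneg hρ.le, Real.norm_eq_abs]
    have h1 := gaussWeight_dominated hv hρ hx (ρ := ρ) ⟨by linarith, by linarith⟩ y
    calc _ ≤ ρ⁻¹ * (8 * Real.exp (1 / (32 * ρ ^ 2)) *
          Real.exp (-(1 / (64 * ρ ^ 2)) * (y - x₀) ^ 2)) * M := by gcongr; exact hg y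
      _ = _ := by ring
  have key := (hasDerivAt_integral_of_dominated_loc_of_deriv_le (μ := volume)
    (F := fun x y => (ρ⁻¹ * w ((x - y) / ρ)) • g y)
    (F' := fun x y => ρ⁻¹ • (ρ⁻¹ * w' ((x - y) / ρ)) • g y)
    (bound := fun y => (ρ⁻¹ * (ρ⁻¹ * (8 * Real.exp (1 / (32 * ρ ^ 2)) * M))) *
        Real.exp (-(1 / (64 * ρ ^ 2)) * (y - x₀) ^ 2))
    (Metric.ball_mem_nhds x₀ one_pos)
    (Eventually.of_forall fun x => Measurable.aestronglyMeasurable (by fun_prop))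
    ((integrable_dominant x₀ hρ _).mono' (Measurable.aestronglyMeasurable (by fun_prop))
      (ae_of_all _ (hbase hw x₀ (by simp))))
    (Measurable.aestronglyMeasurable (by fun_prop))
    (ae_of_all _ fun y x hx => ?_) (integrable_dominant x₀ hρ _)
    (ae_of_all _ fun y x _ => ?_)).2
  · rw [integral_smul, ← gaussConv_eq hρ] at key
    refine key.congr_of_eventuallyEq (Eventually.of_forall fun x => ?_)
    exact gaussConv_eq hρ g x
  · rw [norm_smul, norm_inv, Real.norm_of_nonneg hρ.le, mul_assoc ρ⁻¹ (ρ⁻¹ * _)]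
    exact mul_le_mul_of_nonneg_left (hbase hw' x hx y) (by positivity)
  · have h1 : HasDerivAt (fun x => (x - y) / ρ) (1 / ρ) x :=
      ((hasDerivAt_id x).sub_const y).div_const ρ
    have h2 := (((hd ((x - y) / ρ)).comp x h1).const_mul ρ⁻¹).smul_const (g y)
    refine HasDerivAt.congr_deriv h2 ?_
    rw [smul_smul]
    congr 1
    ring

theorem hasDerivAt_gaussConv_scale {g : ℝ → E} (hgm : Measurable g)
    {M : ℝ} (hg : ∀ y, ‖g y‖ ≤ M) (x₀ : ℝ) {ρ₀ : ℝ} (hρ₀ : 0 < ρ₀) :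
    HasDerivAt (fun ρ => gaussConv kap ρ g x₀) ((2 * ρ₀⁻¹) • gaussConv kap₂ ρ₀ g x₀) ρ₀ := by
  have hM : 0 ≤ M := (norm_nonneg _).trans (hg 0)
  have hwm := isGaussWeight_kap.cont.measurable
  have hwm' := isGaussWeight_kap₂.cont.measurable
  have hs : Ioo (ρ₀ / 2) (2 * ρ₀) ∈ 𝓝 ρ₀ := Ioo_mem_nhds (by linarith) (by linarith)
  have hbase : ∀ {v : ℝ → ℝ}, IsGaussWeight v → ∀ ρ ∈ Ioo (ρ₀ / 2) (2 * ρ₀), ∀ y,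
      ‖(ρ⁻¹ * v ((x₀ - y) / ρ)) • g y‖ ≤ (2 / ρ₀ * (8 * Real.exp (1 / (32 * ρ₀ ^ 2)) * M)) *
        Real.exp (-(1 / (64 * ρ₀ ^ 2)) * (y - x₀) ^ 2) := by
    intro v hv ρ hρ y
    have hp0 : 0 < ρ := by linarith [hρ.1]
    have h2 : ρ⁻¹ ≤ 2 / ρ₀ := by
      rw [inv_le_comm₀ hp0 (by positivity), inv_div]; exact hρ.1.le
    rw [norm_smul, norm_mul, norm_inv, Real.norm_of_nonneg hp0.le, Real.norm_eq_abs]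
    have h1 := gaussWeight_dominated hv hρ₀ (x := x₀) (x₀ := x₀) (by simp) hρ y
    calc _ ≤ 2 / ρ₀ * (8 * Real.exp (1 / (32 * ρ₀ ^ 2)) *
          Real.exp (-(1 / (64 * ρ₀ ^ 2)) * (y - x₀) ^ 2)) * M := by gcongr; exact hg y
      _ = _ := by ring
  have key := (hasDerivAt_integral_of_dominated_loc_of_deriv_le (μ := volume)
    (F := fun ρ y => (ρ⁻¹ * kap ((x₀ - y) / ρ)) • g y)
    (F' := fun ρ y => (2 * ρ⁻¹) • (ρ⁻¹ * kap₂ ((x₀ - y) / ρ)) • g y)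
    (bound := fun y => (2 * (2 / ρ₀) * (2 / ρ₀ * (8 * Real.exp (1 / (32 * ρ₀ ^ 2)) * M))) *
        Real.exp (-(1 / (64 * ρ₀ ^ 2)) * (y - x₀) ^ 2)) hs
    (Eventually.of_forall fun x => Measurable.aestronglyMeasurable (by fun_prop))
    ((integrable_dominant x₀ hρ₀ _).mono' (Measurable.aestronglyMeasurable (by fun_prop))
      (ae_of_all _ (hbase isGaussWeight_kap ρ₀ (mem_of_mem_nhds hs))))
    (Measurable.aestronglyMeasurable (by fun_prop))
    (ae_of_all _ fun y ρ hρ => ?_) (integrable_dominant x₀ hρ₀ _)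
    (ae_of_all _ fun y ρ hρ => ?_)).2
  · rw [integral_smul, ← gaussConv_eq hρ₀] at key
    refine key.congr_of_eventuallyEq ?_
    filter_upwards [hs] with ρ hρ
    exact gaussConv_eq (by linarith [hρ.1]) g x₀
  · have hp0 : 0 < ρ := by linarith [hρ.1]
    have h2 : ρ⁻¹ ≤ 2 / ρ₀ := by
      rw [inv_le_comm₀ hp0 (by positivity), inv_div]; exact hρ.1.le
    rw [norm_smul, norm_mul, norm_inv, Real.norm_of_nonneg hp0.le, Real.norm_two, mul_assoc
      (2 * (2 / ρ₀)) _ (Real.exp _)]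
    refine mul_le_mul (by gcongr) (hbase isGaussWeight_kap₂ ρ hρ y) (norm_nonneg _) (by positivity)
  · have hp0 : ρ ≠ 0 := by linarith [hρ.1]
    have h1 : HasDerivAt (fun ρ => (x₀ - y) / ρ) (-(x₀ - y) / ρ ^ 2) ρ := by
      have := (hasDerivAt_inv hp0).const_mul (x₀ - y)
      refine HasDerivAt.congr_deriv this ?_
      ring
    have h2 := ((hasDerivAt_inv hp0).mul ((hasDerivAt_kap ((x₀ - y) / ρ)).comp ρ h1)).smul_const
      (g y)
    refine HasDerivAt.congr_deriv h2 ?_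
    rw [smul_smul]
    congr 1
    simp only [Function.comp, kap₁, kap₂]
    field_simp
    ring

end

/-! ### The heat semigroup and the Duhamel integral -/

section

variable {E : Type*} [NormedAddCommGroup E] [NormedSpace ℝ E]

/-- The heat semigroup on the line. -/
def heat (σ : ℝ) (g : ℝ → E) (x : ℝ) : E := gaussConv kap (√σ) g x

/-- The first space derivative of `heat`. -/
def heat₁ (σ : ℝ) (g : ℝ → E) (x : ℝ) : E := (√σ)⁻¹ • gaussConv kap₁ (√σ) g x

/-- The second space derivative, and the time derivative, of `heat`. -/
def heat₂ (σ : ℝ) (g : ℝ → E) (x : ℝ) : E := σ⁻¹ • gaussConv kap₂ (√σ) g x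

theorem norm_heat_le {g : ℝ → E} {M : ℝ} (hg : ∀ y, ‖g y‖ ≤ M) (σ x : ℝ) :
    ‖heat σ g x‖ ≤ gaussMass * M := norm_gaussConv_le isGaussWeight_kap hg _ _

theorem norm_heat₁_le {g : ℝ → E} {M : ℝ} (hg : ∀ y, ‖g y‖ ≤ M) (σ x : ℝ) :
    ‖heat₁ σ g x‖ ≤ gaussMass * M * (√σ)⁻¹ := by
  rw [heat₁, norm_smul, norm_inv, Real.norm_of_nonneg (Real.sqrt_nonneg _), mul_comm]
  gcongr
  exact norm_gaussConv_le isGaussWeight_kap₁ hg _ _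

theorem norm_heat₂_le {g : ℝ → E} {M : ℝ} (hg : ∀ y, ‖g y‖ ≤ M) {σ : ℝ} (hσ : 0 < σ) (x : ℝ) :
    ‖heat₂ σ g x‖ ≤ gaussMass * M * σ⁻¹ := by
  rw [heat₂, norm_smul, norm_inv, Real.norm_of_nonneg hσ.le, mul_comm]
  gcongr
  exact norm_gaussConv_le isGaussWeight_kap₂ hg _ _

theorem heat_zero [CompleteSpace E] (g : ℝ → E) (x : ℝ) : heat 0 g x = g x := by
  rw [heat, Real.sqrt_zero, gaussConv_zero]

section Measurable
variable [MeasurableSpace E] [BorelSpace E] [SecondCountableTopology E]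

theorem hasDerivAt_heat {g : ℝ → E} (hgm : Measurable g) {M : ℝ} (hg : ∀ y, ‖g y‖ ≤ M) {σ : ℝ}
    (hσ : 0 < σ) (x : ℝ) : HasDerivAt (heat σ g) (heat₁ σ g x) x :=
  hasDerivAt_gaussConv isGaussWeight_kap isGaussWeight_kap₁ hasDerivAt_kap hgm hg
    (Real.sqrt_pos.2 hσ) x

theorem hasDerivAt_heat₁ {g : ℝ → E} (hgm : Measurable g) {M : ℝ} (hg : ∀ y, ‖g y‖ ≤ M) {σ : ℝ}
    (hσ : 0 < σ) (x : ℝ) : HasDerivAt (heat₁ σ g) (heat₂ σ g x) x := by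
  have := (hasDerivAt_gaussConv isGaussWeight_kap₁ isGaussWeight_kap₂ hasDerivAt_kap₁ hgm hg
    (Real.sqrt_pos.2 hσ) x).const_smul (√σ)⁻¹
  refine HasDerivAt.congr_deriv this ?_
  rw [smul_smul, ← mul_inv, Real.mul_self_sqrt hσ.le, heat₂]

theorem hasDerivAt_heat_time {g : ℝ → E} (hgm : Measurable g) {M : ℝ} (hg : ∀ y, ‖g y‖ ≤ M) {σ : ℝ}
    (hσ : 0 < σ) (x : ℝ) : HasDerivAt (fun τ => heat τ g x) (heat₂ σ g x) σ := by
  have h1 := (hasDerivAt_gaussConv_scale hgm hg x (Real.sqrt_pos.2 hσ)).scomp σ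
    (Real.hasDerivAt_sqrt hσ.ne')
  refine HasDerivAt.congr_deriv h1 ?_
  rw [smul_smul, heat₂]
  congr 1
  have h2 : √σ ^ 2 = σ := Real.sq_sqrt hσ.le
  have h3 : √σ ≠ 0 := (Real.sqrt_pos.2 hσ).ne'
  have : σ⁻¹ = (√σ ^ 2)⁻¹ := by rw [h2]
  rw [this]
  field_simp

theorem norm_heat_add_sub_le_sqrt {g : ℝ → E} (hgm : Measurable g) {M : ℝ} (hg : ∀ y, ‖g y‖ ≤ M)
    {σ h : ℝ} (hσ : 0 < σ) (hh : 0 ≤ h) (x : ℝ) :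
    ‖heat (σ + h) g x - heat σ g x‖ ≤ 2 * gaussMass * M * √h * (√σ)⁻¹ := by
  have hM : 0 ≤ M := (norm_nonneg _).trans (hg 0)
  have hG := gaussMass_nonneg
  have hpos := Real.sqrt_pos.2 hσ
  have hle : √σ ≤ √(σ + h) := Real.sqrt_le_sqrt (by linarith)
  have key : ‖gaussConv kap (√(σ + h)) g x - gaussConv kap (√σ) g x‖ ≤
      (2 * gaussMass * M * (√σ)⁻¹) * ‖√(σ + h) - √σ‖ := by
    refine (convex_Icc (√σ) (√(σ + h))).norm_image_sub_le_of_norm_hasDerivWithin_le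
      (f := fun ρ => gaussConv kap ρ g x) (fun ρ hρ => (hasDerivAt_gaussConv_scale hgm hg x
        (hpos.trans_le hρ.1)).hasDerivWithinAt) (fun ρ hρ => ?_)
      (left_mem_Icc.2 hle) (right_mem_Icc.2 hle)
    have hρ0 := hpos.trans_le hρ.1
    rw [norm_smul, norm_mul, norm_inv, Real.norm_of_nonneg hρ0.le, Real.norm_two]
    calc 2 * ρ⁻¹ * ‖gaussConv kap₂ ρ g x‖ ≤ 2 * (√σ)⁻¹ * (gaussMass * M) := by
          gcongr
          · exact hρ.1
          · exact norm_gaussConv_le isGaussWeight_kap₂ hg _ _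
      _ = _ := by ring
  refine key.trans ?_
  have h2 : ‖√(σ + h) - √σ‖ ≤ √h := by
    rw [Real.norm_of_nonneg (by linarith)]
    have h3 : √(σ + h) ≤ √σ + √h := Real.sqrt_le_iff.2 ⟨by positivity, by
      nlinarith [Real.sq_sqrt hσ.le, Real.sq_sqrt hh,
        mul_nonneg (Real.sqrt_nonneg σ) (Real.sqrt_nonneg h)]⟩
    linarith
  calc _ ≤ (2 * gaussMass * M * (√σ)⁻¹) * √h := by gcongr
    _ = _ := by ring

theorem norm_heat_add_sub_le {g : ℝ → E} (hgm : Measurable g) {M : ℝ} (hg : ∀ y, ‖g y‖ ≤ M)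
    {σ h : ℝ} (hσ : 0 < σ) (hh : 0 ≤ h) (x : ℝ) :
    ‖heat (σ + h) g x - heat σ g x‖ ≤ gaussMass * M * σ⁻¹ * h := by
  have hM : 0 ≤ M := (norm_nonneg _).trans (hg 0)
  have hG := gaussMass_nonneg
  have key := (convex_Icc σ (σ + h)).norm_image_sub_le_of_norm_hasDerivWithin_le
      (f := fun τ => heat τ g x) (C := gaussMass * M * σ⁻¹) (fun τ hτ =>
        (hasDerivAt_heat_time hgm hg (hσ.trans_le hτ.1) x).hasDerivWithinAt) (fun τ hτ => by
          refine (norm_heat₂_le hg (hσ.trans_le hτ.1) x).trans ?_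
          gcongr
          exact hτ.1)
      (left_mem_Icc.2 (by linarith)) (right_mem_Icc.2 (by linarith : σ ≤ σ + h))
  rwa [add_sub_cancel_left, Real.norm_of_nonneg hh] at key

/-- Gaussian averages of a uniformly convergent family at converging positions and scales. -/
theorem tendsto_gaussConv {ι : Type*} {l : Filter ι} {w : ℝ → ℝ} (hw : IsGaussWeight w)
    {g : ι → ℝ → E} {g₀ : ℝ → E} (hgm : ∀ i, Measurable (g i)) (hgm₀ : Measurable g₀)
    {M : ℝ} (hg : ∀ i y, ‖g i y‖ ≤ M) (hg₀ : ∀ y, ‖g₀ y‖ ≤ M) {e : ι → ℝ}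
    (he : Tendsto e l (𝓝 0)) (hge : ∀ᶠ i in l, ∀ y, ‖g i y - g₀ y‖ ≤ e i)
    {x ρ : ι → ℝ} {x₀ ρ₀ : ℝ} (hρ₀ : 0 < ρ₀) (hx : Tendsto x l (𝓝 x₀)) (hρ : Tendsto ρ l (𝓝 ρ₀)) :
    Tendsto (fun i => gaussConv w (ρ i) (g i) (x i)) l (𝓝 (gaussConv w ρ₀ g₀ x₀)) := by
  have h1 : Tendsto (fun i => gaussConv w (ρ i) g₀ (x i)) l (𝓝 (gaussConv w ρ₀ g₀ x₀)) :=
    (continuousAt_gaussConv hw hgm₀ hg₀ x₀ hρ₀).tendsto.comp (hx.prodMk_nhds hρ)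
  have h2 : Tendsto (fun i => gaussConv w (ρ i) (g i) (x i) - gaussConv w (ρ i) g₀ (x i)) l
      (𝓝 0) := by
    refine squeeze_zero_norm' ?_ (by simpa using he.const_mul gaussMass)
    filter_upwards [hge] with i hi
    rw [← gaussConv_sub hw (hgm i) hgm₀ (hg i) hg₀]
    exact norm_gaussConv_le hw hi _ _
  simpa using h2.add h1

end Measurable

theorem ae_ne (s : ℝ) : ∀ᵐ r : ℝ, r ≠ s := by
  simpa using (countable_singleton s).ae_notMem volume

theorem intervalIntegrable_inv_sqrt {s : ℝ} (hs : 0 ≤ s) :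
    IntervalIntegrable (fun r => (√r)⁻¹) volume 0 s := by
  refine intervalIntegral.intervalIntegrable_deriv_of_nonneg (g := fun r => 2 * √r)
    (by fun_prop) (fun r hr => ?_) (fun r _ => by positivity)
  rw [min_eq_left hs] at hr
  refine HasDerivAt.congr_deriv ((Real.hasDerivAt_sqrt hr.1.ne').const_mul 2) ?_
  field_simp

theorem integral_inv_sqrt {s : ℝ} (hs : 0 ≤ s) : ∫ r in 0..s, (√r)⁻¹ = 2 * √s := by
  rw [intervalIntegral.integral_eq_sub_of_hasDerivAt_of_le hs (f := fun r => 2 * √r)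
    (by fun_prop) (fun r hr => ?_) (intervalIntegrable_inv_sqrt hs)]
  · simp
  refine HasDerivAt.congr_deriv ((Real.hasDerivAt_sqrt hr.1.ne').const_mul 2) ?_
  field_simp

theorem intervalIntegrable_inv_sqrt_sub {s : ℝ} (hs : 0 ≤ s) :
    IntervalIntegrable (fun r => (√(s - r))⁻¹) volume 0 s := by
  have := ((intervalIntegrable_inv_sqrt hs).comp_sub_left s).symm
  simpa using this

theorem integral_inv_sqrt_sub {s : ℝ} (hs : 0 ≤ s) : ∫ r in 0..s, (√(s - r))⁻¹ = 2 * √s := by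
  rw [intervalIntegral.integral_comp_sub_left (fun r => (√r)⁻¹) s]
  simpa using integral_inv_sqrt hs

/-- The Duhamel integral: the solution of `∂ₛu = ∂ₜ²u + f` on the line with zero initial value. -/
def duhamel (f : ℝ → ℝ → E) (x s : ℝ) : E := ∫ r in 0..s, heat (s - r) (fun y => f y r) x

/-- The space derivative of the Duhamel integral. -/
def duhamel₁ (f : ℝ → ℝ → E) (x s : ℝ) : E := ∫ r in 0..s, heat₁ (s - r) (fun y => f y r) x

/-- The time derivative of the Duhamel integral. Subtracting the source at the final time makes
the singularity of `heat₂` at `r = s` integrable for Hölder continuous sources. -/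
def duhamelTime (f : ℝ → ℝ → E) (x s : ℝ) : E :=
  (∫ r in 0..s, heat₂ (s - r) (fun y => f y r - f y s) x) + heat s (fun y => f y s) x

theorem measurable_slice {F : Type*} [MeasurableSpace F] {f : ℝ → ℝ → F}
    (hf : Measurable fun p : ℝ × ℝ => f p.1 p.2) (r : ℝ) :
    Measurable fun y => f y r := hf.comp (measurable_id.prodMk measurable_const)

theorem norm_duhamel₁_le {f : ℝ → ℝ → E} {M : ℝ} (hM : ∀ x r, ‖f x r‖ ≤ M) {s : ℝ} (hs : 0 ≤ s)
    (x : ℝ) : ‖duhamel₁ f x s‖ ≤ 2 * gaussMass * M * √s := by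
  have := intervalIntegral.norm_integral_le_of_norm_le hs
    (f := fun r => heat₁ (s - r) (fun y => f y r) x)
    (ae_of_all _ fun r _ => norm_heat₁_le (fun y => hM y r) (s - r) x)
    ((intervalIntegrable_inv_sqrt_sub hs).const_mul _)
  refine this.trans_eq ?_
  rw [intervalIntegral.integral_const_mul, integral_inv_sqrt_sub hs]
  ring

section Duhamel
variable [MeasurableSpace E] [BorelSpace E] [SecondCountableTopology E]
variable {f : ℝ → ℝ → E} {M : ℝ}

theorem stronglyMeasurable_heat (hf : Measurable fun p : ℝ × ℝ => f p.1 p.2) {σ : ℝ → ℝ}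
    (hσ : Measurable σ) (x : ℝ) : StronglyMeasurable fun r => heat (σ r) (fun y => f y r) x :=
  stronglyMeasurable_gaussConv isGaussWeight_kap hf hσ.sqrt x

theorem stronglyMeasurable_heat₁ (hf : Measurable fun p : ℝ × ℝ => f p.1 p.2) {σ : ℝ → ℝ}
    (hσ : Measurable σ) (x : ℝ) : StronglyMeasurable fun r => heat₁ (σ r) (fun y => f y r) x :=
  (hσ.sqrt.inv.stronglyMeasurable).smul
    (stronglyMeasurable_gaussConv isGaussWeight_kap₁ hf hσ.sqrt x)

theorem stronglyMeasurable_heat₂ (hf : Measurable fun p : ℝ × ℝ => f p.1 p.2) {σ : ℝ → ℝ}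
    (hσ : Measurable σ) (x : ℝ) : StronglyMeasurable fun r => heat₂ (σ r) (fun y => f y r) x :=
  (hσ.inv.stronglyMeasurable).smul
    (stronglyMeasurable_gaussConv isGaussWeight_kap₂ hf hσ.sqrt x)

theorem intervalIntegrable_heat (hf : Measurable fun p : ℝ × ℝ => f p.1 p.2)
    (hM : ∀ x r, ‖f x r‖ ≤ M) {σ : ℝ → ℝ} (hσ : Measurable σ) (x a b : ℝ) :
    IntervalIntegrable (fun r => heat (σ r) (fun y => f y r) x) volume a b :=
  (intervalIntegrable_const (c := gaussMass * M)).mono_fun'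
    (stronglyMeasurable_heat hf hσ x).aestronglyMeasurable
    (Eventually.of_forall fun r => norm_heat_le (fun y => hM y r) _ _)

theorem norm_duhamel_sub_le {f₁ f₂ : ℝ → ℝ → E} {M₁ M₂ : ℝ}
    (hf₁ : Measurable fun p : ℝ × ℝ => f₁ p.1 p.2) (hf₂ : Measurable fun p : ℝ × ℝ => f₂ p.1 p.2)
    (h₁ : ∀ x r, ‖f₁ x r‖ ≤ M₁) (h₂ : ∀ x r, ‖f₂ x r‖ ≤ M₂) {b : ℝ → ℝ} {s : ℝ} (hs : 0 ≤ s)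
    (hb : IntervalIntegrable b volume 0 s) (hle : ∀ x, ∀ r ∈ Icc 0 s, ‖f₁ x r - f₂ x r‖ ≤ b r)
    (x : ℝ) : ‖duhamel f₁ x s - duhamel f₂ x s‖ ≤ gaussMass * ∫ r in 0..s, b r := by
  have hσ : Measurable fun r => s - r := by fun_prop
  unfold duhamel
  rw [← intervalIntegral.integral_sub (intervalIntegrable_heat hf₁ h₁ hσ x 0 s)
    (intervalIntegrable_heat hf₂ h₂ hσ x 0 s), ← intervalIntegral.integral_const_mul]
  refine intervalIntegral.norm_integral_le_of_norm_le hs (ae_of_all _ fun r hr => ?_)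
    (hb.const_mul _)
  rw [heat, heat, ← gaussConv_sub isGaussWeight_kap (measurable_slice hf₁ r)
    (measurable_slice hf₂ r) (fun y => h₁ y r) (fun y => h₂ y r)]
  exact norm_gaussConv_le isGaussWeight_kap (fun y => hle y r (Ioc_subset_Icc_self hr)) _ _

theorem norm_duhamel_add_sub_le (hf : Measurable fun p : ℝ × ℝ => f p.1 p.2)
    (hM : ∀ x r, ‖f x r‖ ≤ M) (x : ℝ) {s h : ℝ} (hs : 0 ≤ s) (hh : 0 ≤ h) :
    ‖duhamel f x (s + h) - duhamel f x s‖ ≤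
      gaussMass * M * h + 4 * gaussMass * M * √h * √s := by
  have h1 := intervalIntegrable_heat hf hM (σ := fun r => s + h - r) (by fun_prop) x
  have h2 := intervalIntegrable_heat hf hM (σ := fun r => s - r) (by fun_prop) x
  unfold duhamel
  rw [← intervalIntegral.integral_add_adjacent_intervals (h1 0 s) (h1 s (s + h)),
    add_sub_right_comm, ← intervalIntegral.integral_sub (h1 0 s) (h2 0 s), add_comm]
  refine (norm_add_le _ _).trans (add_le_add ?_ ?_)
  · have := intervalIntegral.norm_integral_le_of_norm_le_const (a := s) (b := s + h)
      (f := fun r => heat (s + h - r) (fun y => f y r) x)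
      fun r _ => norm_heat_le (fun y => hM y r) (s + h - r) x
    simpa [abs_of_nonneg hh] using this
  · have := intervalIntegral.norm_integral_le_of_norm_le hs
      (f := fun r => heat (s + h - r) (fun y => f y r) x - heat (s - r) (fun y => f y r) x)
      ((ae_ne s).mono fun r hr hr' => (by
        have := norm_heat_add_sub_le_sqrt (measurable_slice hf r) (fun y => hM y r)
          (sub_pos.2 (lt_of_le_of_ne hr'.2 hr)) hh x
        rwa [sub_add_eq_add_sub] at this))
      ((intervalIntegrable_inv_sqrt_sub hs).const_mul _)
    refine this.trans_eq ?_
    rw [intervalIntegral.integral_const_mul, integral_inv_sqrt_sub hs]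
    ring

theorem hasDerivAt_duhamel (hf : Measurable fun p : ℝ × ℝ => f p.1 p.2)
    (hM : ∀ x r, ‖f x r‖ ≤ M) {s : ℝ} (hs : 0 ≤ s) (x : ℝ) :
    HasDerivAt (fun y => duhamel f y s) (duhamel₁ f x s) x := by
  have hσ : Measurable fun r => s - r := by fun_prop
  refine (intervalIntegral.hasDerivAt_integral_of_dominated_loc_of_deriv_le (s := univ)
    (F := fun x r => heat (s - r) (fun y => f y r) x)
    (F' := fun x r => heat₁ (s - r) (fun y => f y r) x) univ_mem
    (Eventually.of_forall fun x => (stronglyMeasurable_heat hf hσ x).aestronglyMeasurable)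
    (intervalIntegrable_heat hf hM hσ x 0 s)
    (stronglyMeasurable_heat₁ hf hσ x).aestronglyMeasurable
    (ae_of_all _ fun r _ x _ => norm_heat₁_le (fun y => hM y r) _ _)
    ((intervalIntegrable_inv_sqrt_sub hs).const_mul _)
    ((ae_ne s).mono fun r hr hr' x _ => ?_)).2
  rw [uIoc_of_le hs] at hr'
  exact hasDerivAt_heat (measurable_slice hf r) (fun y => hM y r)
    (sub_pos.2 (lt_of_le_of_ne hr'.2 hr)) x

theorem continuous_duhamel₁ (hf : Measurable fun p : ℝ × ℝ => f p.1 p.2)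
    (hM : ∀ x r, ‖f x r‖ ≤ M) {s : ℝ} (hs : 0 ≤ s) : Continuous fun x => duhamel₁ f x s := by
  have hσ : Measurable fun r => s - r := by fun_prop
  refine continuous_iff_continuousAt.2 fun x => ?_
  refine intervalIntegral.continuousAt_of_dominated_interval
    (F := fun x r => heat₁ (s - r) (fun y => f y r) x)
    (Eventually.of_forall fun x => (stronglyMeasurable_heat₁ hf hσ x).aestronglyMeasurable)
    (Eventually.of_forall fun x => ae_of_all _ fun r _ => norm_heat₁_le (fun y => hM y r) _ _)
    ((intervalIntegrable_inv_sqrt_sub hs).const_mul _)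
    ((ae_ne s).mono fun r hr hr' => ?_)
  rw [uIoc_of_le hs] at hr'
  exact (hasDerivAt_heat₁ (measurable_slice hf r) (fun y => hM y r)
    (sub_pos.2 (lt_of_le_of_ne hr'.2 hr)) x).continuousAt

theorem continuousOn_duhamel (hf : Measurable fun p : ℝ × ℝ => f p.1 p.2)
    (hM : ∀ x r, ‖f x r‖ ≤ M) :
    ContinuousOn (fun p : ℝ × ℝ => duhamel f p.1 p.2) (univ ×ˢ Ici 0) := by
  have hM0 : 0 ≤ M := (norm_nonneg _).trans (hM 0 0)
  have hG := gaussMass_nonneg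
  rintro ⟨x₀, s₀⟩ ⟨-, hs₀⟩
  have hs₀ : 0 ≤ s₀ := hs₀
  -- Lipschitz in space, Hölder in time
  have hx : ∀ x s, 0 ≤ s → ‖duhamel f x s - duhamel f x₀ s‖ ≤
      2 * gaussMass * M * √s * |x - x₀| := fun x s hs =>
    convex_univ.norm_image_sub_le_of_norm_hasDerivWithin_le
      (fun y _ => (hasDerivAt_duhamel hf hM hs y).hasDerivWithinAt)
      (fun y _ => norm_duhamel₁_le hM hs y) (mem_univ x₀) (mem_univ x)
  have ht : ∀ s, 0 ≤ s → ‖duhamel f x₀ s - duhamel f x₀ s₀‖ ≤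
      gaussMass * M * |s - s₀| + 4 * gaussMass * M * √|s - s₀| * √(max s s₀) := by
    intro s hs
    rcases le_total s₀ s with h | h
    · have := norm_duhamel_add_sub_le hf hM x₀ hs₀ (sub_nonneg.2 h)
      rw [add_sub_cancel] at this
      rw [abs_of_nonneg (sub_nonneg.2 h)]
      refine this.trans ?_
      gcongr
      exact le_max_right _ _
    · have := norm_duhamel_add_sub_le hf hM x₀ hs (sub_nonneg.2 h)
      rw [add_sub_cancel, norm_sub_rev] at this
      rw [abs_sub_comm, abs_of_nonneg (sub_nonneg.2 h)]
      refine this.trans ?_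
      gcongr
      exact le_max_left _ _
  have hlim : Tendsto (fun p : ℝ × ℝ => 2 * gaussMass * M * √p.2 * |p.1 - x₀| +
      (gaussMass * M * |p.2 - s₀| + 4 * gaussMass * M * √|p.2 - s₀| * √(max p.2 s₀)))
      (𝓝[univ ×ˢ Ici 0] (x₀, s₀)) (𝓝 0) := by
    have : Continuous (fun p : ℝ × ℝ => 2 * gaussMass * M * √p.2 * |p.1 - x₀| +
      (gaussMass * M * |p.2 - s₀| + 4 * gaussMass * M * √|p.2 - s₀| * √(max p.2 s₀))) := by
      fun_prop
    have h0 := (this.tendsto (x₀, s₀)).mono_left (nhdsWithin_le_nhds (s := univ ×ˢ Ici 0))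
    simpa using h0
  have : Tendsto (fun p : ℝ × ℝ => duhamel f p.1 p.2 - duhamel f x₀ s₀)
      (𝓝[univ ×ˢ Ici 0] (x₀, s₀)) (𝓝 0) := by
    refine squeeze_zero_norm' ?_ hlim
    filter_upwards [self_mem_nhdsWithin] with p hp
    rw [← sub_add_sub_cancel _ (duhamel f x₀ p.2)]
    exact (norm_add_le _ _).trans (add_le_add (hx p.1 p.2 hp.2) (ht p.2 hp.2))
  have h2 := this.add_const (duhamel f x₀ s₀)
  simp only [sub_add_cancel, zero_add] at h2
  exact h2

end Duhamel

end

/-! ### Time and second space derivatives of the Duhamel integral -/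

/-- A continuous right derivative is a derivative: subtract its integral. -/
theorem hasDerivAt_of_hasDerivWithinAt_Ici {E : Type*} [NormedAddCommGroup E] [NormedSpace ℝ E]
    [CompleteSpace E] {F W : ℝ → E} (hW : ContinuousOn W (Ioi 0))
    (hF : ContinuousOn F (Ioi 0)) (hd : ∀ s, 0 < s → HasDerivWithinAt F (W s) (Ici s) s)
    {s : ℝ} (hs : 0 < s) : HasDerivAt F (W s) s := by
  set a := s / 2 with ha
  have ha0 : 0 < a := by positivity
  have hint : ∀ r, 0 < r → IntervalIntegrable W volume a r := fun r hr =>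
    (hW.mono fun y hy => (lt_min ha0 hr).trans_le hy.1).intervalIntegrable
  have hI : ∀ r, 0 < r → HasDerivAt (fun t => ∫ y in a..t, W y) (W r) r := fun r hr =>
    intervalIntegral.integral_hasDerivAt_right (hint r hr)
      (hW.stronglyMeasurableAtFilter isOpen_Ioi r hr) (hW.continuousAt (Ioi_mem_nhds hr))
  have hconst : ∀ r ∈ Icc a (2 * s), F r - ∫ y in a..r, W y = F a - ∫ y in a..a, W y := by
    refine constant_of_has_deriv_right_zero (f := fun r => F r - ∫ y in a..r, W y) ?_ ?_
    · refine (hF.mono fun y hy => ha0.trans_le hy.1).sub fun r hr => ?_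
      exact (hI r (ha0.trans_le hr.1)).continuousAt.continuousWithinAt
    · intro r hr
      have h0 := ha0.trans_le hr.1
      have h1 := (hd r h0).sub (hI r h0).hasDerivWithinAt
      rw [sub_self] at h1
      exact h1
  have h1 : HasDerivAt (fun r => (F a - ∫ y in a..a, W y) + ∫ y in a..r, W y) (W s) s :=
    (hI s hs).const_add _
  refine h1.congr_of_eventuallyEq ?_
  filter_upwards [Icc_mem_nhds (show a < s by linarith) (show s < 2 * s by linarith)] with r hr
  rw [← hconst r hr, sub_add_cancel]

/-- Bounded measurable sources that are Hölder continuous of order `1/2` in time, uniformly in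
space, away from the initial time: on each `[a, b]` with `a > 0` the value at time `s` is
approached at rate `√(s - r)` from all earlier times `r ≥ 0`. -/
structure IsHolderSource {E : Type*} [NormedAddCommGroup E] [MeasurableSpace E]
    (f : ℝ → ℝ → E) (M : ℝ) : Prop where
  meas : Measurable fun p : ℝ × ℝ => f p.1 p.2
  bound : ∀ x r, ‖f x r‖ ≤ M
  holder : ∀ a b : ℝ, 0 < a → ∃ C, ∀ s ∈ Icc a b, ∀ r ∈ Icc 0 s, ∀ x,
    ‖f x r - f x s‖ ≤ C * √(s - r)

section Source
variable {E : Type*} [NormedAddCommGroup E] [MeasurableSpace E] {f : ℝ → ℝ → E} {M : ℝ}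

theorem IsHolderSource.measurable_sub [BorelSpace E] [SecondCountableTopology E]
    (hf : IsHolderSource f M) (s : ℝ) :
    Measurable fun p : ℝ × ℝ => f p.1 p.2 - f p.1 s :=
  hf.meas.sub (hf.meas.comp (measurable_fst.prodMk measurable_const))

theorem IsHolderSource.measurable_slice_sub [BorelSpace E] [SecondCountableTopology E]
    (hf : IsHolderSource f M) (s r : ℝ) : Measurable fun y => f y r - f y s :=
  (measurable_slice hf.meas r).sub (measurable_slice hf.meas s)

theorem IsHolderSource.bound_sub (hf : IsHolderSource f M) (x r s : ℝ) :
    ‖f x r - f x s‖ ≤ 2 * M :=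
  (norm_sub_le _ _).trans (by linarith [hf.bound x r, hf.bound x s])

theorem tendsto_holder_sub (hf : IsHolderSource f M) {a : ℝ} (ha : 0 < a) :
    ∃ e : ℝ → ℝ, Tendsto e (𝓝 a) (𝓝 0) ∧ ∀ᶠ s in 𝓝 a, ∀ y, ‖f y s - f y a‖ ≤ e s := by
  obtain ⟨C, hC⟩ := hf.holder (a / 2) (2 * a) (by positivity)
  refine ⟨fun s => C * √|s - a|, ?_, ?_⟩
  · have : Continuous fun s => C * √|s - a| := by fun_prop
    simpa using this.tendsto a
  · filter_upwards [Icc_mem_nhds (show a / 2 < a by linarith) (show a < 2 * a by linarith)]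
      with s hs y
    rcases le_total s a with h | h
    · have := hC a ⟨by linarith, by linarith⟩ s ⟨by linarith [hs.1], h⟩ y
      rwa [abs_sub_comm, abs_of_nonneg (sub_nonneg.2 h)]
    · have := hC s hs a ⟨ha.le, h⟩ y
      rwa [abs_of_nonneg (sub_nonneg.2 h), norm_sub_rev]

end Source

theorem inv_mul_sqrt {σ : ℝ} (hσ : 0 < σ) : σ⁻¹ * √σ = (√σ)⁻¹ := by
  have h2 : √σ ^ 2 = σ := Real.sq_sqrt hσ.le
  have h3 : √σ ≠ 0 := (Real.sqrt_pos.2 hσ).ne'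
  have : σ⁻¹ = (√σ ^ 2)⁻¹ := by rw [h2]
  rw [this]
  field_simp

theorem norm_heat₂_le_of_holder {E : Type*} [NormedAddCommGroup E] [NormedSpace ℝ E]
    {g : ℝ → E} {C σ : ℝ} (hσ : 0 < σ) (hg : ∀ y, ‖g y‖ ≤ C * √σ) (x : ℝ) :
    ‖heat₂ σ g x‖ ≤ gaussMass * C * (√σ)⁻¹ := by
  refine (norm_heat₂_le hg hσ x).trans_eq ?_
  rw [← inv_mul_sqrt hσ]
  ring

/-- The singular part of `duhamelTime` as an integral over a fixed interval, with the singularity at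
the fixed point `σ = 0`; in this form it is continuous in `(x, s)` by dominated convergence. -/
theorem duhamelTime_singular_eq {E : Type*} [NormedAddCommGroup E] [NormedSpace ℝ E]
    {f : ℝ → ℝ → E} {x s b : ℝ} (hs : 0 ≤ s) (hsb : s ≤ b) :
    ∫ r in 0..s, heat₂ (s - r) (fun y => f y r - f y s) x =
      ∫ σ in Ioc 0 b, if σ ≤ s then heat₂ σ (fun y => f y (s - σ) - f y s) x else 0 := by
  have h1 := intervalIntegral.integral_comp_sub_left (a := 0) (b := s)
    (fun σ => heat₂ σ (fun y => f y (s - σ) - f y s) x) s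
  simp only [sub_sub_cancel, sub_self, sub_zero] at h1
  rw [h1, intervalIntegral.integral_of_le hs]
  have h2 : (fun σ => if σ ≤ s then heat₂ σ (fun y => f y (s - σ) - f y s) x else 0) =
      (Iic s).indicator fun σ => heat₂ σ (fun y => f y (s - σ) - f y s) x := by
    ext σ; simp [indicator_apply]
  rw [h2, setIntegral_indicator measurableSet_Iic, Ioc_inter_Iic, min_eq_right hsb]

section HolderSource
variable {E : Type*} [NormedAddCommGroup E] [NormedSpace ℝ E] [MeasurableSpace E] [BorelSpace E]
  [SecondCountableTopology E] {f : ℝ → ℝ → E} {M : ℝ}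

theorem heat_sub {g₁ g₂ : ℝ → E} (hm₁ : Measurable g₁) (hm₂ : Measurable g₂) {M₁ M₂ : ℝ}
    (h₁ : ∀ y, ‖g₁ y‖ ≤ M₁) (h₂ : ∀ y, ‖g₂ y‖ ≤ M₂) (σ x : ℝ) :
    heat σ (fun y => g₁ y - g₂ y) x = heat σ g₁ x - heat σ g₂ x :=
  gaussConv_sub isGaussWeight_kap hm₁ hm₂ h₁ h₂ _ _

theorem heat₁_sub {g₁ g₂ : ℝ → E} (hm₁ : Measurable g₁) (hm₂ : Measurable g₂) {M₁ M₂ : ℝ}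
    (h₁ : ∀ y, ‖g₁ y‖ ≤ M₁) (h₂ : ∀ y, ‖g₂ y‖ ≤ M₂) (σ x : ℝ) :
    heat₁ σ (fun y => g₁ y - g₂ y) x = heat₁ σ g₁ x - heat₁ σ g₂ x := by
  rw [heat₁, gaussConv_sub isGaussWeight_kap₁ hm₁ hm₂ h₁ h₂, smul_sub, heat₁, heat₁]

theorem continuousOn_heat_time {g : ℝ → E} (hgm : Measurable g) (hg : ∀ y, ‖g y‖ ≤ M) (x : ℝ) :
    ContinuousOn (fun σ => heat σ g x) (Ioi 0) := fun _ hσ =>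
  (hasDerivAt_heat_time hgm hg hσ x).continuousAt.continuousWithinAt

/-- The singular integral in the time derivative converges, and is the limit of the difference
quotients, by dominated convergence. -/
theorem tendsto_slope_singular (hf : IsHolderSource f M) (x : ℝ) {s : ℝ} (hs : 0 < s) :
    Tendsto (fun τ => ∫ r in 0..s, (τ - s)⁻¹ • (heat (τ - r) (fun y => f y r - f y s) x -
      heat (s - r) (fun y => f y r - f y s) x)) (𝓝[>] s)
      (𝓝 (∫ r in 0..s, heat₂ (s - r) (fun y => f y r - f y s) x)) := by
  obtain ⟨C, hC⟩ := hf.holder s s hs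
  have hd := hf.measurable_sub s
  refine intervalIntegral.tendsto_integral_filter_of_dominated_convergence
    (fun r => gaussMass * C * (√(s - r))⁻¹) ?_ ?_
    ((intervalIntegrable_inv_sqrt_sub hs.le).const_mul _) ?_
  · refine Eventually.of_forall fun τ => StronglyMeasurable.aestronglyMeasurable ?_
    exact (((stronglyMeasurable_heat hd (σ := fun r => τ - r) (by fun_prop) x)).sub
      (stronglyMeasurable_heat hd (σ := fun r => s - r) (by fun_prop) x)).const_smul _
  · filter_upwards [self_mem_nhdsWithin] with τ hτ
    have hτ0 : 0 < τ - s := sub_pos.2 hτ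
    filter_upwards [ae_ne s] with r hr hr'
    rw [uIoc_of_le hs.le] at hr'
    have hσ : 0 < s - r := sub_pos.2 (lt_of_le_of_ne hr'.2 hr)
    have := norm_heat_add_sub_le (hf.measurable_slice_sub s r)
      (fun y => hC s ⟨le_rfl, le_rfl⟩ r ⟨hr'.1.le, hr'.2⟩ y) hσ hτ0.le x
    rw [show s - r + (τ - s) = τ - r by ring] at this
    rw [norm_smul, norm_inv, Real.norm_of_nonneg hτ0.le]
    calc (τ - s)⁻¹ * _ ≤ (τ - s)⁻¹ * (gaussMass * (C * √(s - r)) * (s - r)⁻¹ * (τ - s)) := by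
          gcongr
      _ = gaussMass * C * ((s - r)⁻¹ * √(s - r)) := by field_simp
      _ = _ := by rw [inv_mul_sqrt hσ]
  · filter_upwards [ae_ne s] with r hr hr'
    rw [uIoc_of_le hs.le] at hr'
    have hσ : 0 < s - r := sub_pos.2 (lt_of_le_of_ne hr'.2 hr)
    have h1 := (hasDerivAt_heat_time (hf.measurable_slice_sub s r) (fun y => hf.bound_sub y r s) hσ
      x)
    have h2 : HasDerivAt (fun τ => heat (τ - r) (fun y => f y r - f y s) x)
        (heat₂ (s - r) (fun y => f y r - f y s) x) s := h1.comp_sub_const s r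
    exact (hasDerivAt_iff_tendsto_slope.1 h2).mono_left
      (nhdsWithin_mono _ fun y hy => (ne_of_gt hy))

/-- The source is frozen at a time `s`. At `τ = s` the first part is differentiated under the
integral, the second has derivative zero, and the third is differentiated in its end point. -/
theorem duhamel_eq_add (hf : IsHolderSource f M) (x s τ : ℝ) :
    duhamel f x τ = (∫ r in 0..s, heat (τ - r) (fun y => f y r - f y s) x) +
      (∫ r in s..τ, heat (τ - r) (fun y => f y r - f y s) x) +
      ∫ σ in 0..τ, heat σ (fun y => f y s) x := by
  have hm : Measurable fun r => τ - r := by fun_prop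
  have h1 := intervalIntegrable_heat (hf.measurable_sub s) (fun x r => hf.bound_sub x r s) hm x
  have h2 := intervalIntegrable_heat (f := fun y _ => f y s)
    (hf.meas.comp (measurable_fst.prodMk measurable_const)) (fun y _ => hf.bound y s) hm x 0 τ
  have h3 : ∫ σ in 0..τ, heat σ (fun y => f y s) x =
      ∫ r in 0..τ, heat (τ - r) (fun y => f y s) x := by
    rw [intervalIntegral.integral_comp_sub_left (fun σ => heat σ (fun y => f y s) x) τ]
    simp
  rw [h3, intervalIntegral.integral_add_adjacent_intervals (h1 0 s) (h1 s τ),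
    ← intervalIntegral.integral_add (h1 0 τ) h2, duhamel]
  refine intervalIntegral.integral_congr fun r _ => ?_
  rw [heat_sub (measurable_slice hf.meas r) (measurable_slice hf.meas s) (fun y => hf.bound y r)
    (fun y => hf.bound y s), sub_add_cancel]

theorem hasDerivWithinAt_duhamel_time [CompleteSpace E] (hf : IsHolderSource f M) (x : ℝ) {s : ℝ}
    (hs : 0 < s) :
    HasDerivWithinAt (fun τ => duhamel f x τ) (duhamelTime f x s) (Ici s) s := by
  have hG := gaussMass_nonneg
  have hm : ∀ τ : ℝ, Measurable fun r => τ - r := fun τ => by fun_prop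
  have hd := hf.measurable_sub s
  have h1 : HasDerivWithinAt (fun τ => ∫ r in 0..s, heat (τ - r) (fun y => f y r - f y s) x)
      (∫ r in 0..s, heat₂ (s - r) (fun y => f y r - f y s) x) (Ici s) s := by
    rw [← hasDerivWithinAt_Ioi_iff_Ici, hasDerivWithinAt_iff_tendsto_slope' (by simp)]
    refine (tendsto_slope_singular hf x hs).congr fun τ => ?_
    have hi := fun τ => intervalIntegrable_heat hd (fun x r => hf.bound_sub x r s) (hm τ) x 0 s
    rw [slope_def_module, intervalIntegral.integral_smul,
      intervalIntegral.integral_sub (hi τ) (hi s)]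
  have h2 : HasDerivWithinAt (fun τ => ∫ r in s..τ, heat (τ - r) (fun y => f y r - f y s) x)
      0 (Ici s) s := by
    obtain ⟨C, hC⟩ := hf.holder s (s + 1) hs
    rw [← hasDerivWithinAt_Ioi_iff_Ici, hasDerivWithinAt_iff_tendsto_slope' (by simp)]
    have hlim : Tendsto (fun τ => gaussMass * (|C| * √(τ - s))) (𝓝[>] s) (𝓝 0) := by
      have : Continuous fun τ => gaussMass * (|C| * √(τ - s)) := by fun_prop
      simpa using (this.tendsto s).mono_left nhdsWithin_le_nhds
    refine squeeze_zero_norm' ?_ hlim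
    filter_upwards [Ioo_mem_nhdsGT (show s < s + 1 by linarith)] with τ hτ
    have hτ0 : 0 < τ - s := sub_pos.2 hτ.1
    have hb := intervalIntegral.norm_integral_le_of_norm_le_const (a := s) (b := τ)
      (f := fun r => heat (τ - r) (fun y => f y r - f y s) x) (C := gaussMass * (|C| * √(τ - s)))
      (fun r hr => by
        rw [uIoc_of_le hτ.1.le] at hr
        refine norm_heat_le (fun y => ?_) _ _
        have := hC r ⟨hr.1.le, hr.2.trans hτ.2.le⟩ s ⟨hs.le, hr.1.le⟩ y
        rw [norm_sub_rev]
        refine this.trans ?_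
        gcongr
        · exact le_abs_self C
        · exact hr.2)
    rw [slope_def_module, intervalIntegral.integral_same, sub_zero, norm_smul, norm_inv,
      Real.norm_of_nonneg hτ0.le]
    rw [abs_of_nonneg hτ0.le] at hb
    calc (τ - s)⁻¹ * _ ≤ (τ - s)⁻¹ * (gaussMass * (|C| * √(τ - s)) * (τ - s)) := by gcongr
      _ = _ := by field_simp
  have h3 : HasDerivAt (fun τ => ∫ σ in 0..τ, heat σ (fun y => f y s) x)
      (heat s (fun y => f y s) x) s := by
    have hmeas : StronglyMeasurable fun σ => heat σ (fun y => f y s) x :=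
      stronglyMeasurable_heat (f := fun y _ => f y s)
        (hf.meas.comp (measurable_fst.prodMk measurable_const)) measurable_id x
    refine intervalIntegral.integral_hasDerivAt_right ?_ (hmeas.stronglyMeasurableAtFilter) ?_
    · exact intervalIntegrable_heat (f := fun y _ => f y s)
        (hf.meas.comp (measurable_fst.prodMk measurable_const)) (fun y _ => hf.bound y s)
        measurable_id x 0 s
    · exact (continuousOn_heat_time (measurable_slice hf.meas s)
        (fun y => hf.bound y s) x).continuousAt (Ioi_mem_nhds hs)
  have := (h1.add h2).add h3.hasDerivWithinAt
  rw [add_zero] at this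
  refine this.congr (fun τ _ => duhamel_eq_add hf x s τ) (duhamel_eq_add hf x s s)

theorem continuousOn_duhamelTime (hf : IsHolderSource f M) :
    ContinuousOn (fun p : ℝ × ℝ => duhamelTime f p.1 p.2) (univ ×ˢ Ioi 0) := by
  rintro ⟨x₀, s₀⟩ ⟨-, hs₀⟩
  have hs₀ : 0 < s₀ := hs₀
  refine ContinuousAt.continuousWithinAt ?_
  have hM : 0 ≤ M := (norm_nonneg _).trans (hf.bound 0 0)
  have hM2 : ∀ x r, ‖f x r‖ ≤ 2 * M := fun x r => (hf.bound x r).trans (by linarith)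
  have hfst : Tendsto (fun p : ℝ × ℝ => p.1) (𝓝 (x₀, s₀)) (𝓝 x₀) := continuousAt_fst
  have hsnd : Tendsto (fun p : ℝ × ℝ => p.2) (𝓝 (x₀, s₀)) (𝓝 s₀) := continuousAt_snd
  obtain ⟨e, he, hse⟩ := tendsto_holder_sub hf hs₀
  have hheat : ContinuousAt (fun p : ℝ × ℝ => heat p.2 (fun y => f y p.2) p.1) (x₀, s₀) :=
    tendsto_gaussConv (g := fun (p : ℝ × ℝ) y => f y p.2) isGaussWeight_kap
      (fun p => measurable_slice hf.meas p.2)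
      (measurable_slice hf.meas s₀) (fun p y => hf.bound y p.2) (fun y => hf.bound y s₀)
      (he.comp hsnd) (hsnd.eventually hse) (Real.sqrt_pos.2 hs₀) hfst hsnd.sqrt
  refine ContinuousAt.add ?_ hheat
  have hnear : ∀ᶠ p : ℝ × ℝ in 𝓝 (x₀, s₀), p.2 ∈ Icc (s₀ / 2) (2 * s₀) :=
    hsnd (Icc_mem_nhds (by linarith) (by linarith))
  obtain ⟨C, hC⟩ := hf.holder (s₀ / 2) (2 * s₀) (by positivity)
  suffices h : ContinuousAt (fun p : ℝ × ℝ => ∫ σ in Ioc 0 (2 * s₀),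
      if σ ≤ p.2 then heat₂ σ (fun y => f y (p.2 - σ) - f y p.2) p.1 else 0) (x₀, s₀) by
    refine h.congr ?_
    filter_upwards [hnear] with p hp
    exact (duhamelTime_singular_eq (by linarith [hp.1]) hp.2).symm
  have hmd : ∀ s : ℝ, Measurable fun p : ℝ × ℝ => f p.1 (s - p.2) - f p.1 s := fun s =>
    (hf.meas.comp (by fun_prop : Measurable fun p : ℝ × ℝ => (p.1, s - p.2))).sub
      (hf.meas.comp (measurable_fst.prodMk measurable_const))
  have hbd := ((intervalIntegrable_inv_sqrt (s := 2 * s₀) (by linarith)).const_mul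
    (gaussMass * |C|))
  rw [intervalIntegrable_iff_integrableOn_Ioc_of_le (by linarith)] at hbd
  refine continuousAt_of_dominated (bound := fun σ => gaussMass * |C| * (√σ)⁻¹) ?_ ?_ hbd ?_
  · refine Eventually.of_forall fun p => StronglyMeasurable.aestronglyMeasurable ?_
    exact StronglyMeasurable.ite measurableSet_Iic
      (stronglyMeasurable_heat₂ (hmd p.2) measurable_id p.1) stronglyMeasurable_const
  · filter_upwards [hnear] with p hp
    refine (ae_restrict_iff' measurableSet_Ioc).2 (ae_of_all _ fun σ hσ => ?_)
    have := gaussMass_nonneg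
    split_ifs with h
    · refine norm_heat₂_le_of_holder hσ.1 (fun y => ?_) _
      have h1 := hC p.2 hp (p.2 - σ) ⟨by linarith, by linarith [hσ.1]⟩ y
      rw [sub_sub_cancel] at h1
      refine h1.trans ?_
      gcongr
      exact le_abs_self C
    · rw [norm_zero]; positivity
  · refine (ae_restrict_iff' measurableSet_Ioc).2 ((ae_ne s₀).mono fun σ hne hσ => ?_)
    rcases hne.lt_or_gt with h | h
    · have h1 : (fun p : ℝ × ℝ => heat₂ σ (fun y => f y (p.2 - σ) - f y p.2) p.1) =ᶠ[𝓝 (x₀, s₀)]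
          fun p : ℝ × ℝ =>
            if σ ≤ p.2 then heat₂ σ (fun y => f y (p.2 - σ) - f y p.2) p.1 else 0 := by
        filter_upwards [hsnd.eventually (eventually_gt_nhds h)] with p hp
        rw [if_pos hp.le]
      refine ContinuousAt.congr ?_ h1
      obtain ⟨e', he', hse'⟩ := tendsto_holder_sub hf (sub_pos.2 h)
      have hsub : Tendsto (fun p : ℝ × ℝ => p.2 - σ) (𝓝 (x₀, s₀)) (𝓝 (s₀ - σ)) :=
        hsnd.sub_const σ
      refine Tendsto.const_smul (tendsto_gaussConv (M := 2 * M) (g := fun (p : ℝ × ℝ) y =>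
          f y (p.2 - σ) - f y p.2)
        (e := fun p : ℝ × ℝ => e' (p.2 - σ) + e p.2) isGaussWeight_kap₂
        (fun p => (measurable_slice hf.meas _).sub (measurable_slice hf.meas _))
        ((measurable_slice hf.meas _).sub (measurable_slice hf.meas _))
        (fun p y => hf.bound_sub y _ _) (fun y => hf.bound_sub y _ _)
        ?_ ?_ (Real.sqrt_pos.2 hσ.1) hfst tendsto_const_nhds) _
      · simpa using (he'.comp hsub).add (he.comp hsnd)
      · filter_upwards [hsub.eventually hse', hsnd.eventually hse] with p h1 h2 y
        change ‖f y (p.2 - σ) - f y p.2 - (f y (s₀ - σ) - f y s₀)‖ ≤ _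
        rw [sub_sub_sub_comm]
        exact (norm_sub_le _ _).trans (add_le_add (h1 y) (h2 y))
    · have h1 : (fun _ : ℝ × ℝ => (0 : E)) =ᶠ[𝓝 (x₀, s₀)] fun p : ℝ × ℝ =>
            if σ ≤ p.2 then heat₂ σ (fun y => f y (p.2 - σ) - f y p.2) p.1 else 0 := by
        filter_upwards [hsnd.eventually (eventually_lt_nhds h)] with p hp
        rw [if_neg hp.not_ge]
      exact continuousAt_const.congr h1

theorem hasDerivAt_duhamel_time [CompleteSpace E] (hf : IsHolderSource f M) (x : ℝ) {s : ℝ}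
    (hs : 0 < s) : HasDerivAt (fun τ => duhamel f x τ) (duhamelTime f x s) s := by
  refine hasDerivAt_of_hasDerivWithinAt_Ici (W := fun τ => duhamelTime f x τ) ?_ ?_
    (fun s hs => hasDerivWithinAt_duhamel_time hf x hs) hs
  · exact (continuousOn_duhamelTime hf).comp (f := fun τ : ℝ => (x, τ)) (by fun_prop)
      fun τ hτ => ⟨mem_univ _, hτ⟩
  · exact (continuousOn_duhamel hf.meas hf.bound).comp (f := fun τ : ℝ => (x, τ)) (by fun_prop)
      fun τ hτ => ⟨mem_univ _, mem_Ici.2 (le_of_lt hτ)⟩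

/-- `∫₀ˢ heat σ g dσ` has second space derivative `heat s g - g` where `g` is continuous: the
integral from `δ` has second derivative `heat s g - heat δ g`, and `δ → 0`. -/
theorem hasDerivAt_integral_heat₁ [CompleteSpace E] {g : ℝ → E} (hgm : Measurable g)
    (hg : ∀ y, ‖g y‖ ≤ M) {U : Set ℝ} (hU : IsOpen U) (hgc : ContinuousOn g U) {s : ℝ} (hs : 0 < s)
    {x : ℝ} (hx : x ∈ U) :
    HasDerivAt (fun y => ∫ σ in 0..s, heat₁ σ g y) (heat s g x - g x) x := by
  have hG := gaussMass_nonneg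
  have hmg : Measurable fun p : ℝ × ℝ => g p.1 := hgm.comp measurable_fst
  have hint : ∀ y a, 0 ≤ a → IntervalIntegrable (fun σ => heat₁ σ g y) volume 0 a := fun y a ha =>
    ((intervalIntegrable_inv_sqrt ha).const_mul (gaussMass * M)).mono_fun'
      (stronglyMeasurable_heat₁ (f := fun y _ => g y) hmg measurable_id y).aestronglyMeasurable
      (ae_of_all _ fun σ => norm_heat₁_le hg σ y)
  have hM : 0 ≤ M := (norm_nonneg _).trans (hg 0)
  have hδs : ∀ᶠ δ in 𝓝[>] (0 : ℝ), δ ∈ Ioo 0 s := Ioo_mem_nhdsGT hs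
  refine hasDerivAt_of_tendstoLocallyUniformlyOn (l := 𝓝[>] (0 : ℝ)) hU
    (f := fun δ y => ∫ σ in δ..s, heat₁ σ g y) (f' := fun δ y => heat s g y - heat δ g y)
    (g' := fun y => heat s g y - g y) ?_ ?_ ?_ hx
  · rw [Metric.tendstoLocallyUniformlyOn_iff]
    intro η hη y hy
    have hc := continuousAt_gaussConv_zero isGaussWeight_kap hgm hg
      (hgc.continuousAt (hU.mem_nhds hy))
    have h1 := hc.eventually (Metric.ball_mem_nhds _ (half_pos hη))
    simp only [gaussConv_zero] at h1
    rw [nhds_prod_eq, eventually_prod_iff] at h1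
    obtain ⟨pa, ha, pb, hb, hab⟩ := h1
    have h2 := (hgc.continuousAt (hU.mem_nhds hy)).eventually
      (Metric.ball_mem_nhds _ (half_pos hη))
    refine ⟨_, mem_nhdsWithin_of_mem_nhds (inter_mem ha h2), ?_⟩
    have hsq : Tendsto (fun δ : ℝ => √δ) (𝓝[>] 0) (𝓝 0) := by
      simpa using (Real.continuous_sqrt.tendsto 0).mono_left (nhdsWithin_le_nhds (s := Ioi 0))
    filter_upwards [hsq.eventually hb] with δ hδ z hz
    have h3 : dist (heat δ g z) (g y) < η / 2 := hab hz.1 hδ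
    have h4 : dist (g z) (g y) < η / 2 := hz.2
    rw [dist_sub_left]
    calc dist (g z) (heat δ g z) ≤ dist (g z) (g y) + dist (heat δ g z) (g y) :=
          dist_triangle_right _ _ _
      _ < η := by linarith
  · filter_upwards [hδs] with δ hδ y _
    have key := (intervalIntegral.hasDerivAt_integral_of_dominated_loc_of_deriv_le (s := univ)
      (μ := volume) (a := δ) (b := s) (x₀ := y)
      (F := fun x σ => heat₁ σ g x) (F' := fun x σ => heat₂ σ g x)
      (bound := fun _ => gaussMass * M * δ⁻¹) univ_mem
      (Eventually.of_forall fun x =>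
        (stronglyMeasurable_heat₁ (f := fun y _ => g y) hmg measurable_id x).aestronglyMeasurable)
      ((hint y s hs.le).mono_set (by
        rw [uIcc_of_le hδ.2.le, uIcc_of_le hs.le]; exact Icc_subset_Icc_left hδ.1.le))
      (stronglyMeasurable_heat₂ (f := fun y _ => g y) hmg measurable_id y).aestronglyMeasurable
      (ae_of_all _ fun σ hσ x _ => by
        rw [uIoc_of_le hδ.2.le] at hσ
        refine (norm_heat₂_le hg (hδ.1.trans hσ.1) x).trans ?_
        gcongr
        · exact hδ.1
        · exact hσ.1.le)
      intervalIntegrable_const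
      (ae_of_all _ fun σ hσ x _ => by
        rw [uIoc_of_le hδ.2.le] at hσ
        exact hasDerivAt_heat₁ hgm hg (hδ.1.trans hσ.1) x))
    have h5 : ∫ σ in δ..s, heat₂ σ g y = heat s g y - heat δ g y := by
      refine intervalIntegral.integral_eq_sub_of_hasDerivAt
        (f := fun σ => heat σ g y) (fun σ hσ => ?_) key.1
      rw [uIcc_of_le hδ.2.le] at hσ
      exact hasDerivAt_heat_time hgm hg (hδ.1.trans_le hσ.1) y
    rw [← h5]
    exact key.2
  · intro y _
    have h6 : Tendsto (fun δ => ∫ σ in 0..δ, heat₁ σ g y) (𝓝[>] 0) (𝓝 0) := by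
      have hlim : Tendsto (fun δ => gaussMass * M * (2 * √δ)) (𝓝[>] 0) (𝓝 0) := by
        have : Continuous fun δ => gaussMass * M * (2 * √δ) := by fun_prop
        simpa using (this.tendsto 0).mono_left nhdsWithin_le_nhds
      refine squeeze_zero_norm' ?_ hlim
      filter_upwards [self_mem_nhdsWithin] with δ hδ
      have hδ0 : 0 ≤ δ := le_of_lt hδ
      have := intervalIntegral.norm_integral_le_of_norm_le hδ0 (f := fun σ => heat₁ σ g y)
        (ae_of_all _ fun σ _ => norm_heat₁_le hg σ y)
        ((intervalIntegrable_inv_sqrt hδ0).const_mul _)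
      rwa [intervalIntegral.integral_const_mul, integral_inv_sqrt hδ0] at this
    have h7 := h6.const_sub (∫ σ in 0..s, heat₁ σ g y)
    rw [sub_zero] at h7
    refine h7.congr' ?_
    filter_upwards [hδs] with δ hδ
    exact intervalIntegral.integral_interval_sub_left (hint y s hs.le) (hint y δ hδ.1.le)

/-- The Duhamel integral solves the inhomogeneous heat equation where the source is continuous in
space: its second space derivative is its time derivative minus the source. -/
theorem hasDerivAt_duhamel₁ [CompleteSpace E] (hf : IsHolderSource f M) {s : ℝ} (hs : 0 < s)
    {U : Set ℝ} (hU : IsOpen U) (hfc : ContinuousOn (fun y => f y s) U) {x : ℝ} (hx : x ∈ U) :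
    HasDerivAt (fun y => duhamel₁ f y s) (duhamelTime f x s - f x s) x := by
  have hσ : Measurable fun r => s - r := by fun_prop
  have hd := hf.measurable_sub s
  obtain ⟨C, hC⟩ := hf.holder s s hs
  have hi : ∀ {f : ℝ → ℝ → E} {M : ℝ}, Measurable (fun p : ℝ × ℝ => f p.1 p.2) →
      (∀ x r, ‖f x r‖ ≤ M) → ∀ y, IntervalIntegrable
        (fun r => heat₁ (s - r) (fun y => f y r) y) volume 0 s := fun hfm hfb y =>
    ((intervalIntegrable_inv_sqrt_sub hs.le).const_mul _).mono_fun'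
      (stronglyMeasurable_heat₁ hfm hσ y).aestronglyMeasurable
      (ae_of_all _ fun r => norm_heat₁_le (fun z => hfb z r) _ y)
  have hsplit : ∀ y, duhamel₁ f y s =
      (∫ r in 0..s, heat₁ (s - r) (fun y => f y r - f y s) y) +
        ∫ σ in 0..s, heat₁ σ (fun y => f y s) y := by
    intro y
    have h1 := hi hd (fun x r => hf.bound_sub x r s) y
    have h2 := hi (f := fun y _ => f y s) (hf.meas.comp (measurable_fst.prodMk measurable_const))
      (fun y _ => hf.bound y s) y
    have h3 : ∫ σ in 0..s, heat₁ σ (fun y => f y s) y =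
        ∫ r in 0..s, heat₁ (s - r) (fun y => f y s) y := by
      rw [intervalIntegral.integral_comp_sub_left (fun σ => heat₁ σ (fun y => f y s) y) s]
      simp
    rw [h3, ← intervalIntegral.integral_add h1 h2, duhamel₁]
    refine intervalIntegral.integral_congr fun r _ => ?_
    rw [heat₁_sub (measurable_slice hf.meas r) (measurable_slice hf.meas s)
      (fun y => hf.bound y r) (fun y => hf.bound y s), sub_add_cancel]
  have hA := (intervalIntegral.hasDerivAt_integral_of_dominated_loc_of_deriv_le (s := univ)
    (μ := volume) (a := 0) (b := s) (x₀ := x)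
    (F := fun x r => heat₁ (s - r) (fun y => f y r - f y s) x)
    (F' := fun x r => heat₂ (s - r) (fun y => f y r - f y s) x)
    (bound := fun r => gaussMass * C * (√(s - r))⁻¹) univ_mem
    (Eventually.of_forall fun x => (stronglyMeasurable_heat₁ hd hσ x).aestronglyMeasurable)
    (hi hd (fun x r => hf.bound_sub x r s) x)
    (stronglyMeasurable_heat₂ hd hσ x).aestronglyMeasurable
    ((ae_ne s).mono fun r hr hr' y _ => by
      rw [uIoc_of_le hs.le] at hr'
      exact norm_heat₂_le_of_holder (sub_pos.2 (lt_of_le_of_ne hr'.2 hr))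
        (fun z => hC s ⟨le_rfl, le_rfl⟩ r ⟨hr'.1.le, hr'.2⟩ z) y)
    ((intervalIntegrable_inv_sqrt_sub hs.le).const_mul _)
    ((ae_ne s).mono fun r hr hr' y _ => by
      rw [uIoc_of_le hs.le] at hr'
      exact hasDerivAt_heat₁ (hf.measurable_slice_sub s r) (fun z => hf.bound_sub z r s)
        (sub_pos.2 (lt_of_le_of_ne hr'.2 hr)) y)).2
  have hB := hasDerivAt_integral_heat₁ (measurable_slice hf.meas s) (fun y => hf.bound y s) hU hfc
    hs hx
  refine HasDerivAt.congr_deriv ((hA.add hB).congr_of_eventuallyEq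
    (Eventually.of_forall hsplit)) ?_
  rw [duhamelTime, add_sub_assoc]

end HolderSource

/-! ### Odd periodic extension: the Dirichlet problem on `[0, 1]` -/

section

/-- The triangle wave: the even `2`-periodic continuation of the identity of `[0, 1]`. -/
def tri (x : ℝ) : ℝ := Real.arccos (Real.cos (Real.pi * x)) / Real.pi

/-- The odd `2`-periodic extension of (the restriction to `(0, 1)` of) a function. It vanishes at
the integers and may jump there. -/
def oddExt {E : Type*} [NormedAddCommGroup E] [NormedSpace ℝ E] (g : ℝ → E) (x : ℝ) : E :=
  Real.sign (Real.sin (Real.pi * x)) • g (tri x)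

theorem continuous_tri : Continuous tri := by
  unfold tri
  exact (Real.continuous_arccos.comp (by fun_prop)).div_const _

theorem tri_eq {x : ℝ} (hx : x ∈ Icc (0 : ℝ) 1) : tri x = x := by
  rw [tri, Real.arccos_cos (mul_nonneg Real.pi_pos.le hx.1)
    (by nlinarith [Real.pi_pos, hx.2]), mul_div_cancel_left₀ _ Real.pi_pos.ne']

theorem measurable_sign : Measurable Real.sign := by
  unfold Real.sign
  exact Measurable.ite measurableSet_Iio measurable_const
    (Measurable.ite measurableSet_Ioi measurable_const measurable_const)

theorem abs_sign_le_one (x : ℝ) : |Real.sign x| ≤ 1 := by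
  rcases Real.sign_apply_eq x with h | h | h <;> simp [h]

variable {E : Type*} [NormedAddCommGroup E] [NormedSpace ℝ E]

theorem oddExt_eq (g : ℝ → E) {x : ℝ} (hx : x ∈ Ioo (0 : ℝ) 1) : oddExt g x = g x := by
  have h1 : 0 < Real.sin (Real.pi * x) :=
    Real.sin_pos_of_pos_of_lt_pi (mul_pos Real.pi_pos hx.1) (by nlinarith [Real.pi_pos, hx.2])
  rw [oddExt, Real.sign_of_pos h1, one_smul, tri_eq (Ioo_subset_Icc_self hx)]

theorem oddExt_odd_zero (g : ℝ → E) (y : ℝ) : oddExt g (0 - y) = -oddExt g (0 + y) := by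
  simp [oddExt, tri, Real.sign_neg]

theorem oddExt_odd_one (g : ℝ → E) (y : ℝ) : oddExt g (1 - y) = -oddExt g (1 + y) := by
  have h1 : Real.pi * (1 - y) = Real.pi - Real.pi * y := by ring
  have h2 : Real.pi * (1 + y) = Real.pi * y + Real.pi := by ring
  simp [oddExt, tri, h1, h2, Real.sign_neg, Real.sin_pi_sub, Real.cos_pi_sub]

theorem oddExt_zero (g : ℝ → E) : oddExt g 0 = 0 := by simp [oddExt]

theorem oddExt_one (g : ℝ → E) : oddExt g 1 = 0 := by simp [oddExt]

theorem oddExt_eq_of_eq_zero {g : ℝ → E} (h0 : g 0 = 0) (h1 : g 1 = 0) {x : ℝ}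
    (hx : x ∈ Icc (0 : ℝ) 1) : oddExt g x = g x := by
  rcases hx.1.eq_or_lt with h | h
  · rw [← h, oddExt_zero, h0]
  rcases hx.2.eq_or_lt with h' | h'
  · rw [h', oddExt_one, h1]
  exact oddExt_eq g ⟨h, h'⟩

theorem norm_oddExt_le (g : ℝ → E) (x : ℝ) : ‖oddExt g x‖ ≤ ‖g (tri x)‖ := by
  rw [oddExt, norm_smul, Real.norm_eq_abs]
  exact mul_le_of_le_one_left (norm_nonneg _) (abs_sign_le_one _)

theorem norm_oddExt_sub_le (g₁ g₂ : ℝ → E) (x : ℝ) :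
    ‖oddExt g₁ x - oddExt g₂ x‖ ≤ ‖g₁ (tri x) - g₂ (tri x)‖ := by
  rw [oddExt, oddExt, ← smul_sub]
  exact norm_oddExt_le (fun y => g₁ y - g₂ y) x

theorem tri_eq_zero_or_one {x : ℝ} (hx : Real.sin (Real.pi * x) = 0) : tri x = 0 ∨ tri x = 1 := by
  rcases (Real.sin_eq_zero_iff_cos_eq.1 hx) with h | h
  · left; rw [tri, h]; simp
  · right; rw [tri, h]; simp [Real.pi_pos.ne']

theorem continuous_oddExt {g : ℝ → E} (hg : Continuous g) (h0 : g 0 = 0) (h1 : g 1 = 0) :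
    Continuous (oddExt g) := by
  refine continuous_iff_continuousAt.2 fun x => ?_
  have hs : Continuous fun x => Real.sin (Real.pi * x) := by fun_prop
  have hgt := (hg.comp continuous_tri).continuousAt (x := x)
  rcases lt_trichotomy (Real.sin (Real.pi * x)) 0 with h | h | h
  · refine ((continuousAt_const (y := (-1 : ℝ))).smul hgt).congr ?_
    filter_upwards [hs.continuousAt.eventually_lt_const h] with y hy
    rw [oddExt, Real.sign_of_neg hy]; rfl
  · have hz : g (tri x) = 0 := by
      rcases tri_eq_zero_or_one h with h' | h' <;> rw [h'] <;> assumption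
    have h2 : oddExt g x = 0 := by rw [oddExt, hz, smul_zero]
    rw [ContinuousAt, h2]
    refine squeeze_zero_norm (norm_oddExt_le g) ?_
    have := hgt.norm
    simpa [ContinuousAt, hz] using this
  · refine ((continuousAt_const (y := (1 : ℝ))).smul hgt).congr ?_
    filter_upwards [hs.continuousAt.eventually_const_lt h] with y hy
    rw [oddExt, Real.sign_of_pos hy]; rfl

theorem measurable_oddExt [MeasurableSpace E] [BorelSpace E] [SecondCountableTopology E]
    {f : ℝ → ℝ → E} (hf : Continuous fun p : ℝ × ℝ => f p.1 p.2) :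
    Measurable fun p : ℝ × ℝ => oddExt (fun y => f y p.2) p.1 := by
  have h1 : Measurable fun p : ℝ × ℝ => Real.sign (Real.sin (Real.pi * p.1)) :=
    measurable_sign.comp (by fun_prop)
  have h2 : Continuous fun p : ℝ × ℝ => f (tri p.1) p.2 :=
    hf.comp ((continuous_tri.comp continuous_fst).prodMk continuous_snd)
  exact h1.smul h2.measurable

/- The lemmas above are the interface of the extension; unification must not unfold it. -/
attribute [irreducible] oddExt

/-! ### Existence for bounded Lipschitz nonlinearities -/

section Mild
variable [MeasurableSpace E] [BorelSpace E] [SecondCountableTopology E]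

theorem continuous_heat {g : ℝ → E} (hg : Continuous g) {M : ℝ} (hM : ∀ y, ‖g y‖ ≤ M) :
    Continuous fun p : ℝ × ℝ => heat p.2 g p.1 := by
  refine continuous_iff_continuousAt.2 fun ⟨x, σ⟩ => ?_
  have h1 : ContinuousAt (fun p : ℝ × ℝ => gaussConv kap p.2 g p.1) (x, √σ) := by
    rcases (Real.sqrt_nonneg σ).eq_or_lt with h | h
    · rw [← h]
      exact continuousAt_gaussConv_zero isGaussWeight_kap hg.measurable hM hg.continuousAt
    · exact continuousAt_gaussConv isGaussWeight_kap hg.measurable hM x h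
  exact ContinuousAt.comp (f := fun p : ℝ × ℝ => (p.1, √p.2)) (x := (x, σ)) h1 (by fun_prop)

theorem continuous_heat_oddExt {u0 : ℝ → E} (hu0 : Continuous u0) {M : ℝ} (hM : ∀ t, ‖u0 t‖ ≤ M)
    (h0 : u0 0 = 0) (h1 : u0 1 = 0) :
    Continuous fun p : ℝ × ℝ => heat (max p.2 0) (oddExt u0) p.1 := by
  have h2 : Continuous fun p : ℝ × ℝ => heat p.2 (oddExt u0) p.1 :=
    continuous_heat (continuous_oddExt hu0 h0 h1) fun x => (norm_oddExt_le _ _).trans (hM _)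
  have h3 : Continuous fun p : ℝ × ℝ => (p.1, max p.2 0) := by fun_prop
  exact h2.comp h3

/-- A mild solution, with homogeneous boundary values, of the system
`lam' = A(lam, ℓ + u)`, `u' = ü + B(lam, ℓ + u)`. -/
structure IsMild (A : ℝ × E → ℝ) (B : ℝ × E → E) (lam0 : ℝ → ℝ) (u0 ℓ : ℝ → E)
    (lam : ℝ → ℝ → ℝ) (u : ℝ → ℝ → E) : Prop where
  lam_cont : Continuous fun p : ℝ × ℝ => lam p.1 p.2
  u_cont : Continuous fun p : ℝ × ℝ => u p.1 p.2
  lam_eq : ∀ t s, 0 ≤ s → lam t s = lam0 t + ∫ r in 0..s, A (lam t r, ℓ t + u t r)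
  u_eq : ∀ t s, 0 ≤ s → u t s = heat s (oddExt u0) t +
    duhamel (fun x r => oddExt (fun y => B (lam y r, ℓ y + u y r)) x) t s

theorem norm_duhamel_le {f : ℝ → ℝ → E} {M : ℝ} (hf : Measurable fun p : ℝ × ℝ => f p.1 p.2)
    (hM : ∀ x r, ‖f x r‖ ≤ M) (x : ℝ) {s : ℝ} (hs : 0 ≤ s) :
    ‖duhamel f x s‖ ≤ gaussMass * M * s := by
  have := norm_duhamel_add_sub_le hf hM x le_rfl hs
  simpa [duhamel] using this

theorem mul_exp_neg_le_one {k s : ℝ} (hk : 1 ≤ k) (hs : 0 ≤ s) : Real.exp (-(k * s)) * s ≤ 1 := by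
  rw [Real.exp_neg, inv_mul_le_iff₀ (Real.exp_pos _), mul_one]
  nlinarith [Real.add_one_le_exp (k * s)]

theorem exp_neg_mul_integral_exp_le {k s : ℝ} (hk : 0 < k) :
    Real.exp (-(k * s)) * ∫ r in 0..s, Real.exp (k * r) ≤ 1 / k := by
  rw [intervalIntegral.integral_comp_mul_left (fun r => Real.exp r) hk.ne', integral_exp,
    smul_eq_mul, mul_zero, Real.exp_zero, Real.exp_neg]
  have := Real.exp_pos (k * s)
  rw [one_div, mul_left_comm]
  refine mul_le_of_le_one_right (inv_nonneg.2 hk.le) ?_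
  rw [inv_mul_le_iff₀ this]; linarith

set_option maxHeartbeats 400000 in
/-- Mild solutions exist globally, by the contraction principle in the space of bounded continuous
functions, applied to the solution multiplied by `e^{-ks}` with a large `k`. -/
theorem exists_isMild [CompleteSpace E] {A : ℝ × E → ℝ} {B : ℝ × E → E} {L : NNReal}
    (hA : LipschitzWith L A) (hB : LipschitzWith L B) {M : ℝ} (hAM : ∀ x, |A x| ≤ M)
    (hBM : ∀ x, ‖B x‖ ≤ M)
    {lam0 : ℝ → ℝ} (hlam0 : Continuous lam0) {M₀ : ℝ} (hlamM : ∀ t, |lam0 t| ≤ M₀)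
    {u0 : ℝ → E} (hu0 : Continuous u0) (hu0M : ∀ t, ‖u0 t‖ ≤ M₀) (h0 : u0 0 = 0) (h1 : u0 1 = 0)
    {ℓ : ℝ → E} (hℓ : Continuous ℓ) : ∃ lam u, IsMild A B lam0 u0 ℓ lam u := by
  have hG := gaussMass_nonneg
  have hM : 0 ≤ M := (abs_nonneg _).trans (hAM 0)
  have hM₀ : 0 ≤ M₀ := (abs_nonneg _).trans (hlamM 0)
  -- the Lipschitz constant of the fixed point map is at most `L (1 + gaussMass) / k ≤ 1/2`
  set k : ℝ := 2 * L * (1 + gaussMass) + 1 with hk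
  have hL : (0 : ℝ) ≤ L := L.2
  have hk1 : 1 ≤ k := by have := mul_nonneg hL hG; rw [hk]; nlinarith
  have hk0 : 0 < k := by linarith
  -- `st V` is the state encoded by `V`, and `(P V, Q V)` the right-hand side of the mild equations
  let st : BoundedContinuousFunction (ℝ × ℝ) (ℝ × E) → ℝ → ℝ → ℝ × E := fun V t r =>
    (Real.exp (k * r) * (V (t, r)).1, ℓ t + Real.exp (k * r) • (V (t, r)).2)
  have hst : ∀ V, Continuous fun p : ℝ × ℝ => st V p.1 p.2 := fun V => by
    have hV : Continuous fun p : ℝ × ℝ => V (p.1, p.2) := V.continuous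
    have hℓ' : Continuous fun p : ℝ × ℝ => ℓ p.1 := hℓ.comp continuous_fst
    exact Continuous.prodMk (by fun_prop) (by fun_prop)
  have hst_sub : ∀ V W t r, ‖st V t r - st W t r‖ ≤ Real.exp (k * r) * dist V W := by
    intro V W t r
    have h1 : st V t r - st W t r = Real.exp (k * r) • (V (t, r) - W (t, r)) := by
      ext1
      · simp [st, mul_sub]
      · simp [st, smul_sub]
    rw [h1, norm_smul, Real.norm_of_nonneg (Real.exp_pos _).le, ← dist_eq_norm]
    gcongr
    exact BoundedContinuousFunction.dist_coe_le_dist _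
  let src : BoundedContinuousFunction (ℝ × ℝ) (ℝ × E) → ℝ → ℝ → E := fun V x r =>
    oddExt (fun y => B (st V y r)) x
  have hBc : ∀ V, Continuous fun p : ℝ × ℝ => B (st V p.1 p.2) := fun V =>
    hB.continuous.comp (hst V)
  have hAc : ∀ V, Continuous fun p : ℝ × ℝ => A (st V p.1 p.2) := fun V =>
    hA.continuous.comp (hst V)
  have hsm : ∀ V, Measurable fun p : ℝ × ℝ => src V p.1 p.2 := fun V =>
    measurable_oddExt (f := fun y r => B (st V y r)) (hBc V)
  have hsM : ∀ V x r, ‖src V x r‖ ≤ M := fun V x r => (norm_oddExt_le _ _).trans (hBM _)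
  have hGh := continuous_heat_oddExt hu0 hu0M h0 h1
  have hGM : ∀ x, ‖oddExt u0 x‖ ≤ M₀ := fun x => (norm_oddExt_le _ _).trans (hu0M _)
  let P : BoundedContinuousFunction (ℝ × ℝ) (ℝ × E) → ℝ → ℝ → ℝ := fun V t s =>
    lam0 t + ∫ r in 0..s, A (st V t r)
  let Q : BoundedContinuousFunction (ℝ × ℝ) (ℝ × E) → ℝ → ℝ → E := fun V t s =>
    heat s (oddExt u0) t + duhamel (src V) t s
  have hPc : ∀ V, Continuous fun p : ℝ × ℝ => P V p.1 (max p.2 0) := fun V => by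
    have h2 : Continuous fun p : ℝ × ℝ => ∫ r in 0..(max p.2 0), A (st V p.1 r) :=
      intervalIntegral.continuous_parametric_intervalIntegral_of_continuous
        (f := fun (p : ℝ × ℝ) r => A (st V p.1 r))
        ((hAc V).comp (by fun_prop : Continuous fun q : (ℝ × ℝ) × ℝ => (q.1.1, q.2)))
        (by fun_prop)
    exact (hlam0.comp continuous_fst).add h2
  have hQc : ∀ V, Continuous fun p : ℝ × ℝ => Q V p.1 (max p.2 0) := fun V => by
    have h3 : Continuous fun p : ℝ × ℝ => (p.1, max p.2 0) := by fun_prop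
    have h5 : Continuous fun p : ℝ × ℝ => duhamel (src V) p.1 (max p.2 0) :=
      (continuousOn_duhamel (hsm V) (hsM V)).comp_continuous h3
        fun p => ⟨mem_univ _, mem_Ici.2 (le_max_right _ _)⟩
    exact hGh.add h5
  have hPb : ∀ V t s, 0 ≤ s → |P V t s| ≤ M₀ + M * s := fun V t s hs => by
    refine (abs_add_le _ _).trans (add_le_add (hlamM t) ?_)
    have := intervalIntegral.norm_integral_le_of_norm_le_const (a := 0) (b := s)
      (f := fun r => A (st V t r)) (C := M) (fun r _ => hAM _)
    simpa [abs_of_nonneg hs] using this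
  have hQb : ∀ V t s, 0 ≤ s → ‖Q V t s‖ ≤ gaussMass * M₀ + gaussMass * M * s := fun V t s hs =>
    (norm_add_le _ _).trans (add_le_add (norm_heat_le hGM _ _)
      (norm_duhamel_le (hsm V) (hsM V) t hs))
  let Φ : BoundedContinuousFunction (ℝ × ℝ) (ℝ × E) → BoundedContinuousFunction (ℝ × ℝ) (ℝ × E) :=
    fun V => BoundedContinuousFunction.ofNormedAddCommGroup
      (fun p : ℝ × ℝ => Real.exp (-(k * max p.2 0)) •
        ((P V p.1 (max p.2 0), Q V p.1 (max p.2 0)) : ℝ × E))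
      ((by fun_prop : Continuous fun p : ℝ × ℝ => Real.exp (-(k * max p.2 0))).smul
        ((hPc V).prodMk (hQc V)))
      ((1 + gaussMass) * (M₀ + M)) (fun p => by
        set s := max p.2 0
        have hs : 0 ≤ s := le_max_right _ _
        have h2 : ‖((P V p.1 s, Q V p.1 s) : ℝ × E)‖ ≤ (1 + gaussMass) * (M₀ + M * s) := by
          refine max_le ?_ ?_
          · refine (hPb V p.1 s hs).trans ?_
            nlinarith [mul_nonneg hG (add_nonneg hM₀ (mul_nonneg hM hs))]
          · refine (hQb V p.1 s hs).trans ?_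
            nlinarith [add_nonneg hM₀ (mul_nonneg hM hs)]
        rw [norm_smul, Real.norm_of_nonneg (Real.exp_pos _).le]
        have h3 : Real.exp (-(k * s)) ≤ 1 := Real.exp_le_one_iff.2 (by nlinarith)
        have h4 := mul_exp_neg_le_one hk1 hs
        calc _ ≤ Real.exp (-(k * s)) * ((1 + gaussMass) * (M₀ + M * s)) := by gcongr
          _ = (1 + gaussMass) * (Real.exp (-(k * s)) * M₀ + M * (Real.exp (-(k * s)) * s)) := by
            ring
          _ ≤ (1 + gaussMass) * (1 * M₀ + M * 1) := by gcongr
          _ = _ := by ring)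
  have hcontr : ContractingWith (1 / 2 : NNReal) Φ := by
    refine ⟨by norm_num [← NNReal.coe_lt_coe], LipschitzWith.of_dist_le_mul fun V W => ?_⟩
    refine (BoundedContinuousFunction.dist_le (by positivity)).2 fun ⟨t, s'⟩ => ?_
    set s := max s' 0 with hs'
    have hs : 0 ≤ s := le_max_right _ _
    have hexpi : IntervalIntegrable (fun r => L * (Real.exp (k * r) * dist V W)) volume 0 s :=
      (by fun_prop : Continuous fun r => L * (Real.exp (k * r) * dist V W)).intervalIntegrable _ _
    have hval : ∫ r in 0..s, L * (Real.exp (k * r) * dist V W) =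
        L * dist V W * ∫ r in 0..s, Real.exp (k * r) := by
      rw [← intervalIntegral.integral_const_mul]
      congr 1; ext r; ring
    have hP : |P V t s - P W t s| ≤ L * dist V W * ∫ r in 0..s, Real.exp (k * r) := by
      have hi : ∀ V, IntervalIntegrable (fun r => A (st V t r)) volume 0 s := fun V =>
        ((hAc V).comp (by fun_prop : Continuous fun r : ℝ => (t, r))).intervalIntegrable _ _
      simp only [P, add_sub_add_left_eq_sub]
      rw [← intervalIntegral.integral_sub (hi V) (hi W), ← hval, ← Real.norm_eq_abs]
      refine intervalIntegral.norm_integral_le_of_norm_le hs (ae_of_all _ fun r _ => ?_) hexpi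
      rw [← dist_eq_norm]
      refine (hA.dist_le_mul _ _).trans ?_
      rw [dist_eq_norm]
      gcongr
      exact hst_sub V W t r
    have hQ : ‖Q V t s - Q W t s‖ ≤
        gaussMass * (L * dist V W * ∫ r in 0..s, Real.exp (k * r)) := by
      simp only [Q, add_sub_add_left_eq_sub]
      rw [← hval]
      refine norm_duhamel_sub_le (hsm V) (hsm W) (hsM V) (hsM W) hs hexpi (fun x r _ => ?_) t
      refine (norm_oddExt_sub_le _ _ _).trans ?_
      rw [← dist_eq_norm]
      refine (hB.dist_le_mul _ _).trans ?_
      rw [dist_eq_norm]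
      gcongr
      exact hst_sub V W _ r
    have hΦ : dist (Φ V (t, s')) (Φ W (t, s')) = Real.exp (-(k * s)) *
        ‖((P V t s - P W t s, Q V t s - Q W t s) : ℝ × E)‖ := by
      rw [dist_eq_norm]
      change ‖Real.exp (-(k * s)) • ((P V t s, Q V t s) : ℝ × E) -
        Real.exp (-(k * s)) • ((P W t s, Q W t s) : ℝ × E)‖ = _
      rw [← smul_sub, norm_smul, Real.norm_of_nonneg (Real.exp_pos _).le]
      rfl
    rw [hΦ]
    have hI0 : 0 ≤ ∫ r in 0..s, Real.exp (k * r) :=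
      intervalIntegral.integral_nonneg hs fun r _ => (Real.exp_pos _).le
    have hn : ‖((P V t s - P W t s, Q V t s - Q W t s) : ℝ × E)‖ ≤
        (1 + gaussMass) * (L * dist V W * ∫ r in 0..s, Real.exp (k * r)) := by
      have : 0 ≤ L * dist V W * ∫ r in 0..s, Real.exp (k * r) := by positivity
      refine max_le (hP.trans ?_) (hQ.trans ?_) <;> nlinarith
    calc _ ≤ Real.exp (-(k * s)) *
          ((1 + gaussMass) * (L * dist V W * ∫ r in 0..s, Real.exp (k * r))) := by gcongr
      _ = (1 + gaussMass) * L * dist V W *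
          (Real.exp (-(k * s)) * ∫ r in 0..s, Real.exp (k * r)) := by ring
      _ ≤ (1 + gaussMass) * L * dist V W * (1 / k) := by
        gcongr
        exact exp_neg_mul_integral_exp_le hk0
      _ ≤ (1 / 2 : NNReal) * dist V W := by
        have h5 : (1 + gaussMass) * L * (1 / k) ≤ 1 / 2 := by
          rw [mul_one_div, div_le_iff₀ hk0, hk]; linarith
        calc _ = ((1 + gaussMass) * L * (1 / k)) * dist V W := by ring
          _ ≤ (1 / 2) * dist V W := by gcongr
          _ = _ := by norm_num
  set V := hcontr.fixedPoint Φ with hV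
  have hfix : ∀ t s, 0 ≤ s → V (t, s) = Real.exp (-(k * s)) • ((P V t s, Q V t s) : ℝ × E) := by
    intro t s hs
    have h2 : Φ V = V := hcontr.fixedPoint_isFixedPt
    have h3 : Φ V (t, s) = Real.exp (-(k * max s 0)) •
        ((P V t (max s 0), Q V t (max s 0)) : ℝ × E) := rfl
    rw [h2, max_eq_left hs] at h3
    exact h3
  have hcancel : ∀ s, Real.exp (k * s) * Real.exp (-(k * s)) = 1 := fun s => by
    rw [← Real.exp_add]; simp
  have hVc : Continuous fun p : ℝ × ℝ => V (p.1, p.2) := V.continuous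
  refine ⟨fun t s => Real.exp (k * s) * (V (t, s)).1, fun t s => Real.exp (k * s) • (V (t, s)).2,
    by fun_prop, by fun_prop, fun t s hs => ?_, fun t s hs => ?_⟩
  · rw [hfix t s hs, Prod.smul_fst, smul_eq_mul, ← mul_assoc, hcancel, one_mul]
  · rw [hfix t s hs, Prod.smul_snd, smul_smul, hcancel, one_smul]

end Mild

end

/-! ### Regularity of mild solutions -/

/-- A pair solving `lam' = A(lam, gam)`, `gam' = gam̈ + B(lam, gam)` up to time `T`, regular up to
the end points of the curve: `gs` is the `s`-derivative of `gam`, and `gt` its `t`-derivative. -/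
structure IsStrong {E : Type*} [NormedAddCommGroup E] [NormedSpace ℝ E] (A : ℝ × E → ℝ)
    (B : ℝ × E → E) (T : ℝ) (lam : ℝ → ℝ → ℝ) (gam gs gt : ℝ → ℝ → E) : Prop where
  lam_cont : ContinuousOn (fun p : ℝ × ℝ => lam p.1 p.2) (Icc 0 1 ×ˢ Icc 0 T)
  gam_cont : ContinuousOn (fun p : ℝ × ℝ => gam p.1 p.2) (Icc 0 1 ×ˢ Icc 0 T)
  lam_deriv : ∀ t ∈ Icc (0 : ℝ) 1, ∀ s ∈ Ioc 0 T, HasDerivAt (lam t) (A (lam t s, gam t s)) s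
  gs_cont : ContinuousOn (fun p : ℝ × ℝ => gs p.1 p.2) (Icc 0 1 ×ˢ Ioc 0 T)
  gam_deriv : ∀ t ∈ Icc (0 : ℝ) 1, ∀ s ∈ Ioc 0 T, HasDerivAt (gam t) (gs t s) s
  gt_cont : ∀ s ∈ Ioc 0 T, ContinuousOn (fun t => gt t s) (Icc 0 1)
  gam_space : ∀ s ∈ Ioc 0 T, ∀ t ∈ Ioo (0 : ℝ) 1, HasDerivAt (fun x => gam x s) (gt t s) t
  gt_space : ∀ s ∈ Ioc 0 T, ∀ t ∈ Ioo (0 : ℝ) 1,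
    HasDerivAt (fun x => gt x s) (gs t s - B (lam t s, gam t s)) t

theorem le_sqrt_mul_sqrt {d b : ℝ} (hd : 0 ≤ d) (hdb : d ≤ b) : d ≤ √b * √d := by
  calc d = √d * √d := (Real.mul_self_sqrt hd).symm
    _ ≤ √b * √d := by gcongr

section
variable {E : Type*} [NormedAddCommGroup E] [NormedSpace ℝ E] {A : ℝ × E → ℝ} {B : ℝ × E → E}
  {L : NNReal} {M : ℝ} {lam0 : ℝ → ℝ} {u0 ℓ : ℝ → E} {lam : ℝ → ℝ → ℝ} {u : ℝ → ℝ → E}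

theorem IsMild.continuous_source (h : IsMild A B lam0 u0 ℓ lam u) (hB : LipschitzWith L B)
    (hℓ : Continuous ℓ) : Continuous fun p : ℝ × ℝ => B (lam p.1 p.2, ℓ p.1 + u p.1 p.2) :=
  hB.continuous.comp (h.lam_cont.prodMk ((hℓ.comp continuous_fst).add h.u_cont))

theorem IsMild.norm_lam_sub_le (h : IsMild A B lam0 u0 ℓ lam u) (hA : LipschitzWith L A)
    (hAM : ∀ x, |A x| ≤ M) (t : ℝ) {r s : ℝ} (hr : 0 ≤ r) (hrs : r ≤ s) :
    ‖lam t r - lam t s‖ ≤ M * (s - r) := by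
  have hlt : Continuous fun r => lam t r :=
    h.lam_cont.comp (by fun_prop : Continuous fun r : ℝ => (t, r))
  have hut : Continuous fun r => u t r :=
    h.u_cont.comp (by fun_prop : Continuous fun r : ℝ => (t, r))
  have hc : Continuous fun r => A (lam t r, ℓ t + u t r) :=
    hA.continuous.comp (hlt.prodMk (continuous_const.add hut))
  rw [norm_sub_rev, h.lam_eq t r hr, h.lam_eq t s (hr.trans hrs), add_sub_add_left_eq_sub,
    intervalIntegral.integral_interval_sub_left (hc.intervalIntegrable _ _)
      (hc.intervalIntegrable _ _)]
  have := intervalIntegral.norm_integral_le_of_norm_le_const (a := r) (b := s)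
    (f := fun r => A (lam t r, ℓ t + u t r)) (C := M) (fun r _ => hAM _)
  rwa [abs_of_nonneg (sub_nonneg.2 hrs)] at this

/-- The boundary values vanish, as the extended initial value and source are odd about `0` and about
`1`. -/
theorem IsMild.boundary (h : IsMild A B lam0 u0 ℓ lam u) {s : ℝ} (hs : 0 ≤ s) :
    u 0 s = 0 ∧ u 1 s = 0 := by
  constructor
  · rw [h.u_eq 0 s hs, heat, gaussConv_kap_eq_zero_of_odd (oddExt_odd_zero u0), zero_add, duhamel]
    refine (intervalIntegral.integral_congr (g := fun _ => 0) fun r _ => ?_).trans (by simp)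
    exact gaussConv_kap_eq_zero_of_odd (oddExt_odd_zero _) _
  · rw [h.u_eq 1 s hs, heat, gaussConv_kap_eq_zero_of_odd (oddExt_odd_one u0), zero_add, duhamel]
    refine (intervalIntegral.integral_congr (g := fun _ => 0) fun r _ => ?_).trans (by simp)
    exact gaussConv_kap_eq_zero_of_odd (oddExt_odd_one _) _

theorem IsMild.initial [CompleteSpace E] (h : IsMild A B lam0 u0 ℓ lam u) (h0 : u0 0 = 0)
    (h1 : u0 1 = 0) {t : ℝ} (ht : t ∈ Icc (0 : ℝ) 1) : lam t 0 = lam0 t ∧ u t 0 = u0 t := by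
  constructor
  · rw [h.lam_eq t 0 le_rfl]; simp
  · rw [h.u_eq t 0 le_rfl, heat_zero, oddExt_eq_of_eq_zero h0 h1 ht]; simp [duhamel]

variable [MeasurableSpace E] [BorelSpace E] [SecondCountableTopology E]

theorem IsMild.measurable_source (h : IsMild A B lam0 u0 ℓ lam u) (hB : LipschitzWith L B)
    (hℓ : Continuous ℓ) : Measurable fun p : ℝ × ℝ =>
      (fun x r => oddExt (fun y => B (lam y r, ℓ y + u y r)) x) p.1 p.2 :=
  measurable_oddExt (f := fun y r => B (lam y r, ℓ y + u y r)) (h.continuous_source hB hℓ)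

/-- The source of a mild solution is Hölder continuous in time away from the initial time, since
the heat semigroup and the Duhamel integral are. -/
theorem IsMild.isHolderSource (h : IsMild A B lam0 u0 ℓ lam u) (hA : LipschitzWith L A)
    (hB : LipschitzWith L B) (hAM : ∀ x, |A x| ≤ M) (hBM : ∀ x, ‖B x‖ ≤ M) (hℓ : Continuous ℓ)
    (hu0 : Continuous u0) {M₀ : ℝ} (hu0M : ∀ t, ‖u0 t‖ ≤ M₀) (h0 : u0 0 = 0) (h1 : u0 1 = 0) :
    IsHolderSource (fun x r => oddExt (fun y => B (lam y r, ℓ y + u y r)) x) M := by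
  have hG := gaussMass_nonneg
  have hM : 0 ≤ M := (abs_nonneg _).trans (hAM 0)
  have hM₀ : 0 ≤ M₀ := (norm_nonneg _).trans (hu0M 0)
  have hbd : ∀ x r, ‖oddExt (fun y => B (lam y r, ℓ y + u y r)) x‖ ≤ M := fun x r =>
    (norm_oddExt_le _ _).trans (hBM _)
  have hm := h.measurable_source hB hℓ
  refine ⟨hm, hbd, fun a b ha => ?_⟩
  set K : ℝ := (√(a / 2))⁻¹ with hK
  have ha2 : 0 < √(a / 2) := Real.sqrt_pos.2 (by positivity)
  have hK0 : 0 < K := inv_pos.2 ha2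
  set C₁ : ℝ := M * √b + (2 * gaussMass * M₀ * K + (gaussMass * M * √b + 4 * gaussMass * M * √b))
    with hC₁
  refine ⟨L * C₁ + 2 * M * K, fun s hs r hr x => ?_⟩
  have hC₁0 : 0 ≤ C₁ := by positivity
  have hd : 0 ≤ s - r := sub_nonneg.2 hr.2
  have hL : (0 : ℝ) ≤ L := L.2
  rcases le_total (a / 2) r with hra | hra
  · have hr0 : 0 < r := by linarith
    have hsr := le_sqrt_mul_sqrt hd (show s - r ≤ b by linarith [hs.2])
    have hlam : ∀ y, ‖lam y r - lam y s‖ ≤ M * √b * √(s - r) := fun y => by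
      refine (h.norm_lam_sub_le hA hAM y hr.1 hr.2).trans ?_
      rw [mul_assoc]; gcongr
    have hu : ∀ y, ‖u y r - u y s‖ ≤
        (2 * gaussMass * M₀ * K + (gaussMass * M * √b + 4 * gaussMass * M * √b)) * √(s - r) := by
      intro y
      have e1 := norm_heat_add_sub_le_sqrt (continuous_oddExt hu0 h0 h1).measurable
        (fun x => (norm_oddExt_le _ _).trans (hu0M _)) hr0 hd y
      have e2 := norm_duhamel_add_sub_le hm hbd y hr.1 hd
      rw [add_sub_cancel] at e1 e2
      rw [norm_sub_rev, h.u_eq y r hr.1, h.u_eq y s (hr.1.trans hr.2), add_sub_add_comm, add_mul]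
      refine (norm_add_le _ _).trans (add_le_add (e1.trans ?_) (e2.trans ?_))
      · have : (√r)⁻¹ ≤ K := inv_anti₀ ha2 (Real.sqrt_le_sqrt hra)
        calc _ ≤ 2 * gaussMass * M₀ * √(s - r) * K := by gcongr
          _ = _ := by ring
      · have : √r ≤ √b := Real.sqrt_le_sqrt (by linarith [hr.2, hs.2])
        calc _ ≤ gaussMass * M * (√b * √(s - r)) + 4 * gaussMass * M * √(s - r) * √b := by gcongr
          _ = _ := by ring
    refine (norm_oddExt_sub_le _ _ _).trans ?_
    rw [← dist_eq_norm]
    refine (hB.dist_le_mul _ _).trans ?_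
    have e3 : dist (lam (tri x) r, ℓ (tri x) + u (tri x) r)
        (lam (tri x) s, ℓ (tri x) + u (tri x) s) ≤ C₁ * √(s - r) := by
      rw [Prod.dist_eq, dist_add_left, dist_eq_norm, dist_eq_norm]
      have p1 : 0 ≤ M * √b * √(s - r) := by positivity
      have p2 : 0 ≤ (2 * gaussMass * M₀ * K + (gaussMass * M * √b + 4 * gaussMass * M * √b)) *
        √(s - r) := by positivity
      rw [hC₁, add_mul]
      exact max_le ((hlam _).trans (by linarith)) ((hu _).trans (by linarith))
    calc _ ≤ L * (C₁ * √(s - r)) := by gcongr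
      _ ≤ (L * C₁ + 2 * M * K) * √(s - r) := by
        have : 0 ≤ 2 * M * K * √(s - r) := by positivity
        linarith
  -- far from `s` the bound on the source is enough
  · have e4 : 1 ≤ K * √(s - r) := by
      rw [hK, ← div_eq_inv_mul, one_le_div ha2]
      exact Real.sqrt_le_sqrt (by linarith [hs.1])
    have e5 : 0 ≤ L * C₁ * √(s - r) := by positivity
    refine (norm_sub_le _ _).trans ?_
    have e6 := hbd x r
    have e7 := hbd x s
    nlinarith

theorem continuousOn_heat₂ {g : ℝ → E} (hg : Measurable g) {M : ℝ} (hM : ∀ y, ‖g y‖ ≤ M) :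
    ContinuousOn (fun p : ℝ × ℝ => heat₂ p.2 g p.1) (univ ×ˢ Ioi 0) := by
  rintro ⟨x, s⟩ ⟨-, hs⟩
  have hs : 0 < s := hs
  refine ContinuousAt.continuousWithinAt (ContinuousAt.smul ?_ ?_)
  · exact continuousAt_snd.inv₀ hs.ne'
  · exact ContinuousAt.comp (f := fun p : ℝ × ℝ => (p.1, √p.2)) (x := (x, s))
      (continuousAt_gaussConv isGaussWeight_kap₂ hg hM x (Real.sqrt_pos.2 hs)) (by fun_prop)

/-- Mild solutions are strong solutions, as their sources are Hölder continuous in time. -/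
theorem IsMild.isStrong [CompleteSpace E] {p v : E}
    (h : IsMild A B lam0 u0 (fun t => p + t • v) lam u) (hA : LipschitzWith L A)
    (hB : LipschitzWith L B) (hAM : ∀ x, |A x| ≤ M) (hBM : ∀ x, ‖B x‖ ≤ M)
    (hu0 : Continuous u0) {M₀ : ℝ} (hu0M : ∀ t, ‖u0 t‖ ≤ M₀) (h0 : u0 0 = 0) (h1 : u0 1 = 0) :
    ∃ gs gt, ∀ T, IsStrong A B T lam (fun t s => (p + t • v) + u t s) gs gt := by
  have hℓ : Continuous fun t : ℝ => p + t • v := by fun_prop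
  set F : ℝ → ℝ → E := fun x r => oddExt (fun y => B (lam y r, (p + y • v) + u y r)) x with hF
  have hH : IsHolderSource F M := h.isHolderSource hA hB hAM hBM hℓ hu0 hu0M h0 h1
  set G : ℝ → E := oddExt u0 with hGdef
  have hGm : Measurable G := (continuous_oddExt hu0 h0 h1).measurable
  have hGM : ∀ x, ‖G x‖ ≤ M₀ := fun x => (norm_oddExt_le _ _).trans (hu0M _)
  refine ⟨fun t s => heat₂ s G t + duhamelTime F t s, fun t s => v + (heat₁ s G t + duhamel₁ F t s),
    fun T => ⟨h.lam_cont.continuousOn, ?_, ?_, ?_, ?_, ?_, ?_, ?_⟩⟩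
  · exact ((hℓ.comp continuous_fst).add h.u_cont).continuousOn
  · intro t _ s hs
    have hlt : Continuous fun r => lam t r :=
      h.lam_cont.comp (by fun_prop : Continuous fun r : ℝ => (t, r))
    have hut : Continuous fun r => u t r :=
      h.u_cont.comp (by fun_prop : Continuous fun r : ℝ => (t, r))
    have hc : Continuous fun r => A (lam t r, (p + t • v) + u t r) :=
      hA.continuous.comp (hlt.prodMk (continuous_const.add hut))
    have h2 := (hc.integral_hasStrictDerivAt 0 s).hasDerivAt.const_add (lam0 t)
    refine h2.congr_of_eventuallyEq ?_
    filter_upwards [Ioi_mem_nhds hs.1] with r hr using h.lam_eq t r (le_of_lt hr)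
  · refine ((continuousOn_heat₂ hGm hGM).add (continuousOn_duhamelTime hH)).mono ?_
    exact fun x hx => ⟨mem_univ _, hx.2.1⟩
  · intro t _ s hs
    have h2 := (hasDerivAt_heat_time hGm hGM hs.1 t).add (hasDerivAt_duhamel_time hH t hs.1)
    have h3 := h2.const_add (p + t • v)
    refine h3.congr_of_eventuallyEq ?_
    filter_upwards [Ioi_mem_nhds hs.1] with r hr
    rw [h.u_eq t r (le_of_lt hr)]
    rfl
  · intro s hs
    have h2 : Continuous fun t => heat₁ s G t := continuous_iff_continuousAt.2 fun t =>
      (hasDerivAt_heat₁ hGm hGM hs.1 t).continuousAt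
    exact (continuous_const.add
      (h2.add (continuous_duhamel₁ hH.meas hH.bound hs.1.le))).continuousOn
  · intro s hs t _
    have h2 := (hasDerivAt_heat hGm hGM hs.1 t).add
      (hasDerivAt_duhamel hH.meas hH.bound hs.1.le t)
    have h3 : HasDerivAt (fun t : ℝ => p + t • v) v t := by
      simpa using ((hasDerivAt_id t).smul_const v).const_add p
    refine (h3.add h2).congr_of_eventuallyEq (Eventually.of_forall fun x => ?_)
    change (p + x • v) + u x s = _
    rw [h.u_eq x s hs.1.le]
    rfl
  · intro s hs t ht
    have hsrc : ∀ y ∈ Ioo (0 : ℝ) 1, F y s = B (lam y s, (p + y • v) + u y s) := fun y hy =>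
      oddExt_eq _ hy
    have hFc : ContinuousOn (fun y => F y s) (Ioo 0 1) := by
      have h2 : Continuous fun y => B (lam y s, (p + y • v) + u y s) :=
        (h.continuous_source hB hℓ).comp (by fun_prop : Continuous fun y : ℝ => (y, s))
      exact h2.continuousOn.congr hsrc
    have h2 := (hasDerivAt_heat₁ hGm hGM hs.1 t).add
      (hasDerivAt_duhamel₁ hH hs.1 isOpen_Ioo hFc ht)
    refine HasDerivAt.congr_deriv (h2.const_add v) ?_
    rw [hsrc t ht, add_sub_assoc]

/-- The initial-boundary value problem for bounded Lipschitz nonlinearities has a global strong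
solution. -/
theorem exists_isStrong [CompleteSpace E] (hA : LipschitzWith L A) (hB : LipschitzWith L B)
    (hAM : ∀ x, |A x| ≤ M) (hBM : ∀ x, ‖B x‖ ≤ M) {lam0 : ℝ → ℝ} {gam0 : ℝ → E}
    (hlam0 : ContinuousOn lam0 (Icc 0 1)) (hgam0 : ContinuousOn gam0 (Icc 0 1)) :
    ∃ lam gam gs gt, (∀ T, IsStrong A B T lam gam gs gt) ∧
      (∀ t ∈ Icc (0 : ℝ) 1, lam t 0 = lam0 t ∧ gam t 0 = gam0 t) ∧
      ∀ s, 0 ≤ s → gam 0 s = gam0 0 ∧ gam 1 s = gam0 1 := by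
  -- the segment `p + t v` joins the end points; the difference `u0` to it vanishes there
  set p := gam0 0 with hp
  set v := gam0 1 - gam0 0 with hv
  let lam0' : ℝ → ℝ := fun t => lam0 (projIcc 0 1 zero_le_one t)
  let u0 : ℝ → E := fun t => gam0 (projIcc 0 1 zero_le_one t) -
    (p + (projIcc 0 1 zero_le_one t : ℝ) • v)
  have hproj : Continuous fun t : ℝ => (projIcc 0 1 zero_le_one t : ℝ) :=
    continuous_subtype_val.comp continuous_projIcc
  have hmem : ∀ t : ℝ, (projIcc 0 1 zero_le_one t : ℝ) ∈ Icc (0 : ℝ) 1 := fun t =>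
    Subtype.coe_prop _
  have hl : Continuous lam0' := hlam0.comp_continuous hproj hmem
  have hu : Continuous u0 := (hgam0.comp_continuous hproj hmem).sub
    (continuous_const.add (hproj.smul continuous_const))
  have hval : ∀ t ∈ Icc (0 : ℝ) 1, lam0' t = lam0 t ∧ u0 t = gam0 t - (p + t • v) := fun t ht => by
    have : (projIcc 0 1 zero_le_one t : ℝ) = t := by rw [projIcc_of_mem _ ht]
    simp only [lam0', u0, this, and_self]
  have hu0 : u0 0 = 0 := by rw [(hval 0 (by simp)).2]; simp [hp]
  have hu1 : u0 1 = 0 := by rw [(hval 1 (by simp)).2]; simp [hp, hv]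
  obtain ⟨M₁, hM₁⟩ := isCompact_Icc.exists_bound_of_continuousOn hlam0
  obtain ⟨M₂, hM₂⟩ := isCompact_Icc.exists_bound_of_continuousOn
    (f := fun t => gam0 t - (p + t • v)) (s := Icc (0 : ℝ) 1) (hgam0.sub (by fun_prop))
  have hb1 : ∀ t, |lam0' t| ≤ max M₁ M₂ := fun t => (hM₁ _ (hmem t)).trans (le_max_left _ _)
  have hb2 : ∀ t, ‖u0 t‖ ≤ max M₁ M₂ := fun t => (hM₂ _ (hmem t)).trans (le_max_right _ _)
  obtain ⟨lam, u, h⟩ := exists_isMild hA hB hAM hBM hl hb1 hu hb2 hu0 hu1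
    (ℓ := fun t => p + t • v) (by fun_prop)
  obtain ⟨gs, gt, hs⟩ := h.isStrong hA hB hAM hBM hu hb2 hu0 hu1
  refine ⟨lam, _, gs, gt, hs, fun t ht => ?_, fun s hs => ?_⟩
  · obtain ⟨h1, h2⟩ := h.initial hu0 hu1 ht
    refine ⟨h1.trans (hval t ht).1, ?_⟩
    simp only [h2, (hval t ht).2, add_sub_cancel]
  · obtain ⟨h1, h2⟩ := h.boundary hs
    simp only [h1, h2]
    exact ⟨by simp [hp], by simp [hp, hv]⟩

end

/-! ### The nonlinearity and its truncation -/

/-- The right-hand side of the first equation as a function of the state. -/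
def rhsA (φ : R3 → ℝ) (ε : ℝ) (z : ℝ × R3) : ℝ := -ε * z.1 + φ z.2

/-- The zeroth order part of the right-hand side of the second equation as a function of the
state. -/
def rhsB (φ : R3 → ℝ) (ε α : ℝ) (z : ℝ × R3) : R3 :=
  -(((1 - α * ε) * z.1 + α * φ z.2) • gradient φ z.2)

theorem locallyLipschitz_rhsA {φ : R3 → ℝ} (hφ : ContDiff ℝ 1 φ) (ε : ℝ) :
    LocallyLipschitz (rhsA φ ε) := by
  have : ContDiff ℝ 1 (rhsA φ ε) :=
    (contDiff_const.mul contDiff_fst).add (hφ.comp contDiff_snd)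
  exact this.locallyLipschitz

theorem locallyLipschitz_rhsB {φ : R3 → ℝ} (hφ : ContDiff ℝ 1 φ)
    (hgrad : LocallyLipschitz (gradient φ)) (ε α : ℝ) : LocallyLipschitz (rhsB φ ε α) := by
  have h1 : LocallyLipschitz fun z : ℝ × R3 => -((1 - α * ε) * z.1 + α * φ z.2) := by
    have : ContDiff ℝ 1 fun z : ℝ × R3 => -((1 - α * ε) * z.1 + α * φ z.2) :=
      ((contDiff_const.mul contDiff_fst).add
        (contDiff_const.mul (hφ.comp contDiff_snd))).neg
    exact this.locallyLipschitz
  have h2 : LocallyLipschitz fun z : ℝ × R3 => gradient φ z.2 :=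
    hgrad.comp LipschitzWith.prod_snd.locallyLipschitz
  have h3 : LocallyLipschitz fun q : ℝ × R3 => q.1 • q.2 := by
    have : ContDiff ℝ 1 fun q : ℝ × R3 => q.1 • q.2 := contDiff_fst.smul contDiff_snd
    exact this.locallyLipschitz
  have h4 := h3.comp (h1.prodMk h2)
  have h5 : rhsB φ ε α = (fun q : ℝ × R3 => q.1 • q.2) ∘
      fun z : ℝ × R3 => (-((1 - α * ε) * z.1 + α * φ z.2), gradient φ z.2) := by
    ext1 z; simp only [rhsB, Function.comp, neg_smul]
  rw [h5]; exact h4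

theorem exists_lipschitzOnWith_closedBall {V W : Type*} [NormedAddCommGroup V] [ProperSpace V]
    [NormedAddCommGroup W] {F : V → W} (hF : LocallyLipschitz F) (R : ℝ) :
    ∃ K : NNReal, LipschitzOnWith K F (Metric.closedBall 0 R) :=
  hF.locallyLipschitzOn.exists_lipschitzOnWith_of_compact (isCompact_closedBall 0 R)

/-- A locally Lipschitz map coincides on each ball with a bounded Lipschitz map: multiply it by a
cutoff function. -/
theorem exists_truncation {V W : Type*} [NormedAddCommGroup V] [ProperSpace V]
    [NormedAddCommGroup W] [NormedSpace ℝ W] {F : V → W} (hF : LocallyLipschitz F) (R : ℝ) :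
    ∃ (G : V → W) (L : NNReal) (M : ℝ), LipschitzWith L G ∧ (∀ z, ‖G z‖ ≤ M) ∧
      ∀ z, ‖z‖ ≤ R → G z = F z := by
  obtain ⟨K, hK⟩ := exists_lipschitzOnWith_closedBall hF (R + 1)
  obtain ⟨M', hM'⟩ := (isCompact_closedBall (0 : V) (R + 1)).exists_bound_of_continuousOn
    hF.continuous.continuousOn
  set M : ℝ := max M' 0
  have hM0 : 0 ≤ M := le_max_right _ _
  have hM : ∀ z, ‖z‖ ≤ R + 1 → ‖F z‖ ≤ M := fun z hz =>
    (hM' z (by simpa using hz)).trans (le_max_left _ _)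
  let χ : V → ℝ := fun z => max 0 (min 1 (R + 1 - ‖z‖))
  have hχ0 : ∀ z, 0 ≤ χ z := fun z => le_max_left _ _
  have hχ1 : ∀ z, χ z ≤ 1 := fun z => max_le zero_le_one (min_le_left _ _)
  have hχz : ∀ z, R + 1 < ‖z‖ → χ z = 0 := fun z hz =>
    max_eq_left ((min_le_right _ _).trans (by linarith))
  have hχL : ∀ z w, |χ z - χ w| ≤ ‖z - w‖ := by
    intro z w
    refine (abs_max_sub_max_le_max _ _ _ _).trans ?_
    refine max_le (by simp) ((abs_min_sub_min_le_max _ _ _ _).trans (max_le (by simp) ?_))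
    rw [sub_sub_sub_cancel_left, abs_sub_comm]
    exact abs_norm_sub_norm_le z w
  -- the estimate when the second point lies in the support of the cutoff
  have hest : ∀ z w, ‖w‖ ≤ R + 1 → ‖χ z • F z - χ w • F w‖ ≤ (K + M) * ‖z - w‖ := by
    intro z w hw
    by_cases hz : ‖z‖ ≤ R + 1
    · have e : χ z • F z - χ w • F w = χ z • (F z - F w) + (χ z - χ w) • F w := by
        rw [smul_sub, sub_smul]; abel
      rw [e, add_mul]
      refine (norm_add_le _ _).trans (add_le_add ?_ ?_)
      · rw [norm_smul, Real.norm_of_nonneg (hχ0 z)]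
        refine (mul_le_of_le_one_left (norm_nonneg _) (hχ1 z)).trans ?_
        simpa [dist_eq_norm] using hK.dist_le_mul z (by simpa using hz) w (by simpa using hw)
      · rw [norm_smul, Real.norm_eq_abs, mul_comm]
        exact mul_le_mul (hM w hw) (hχL z w) (abs_nonneg _) hM0
    · have h0 := hχz z (not_le.1 hz)
      have := hχL z w
      rw [h0, zero_sub, abs_neg, abs_of_nonneg (hχ0 w)] at this
      rw [h0, zero_smul, zero_sub, norm_neg, norm_smul, Real.norm_of_nonneg (hχ0 w)]
      calc χ w * ‖F w‖ ≤ ‖z - w‖ * M := by gcongr; exact hM w hw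
        _ ≤ (K + M) * ‖z - w‖ := by
          have : 0 ≤ (K : ℝ) * ‖z - w‖ := by positivity
          linarith
  refine ⟨fun z => χ z • F z, K + M.toNNReal, M, LipschitzWith.of_dist_le_mul fun z w => ?_,
    fun z => ?_, fun z hz => ?_⟩
  · rw [NNReal.coe_add, Real.coe_toNNReal _ hM0, dist_eq_norm, dist_eq_norm]
    by_cases hw : ‖w‖ ≤ R + 1
    · exact hest z w hw
    by_cases hz : ‖z‖ ≤ R + 1
    · rw [norm_sub_rev, norm_sub_rev z w]; exact hest w z hz
    · simp only [hχz z (not_le.1 hz), hχz w (not_le.1 hw), zero_smul, sub_self, norm_zero]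
      positivity
  · by_cases hz : ‖z‖ ≤ R + 1
    · rw [norm_smul, Real.norm_of_nonneg (hχ0 z)]
      exact (mul_le_of_le_one_left (norm_nonneg _) (hχ1 z)).trans (hM z hz)
    · simp [hχz z (not_le.1 hz), hM0]
  · have : χ z = 1 := by
      simp only [χ]
      rw [min_eq_left (by linarith), max_eq_right zero_le_one]
    simp only [this, one_smul]

/-! ### Uniqueness -/

/-- A pair solving `lam' = A(lam, gam)`, `gam' = gam̈ + B(lam, gam)` up to time `T` with the
interior regularity that uniqueness needs. -/
structure IsInterior {E : Type*} [NormedAddCommGroup E] [NormedSpace ℝ E] (A : ℝ × E → ℝ)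
    (B : ℝ × E → E) (T : ℝ) (lam : ℝ → ℝ → ℝ) (gam : ℝ → ℝ → E) : Prop where
  lam_cont : ContinuousOn (fun p : ℝ × ℝ => lam p.1 p.2) (Icc 0 1 ×ˢ Icc 0 T)
  gam_cont : ContinuousOn (fun p : ℝ × ℝ => gam p.1 p.2) (Icc 0 1 ×ˢ Icc 0 T)
  lam_deriv : ∀ t ∈ Icc (0 : ℝ) 1, ∀ s ∈ Ioc 0 T, HasDerivAt (lam t) (A (lam t s, gam t s)) s
  gam_deriv : ∀ s ∈ Ioc 0 T, ∃ dt : ℝ → E, ∀ t ∈ Ioo (0 : ℝ) 1,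
    HasDerivAt (fun x => gam x s) (dt t) t ∧ ∃ ds dtt : E, HasDerivAt (gam t) ds s ∧
      HasDerivAt dt dtt t ∧ ds - dtt = B (lam t s, gam t s)

section
variable {E : Type*} [NormedAddCommGroup E]

theorem IsStrong.isInterior [NormedSpace ℝ E] {A : ℝ × E → ℝ} {B : ℝ × E → E} {T : ℝ}
    {lam : ℝ → ℝ → ℝ} {gam gs gt : ℝ → ℝ → E} (h : IsStrong A B T lam gam gs gt) :
    IsInterior A B T lam gam where
  lam_cont := h.lam_cont
  gam_cont := h.gam_cont
  lam_deriv := h.lam_deriv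
  gam_deriv s hs := ⟨fun t => gt t s, fun t ht => ⟨h.gam_space s hs t ht, _, _,
    h.gam_deriv t (Ioo_subset_Icc_self ht) s hs, h.gt_space s hs t ht, sub_sub_cancel _ _⟩⟩

theorem IsInterior.exists_bound [NormedSpace ℝ E] {A : ℝ × E → ℝ} {B : ℝ × E → E} {T : ℝ}
    {lam : ℝ → ℝ → ℝ} {gam : ℝ → ℝ → E} (h : IsInterior A B T lam gam) :
    ∃ R, ∀ t ∈ Icc (0 : ℝ) 1, ∀ s ∈ Icc 0 T, ‖(lam t s, gam t s)‖ ≤ R := by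
  obtain ⟨R, hR⟩ := (isCompact_Icc.prod isCompact_Icc).exists_bound_of_continuousOn
    (h.lam_cont.prodMk h.gam_cont)
  exact ⟨R, fun t ht s hs => hR (t, s) ⟨ht, hs⟩⟩

/-- Solutions with the same initial and boundary values coincide. -/
theorem IsInterior.unique [InnerProductSpace ℝ E] [ProperSpace E] {A : ℝ × E → ℝ} {B : ℝ × E → E}
    {T : ℝ} (hA : LocallyLipschitz A) (hB : LocallyLipschitz B)
    {lam₁ lam₂ : ℝ → ℝ → ℝ} {gam₁ gam₂ : ℝ → ℝ → E} (h₁ : IsInterior A B T lam₁ gam₁)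
    (h₂ : IsInterior A B T lam₂ gam₂)
    (hinit : ∀ t ∈ Icc (0 : ℝ) 1, lam₁ t 0 = lam₂ t 0 ∧ gam₁ t 0 = gam₂ t 0)
    (hbdry : ∀ s ∈ Icc 0 T, gam₁ 0 s = gam₂ 0 s ∧ gam₁ 1 s = gam₂ 1 s) :
    ∀ t ∈ Icc (0 : ℝ) 1, ∀ s ∈ Icc 0 T, lam₁ t s = lam₂ t s ∧ gam₁ t s = gam₂ t s := by
  obtain ⟨R₁, hR₁⟩ := h₁.exists_bound
  obtain ⟨R₂, hR₂⟩ := h₂.exists_bound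
  obtain ⟨KA, hKA⟩ := exists_lipschitzOnWith_closedBall hA (max R₁ R₂)
  obtain ⟨KB, hKB⟩ := exists_lipschitzOnWith_closedBall hB (max R₁ R₂)
  have hmem₁ : ∀ t ∈ Icc (0 : ℝ) 1, ∀ s ∈ Icc 0 T,
      (lam₁ t s, gam₁ t s) ∈ Metric.closedBall 0 (max R₁ R₂) := fun t ht s hs =>
    mem_closedBall_zero_iff.2 ((hR₁ t ht s hs).trans (le_max_left _ _))
  have hmem₂ : ∀ t ∈ Icc (0 : ℝ) 1, ∀ s ∈ Icc 0 T,
      (lam₂ t s, gam₂ t s) ∈ Metric.closedBall 0 (max R₁ R₂) := fun t ht s hs =>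
    mem_closedBall_zero_iff.2 ((hR₂ t ht s hs).trans (le_max_right _ _))
  have hlip : ∀ t s (d : ℝ) (K : NNReal), K ≤ KA + KB →
      d ≤ K * dist (lam₁ t s, gam₁ t s) (lam₂ t s, gam₂ t s) →
      d ≤ (KA + KB : NNReal) * (|lam₁ t s - lam₂ t s| + ‖gam₁ t s - gam₂ t s‖) := by
    intro t s d K hle e
    refine e.trans ?_
    have : dist (lam₁ t s, gam₁ t s) (lam₂ t s, gam₂ t s) ≤
        |lam₁ t s - lam₂ t s| + ‖gam₁ t s - gam₂ t s‖ := by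
      rw [Prod.dist_eq, Real.dist_eq, dist_eq_norm]
      exact max_le (le_add_of_nonneg_right (norm_nonneg _)) (le_add_of_nonneg_left (abs_nonneg _))
    have hle' : (K : ℝ) ≤ (KA + KB : NNReal) := hle
    gcongr
  have key := eq_zero_of_parabolic (S := T) (L := (KA + KB : NNReal)) NNReal.zero_le_coe
    (eta := fun t s => lam₁ t s - lam₂ t s) (del := fun t s => gam₁ t s - gam₂ t s)
    (h₁.lam_cont.sub h₂.lam_cont) (h₁.gam_cont.sub h₂.gam_cont)
    (fun t ht => sub_eq_zero.2 (hinit t ht).1) (fun t ht => sub_eq_zero.2 (hinit t ht).2)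
    (fun s hs => sub_eq_zero.2 (hbdry s hs).1) (fun s hs => sub_eq_zero.2 (hbdry s hs).2)
    (fun t ht s hs => ⟨_, (h₁.lam_deriv t ht s hs).sub (h₂.lam_deriv t ht s hs),
      hlip t s _ KA le_self_add (hKA.dist_le_mul _ (hmem₁ t ht s (Ioc_subset_Icc_self hs)) _
        (hmem₂ t ht s (Ioc_subset_Icc_self hs)))⟩)
    (fun t ht s hs => by
      obtain ⟨dt₁, H₁⟩ := h₁.gam_deriv s hs
      obtain ⟨dt₂, H₂⟩ := h₂.gam_deriv s hs
      obtain ⟨-, ds₁, dtt₁, a₁, b₁, c₁⟩ := H₁ t ht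
      obtain ⟨-, ds₂, dtt₂, a₂, b₂, c₂⟩ := H₂ t ht
      refine ⟨ds₁ - ds₂, dtt₁ - dtt₂, fun x => dt₁ x - dt₂ x, a₁.sub a₂,
        fun x hx => (H₁ x hx).1.sub (H₂ x hx).1, b₁.sub b₂, ?_⟩
      have ht' := Ioo_subset_Icc_self ht
      have hs' := Ioc_subset_Icc_self hs
      rw [sub_sub_sub_comm, c₁, c₂, ← dist_eq_norm]
      exact hlip t s _ KB le_add_self
        (hKB.dist_le_mul _ (hmem₁ t ht' s hs') _ (hmem₂ t ht' s hs')))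
  exact fun t ht s hs => ⟨sub_eq_zero.1 (key t ht s hs).1, sub_eq_zero.1 (key t ht s hs).2⟩

end

/-! ### The energy estimate -/

section Dirichlet
variable {E : Type*} [NormedAddCommGroup E] [InnerProductSpace ℝ E] {A : ℝ × E → ℝ}
  {B : ℝ × E → E} {T : ℝ} {lam : ℝ → ℝ → ℝ} {gam gs gt : ℝ → ℝ → E}

theorem IsStrong.continuousOn_state (h : IsStrong A B T lam gam gs gt) :
    ContinuousOn (fun p : ℝ × ℝ => (lam p.1 p.2, gam p.1 p.2)) (Icc 0 1 ×ˢ Ioc 0 T) :=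
  (h.lam_cont.prodMk h.gam_cont).mono (prod_mono le_rfl Ioc_subset_Icc_self)

theorem IsStrong.continuousOn_gtt (h : IsStrong A B T lam gam gs gt) (hB : Continuous B) :
    ContinuousOn (fun p : ℝ × ℝ => gs p.1 p.2 - B (lam p.1 p.2, gam p.1 p.2))
      (Icc 0 1 ×ˢ Ioc 0 T) :=
  h.gs_cont.sub (hB.comp_continuousOn h.continuousOn_state)

theorem continuousOn_slice {F : Type*} [TopologicalSpace F] {f : ℝ × ℝ → F} {I J : Set ℝ}
    (hf : ContinuousOn f (I ×ˢ J)) {s : ℝ} (hs : s ∈ J) : ContinuousOn (fun t => f (t, s)) I :=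
  hf.comp (by fun_prop) fun t ht => ⟨ht, hs⟩

theorem intervalIntegrable_of_continuousOn_Icc {F : Type*} [NormedAddCommGroup F] {f : ℝ → F}
    (hf : ContinuousOn f (Icc 0 1)) : IntervalIntegrable f volume 0 1 :=
  ContinuousOn.intervalIntegrable (by rwa [uIcc_of_le zero_le_one])

/-- Integration by parts for the difference of two time slices. No derivative of `gt` in time is
involved, and the boundary terms vanish as the end points are fixed. -/
theorem IsStrong.integral_normSq_sub (h : IsStrong A B T lam gam gs gt) (hB : Continuous B)
    {p q : E} (hb : ∀ s ∈ Icc 0 T, gam 0 s = p ∧ gam 1 s = q) {r s : ℝ} (hr : r ∈ Ioc 0 T)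
    (hs : s ∈ Ioc 0 T) :
    (∫ t in 0..1, ‖gt t r‖ ^ 2) - ∫ t in 0..1, ‖gt t s‖ ^ 2 =
      ∫ t in 0..1, -inner ℝ (gam t r - gam t s)
        ((gs t r - B (lam t r, gam t r)) + (gs t s - B (lam t s, gam t s))) := by
  have hg : ∀ {s}, s ∈ Ioc 0 T → ContinuousOn (fun t => gam t s) (Icc 0 1) := fun hs =>
    continuousOn_slice h.gam_cont (Ioc_subset_Icc_self hs)
  have hgtt : ∀ {s}, s ∈ Ioc 0 T →
      ContinuousOn (fun t => gs t s - B (lam t s, gam t s)) (Icc 0 1) := fun hs =>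
    continuousOn_slice (h.continuousOn_gtt hB) hs
  have hf : ContinuousOn (fun t => inner ℝ (gam t r - gam t s) (gt t r + gt t s)) (Icc 0 1) :=
    ContinuousOn.inner (𝕜 := ℝ) ((hg hr).sub (hg hs)) ((h.gt_cont r hr).add (h.gt_cont s hs))
  have hI1 : IntervalIntegrable (fun t => ‖gt t r‖ ^ 2) volume 0 1 :=
    intervalIntegrable_of_continuousOn_Icc ((h.gt_cont r hr).norm.pow 2)
  have hI2 : IntervalIntegrable (fun t => ‖gt t s‖ ^ 2) volume 0 1 :=
    intervalIntegrable_of_continuousOn_Icc ((h.gt_cont s hs).norm.pow 2)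
  have hI3 : IntervalIntegrable (fun t => inner ℝ (gam t r - gam t s)
        ((gs t r - B (lam t r, gam t r)) + (gs t s - B (lam t s, gam t s)))) volume 0 1 :=
    intervalIntegrable_of_continuousOn_Icc
      (ContinuousOn.inner (𝕜 := ℝ) ((hg hr).sub (hg hs)) ((hgtt hr).add (hgtt hs)))
  have key := intervalIntegral.integral_eq_sub_of_hasDerivAt_of_le zero_le_one hf
    (f' := fun t => inner ℝ (gam t r - gam t s)
        ((gs t r - B (lam t r, gam t r)) + (gs t s - B (lam t s, gam t s))) +
          (‖gt t r‖ ^ 2 - ‖gt t s‖ ^ 2)) (fun t ht => by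
      have h1 := ((h.gam_space r hr t ht).sub (h.gam_space s hs t ht)).inner ℝ
        ((h.gt_space r hr t ht).add (h.gt_space s hs t ht))
      refine HasDerivAt.congr_deriv h1 ?_
      congr 1
      simp only [Pi.add_apply]
      rw [inner_sub_left, inner_add_right, inner_add_right, real_inner_self_eq_norm_sq,
        real_inner_self_eq_norm_sq, real_inner_comm (gt t s)]
      ring) (hI3.add (hI1.sub hI2))
  have hr' := hb r (Ioc_subset_Icc_self hr)
  have hs' := hb s (Ioc_subset_Icc_self hs)
  rw [intervalIntegral.integral_add hI3 (hI1.sub hI2), intervalIntegral.integral_sub hI1 hI2,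
    hr'.1, hr'.2, hs'.1, hs'.2] at key
  simp only [sub_self, inner_zero_left] at key
  rw [intervalIntegral.integral_neg]
  linarith

theorem exists_bound_on_compact {F : Type*} [NormedAddCommGroup F] {f : ℝ × ℝ → F}
    (hf : ContinuousOn f (Icc 0 1 ×ˢ Ioc 0 T)) {s : ℝ} (hs : s ∈ Ioo 0 T) :
    ∃ M, ∀ t ∈ Icc (0 : ℝ) 1, ∀ r ∈ Icc (s / 2) ((s + T) / 2), ‖f (t, r)‖ ≤ M := by
  obtain ⟨M, hM⟩ := (isCompact_Icc.prod isCompact_Icc).exists_bound_of_continuousOn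
    (hf.mono (prod_mono (le_refl (Icc (0 : ℝ) 1))
      (fun r hr => ⟨by linarith [hs.1, hr.1], by linarith [hs.2, hr.2]⟩ :
        Icc (s / 2) ((s + T) / 2) ⊆ Ioc 0 T)))
  exact ⟨M, fun t ht r hr => hM (t, r) ⟨ht, hr⟩⟩

/-- The time derivative of the Dirichlet integral. It is obtained from `integral_normSq_sub` by
passing to the limit in the difference quotients, as `gt` need not be differentiable in time. -/
theorem IsStrong.hasDerivAt_dirichlet (h : IsStrong A B T lam gam gs gt) (hB : Continuous B)
    {p q : E} (hb : ∀ s ∈ Icc 0 T, gam 0 s = p ∧ gam 1 s = q) {s : ℝ} (hs : s ∈ Ioo 0 T) :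
    HasDerivAt (fun r => ∫ t in 0..1, ‖gt t r‖ ^ 2)
      (∫ t in 0..1, -(2 * inner ℝ (gs t s) (gs t s - B (lam t s, gam t s)))) s := by
  have hs' := Ioo_subset_Ioc_self hs
  obtain ⟨M₁, hM₁⟩ := exists_bound_on_compact h.gs_cont hs
  obtain ⟨M₂, hM₂⟩ := exists_bound_on_compact (h.continuousOn_gtt hB) hs
  have hJ : ∀ r ∈ Icc (s / 2) ((s + T) / 2), r ∈ Ioc 0 T := fun r hr =>
    ⟨by linarith [hs.1, hr.1], by linarith [hs.2, hr.2]⟩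
  have hsJ : s ∈ Icc (s / 2) ((s + T) / 2) := ⟨by linarith [hs.1], by linarith [hs.2]⟩
  have hnear : ∀ᶠ r in 𝓝[≠] s, r ∈ Icc (s / 2) ((s + T) / 2) :=
    nhdsWithin_le_nhds (Icc_mem_nhds (by linarith [hs.1]) (by linarith [hs.2]))
  set gtt : ℝ → ℝ → E := fun t s => gs t s - B (lam t s, gam t s) with hgtt
  rw [hasDerivAt_iff_tendsto_slope]
  have hlim : Tendsto (fun r => ∫ t in 0..1,
      -inner ℝ ((r - s)⁻¹ • (gam t r - gam t s)) (gtt t r + gtt t s)) (𝓝[≠] s)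
      (𝓝 (∫ t in 0..1, -(2 * inner ℝ (gs t s) (gtt t s)))) := by
    refine intervalIntegral.tendsto_integral_filter_of_dominated_convergence
      (fun _ => M₁ * (M₂ + M₂)) ?_ ?_ intervalIntegrable_const ?_
    · filter_upwards [hnear] with r hr
      have hg : ∀ {s}, s ∈ Ioc 0 T → ContinuousOn (fun t => gam t s) (Icc 0 1) := fun hs =>
        continuousOn_slice h.gam_cont (Ioc_subset_Icc_self hs)
      have hc : ContinuousOn (fun t => -inner ℝ ((r - s)⁻¹ • (gam t r - gam t s))
          (gtt t r + gtt t s)) (Icc 0 1) :=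
        (ContinuousOn.inner (𝕜 := ℝ) (((hg (hJ r hr)).sub (hg hs')).const_smul _)
          ((continuousOn_slice (h.continuousOn_gtt hB) (hJ r hr)).add
            (continuousOn_slice (h.continuousOn_gtt hB) hs'))).neg
      exact (intervalIntegrable_iff.1
        (intervalIntegrable_of_continuousOn_Icc hc)).aestronglyMeasurable
    · filter_upwards [hnear, self_mem_nhdsWithin] with r hr hrs
      refine ae_of_all _ fun t ht => ?_
      rw [uIoc_of_le zero_le_one] at ht
      have ht' := Ioc_subset_Icc_self ht
      have h1 : ‖gam t r - gam t s‖ ≤ M₁ * ‖r - s‖ :=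
        (convex_Icc (s / 2) ((s + T) / 2)).norm_image_sub_le_of_norm_hasDerivWithin_le
          (fun x hx => (h.gam_deriv t ht' x (hJ x hx)).hasDerivWithinAt)
          (fun x hx => hM₁ t ht' x hx) hsJ hr
      have h2 : 0 < ‖r - s‖ := norm_pos_iff.2 (sub_ne_zero.2 hrs)
      have h3 : ‖(r - s)⁻¹ • (gam t r - gam t s)‖ ≤ M₁ := by
        rw [norm_smul, norm_inv, inv_mul_le_iff₀ h2, mul_comm]
        exact h1
      rw [norm_neg]
      refine (norm_inner_le_norm _ _).trans (mul_le_mul h3 ?_ (norm_nonneg _)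
        ((norm_nonneg _).trans h3))
      exact (norm_add_le _ _).trans (add_le_add (hM₂ t ht' r hr) (hM₂ t ht' s hsJ))
    · refine ae_of_all _ fun t ht => ?_
      rw [uIoc_of_le zero_le_one] at ht
      have ht' := Ioc_subset_Icc_self ht
      have h1 : Tendsto (fun r => (r - s)⁻¹ • (gam t r - gam t s)) (𝓝[≠] s) (𝓝 (gs t s)) :=
        (hasDerivAt_iff_tendsto_slope.1 (h.gam_deriv t ht' s hs')).congr fun r => by
          rw [slope_def_module]
      have h2 : Tendsto (fun r => gtt t r) (𝓝[≠] s) (𝓝 (gtt t s)) := by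
        have hc : ContinuousOn (fun r => gtt t r) (Ioc 0 T) :=
          (h.continuousOn_gtt hB).comp (f := fun r : ℝ => (t, r)) (by fun_prop)
            fun r hr => ⟨ht', hr⟩
        exact (hc.continuousAt (Ioc_mem_nhds hs.1 hs.2)).tendsto.mono_left nhdsWithin_le_nhds
      have h3 := (Tendsto.inner (𝕜 := ℝ) h1 (h2.add_const (gtt t s))).neg
      rwa [← two_smul ℝ (gtt t s), real_inner_smul_right] at h3
  refine hlim.congr' ?_
  filter_upwards [hnear] with r hr
  rw [slope_def_module, h.integral_normSq_sub hB hb (hJ r hr) hs',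
    ← intervalIntegral.integral_smul]
  refine intervalIntegral.integral_congr fun t _ => ?_
  simp only [hgtt]
  rw [real_inner_smul_left, smul_eq_mul, mul_neg]

end Dirichlet

section Energy
variable {φ : R3 → ℝ} {ε α T : ℝ} {lam : ℝ → ℝ → ℝ} {gam gs gt : ℝ → ℝ → R3}

/-- The zeroth order part of the energy density. Along the flow, the first two terms balance the
reaction term; the last one, whose factor is large enough, makes the energy coercive. -/
def potential (φ : R3 → ℝ) (ε α : ℝ) (z : ℝ × R3) : ℝ :=
  (1 - α * ε) * z.1 * φ z.2 + α / 2 * φ z.2 ^ 2 + ((1 - α * ε) ^ 2 / α + 1) * z.1 ^ 2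

/-- The energy of a pair at a fixed time, `gt` being the derivative of the curve. -/
def energy (φ : R3 → ℝ) (ε α : ℝ) (lam : ℝ → ℝ → ℝ) (gam gt : ℝ → ℝ → R3) (s : ℝ) : ℝ :=
  1 / 2 * (∫ t in 0..1, ‖gt t s‖ ^ 2) + ∫ t in 0..1, potential φ ε α (lam t s, gam t s)

theorem le_potential (hα : 0 < α) (z : ℝ × R3) :
    α / 4 * φ z.2 ^ 2 + z.1 ^ 2 ≤ potential φ ε α z := by
  unfold potential
  set c := 1 - α * ε
  have h : 0 ≤ (α / 2 * φ z.2 + c * z.1) ^ 2 / α := by positivity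
  have e : (α / 2 * φ z.2 + c * z.1) ^ 2 / α =
      α / 4 * φ z.2 ^ 2 + c * z.1 * φ z.2 + c ^ 2 / α * z.1 ^ 2 := by
    field_simp; ring
  linarith

/-- The growth rate in the energy inequality. -/
def energyRate (ε α : ℝ) : ℝ :=
  (|1 - α * ε| + (2 * ((1 - α * ε) ^ 2 / α + 1) + ε * |1 - α * ε|)) * (4 / α + 1)

/-- The part of the time derivative of the energy density that is not matched by the dissipation is
quadratic in `(lam, φ(gam))`, so that the energy controls it. -/
theorem production_le (hε : 0 < ε) (hα : 0 < α) (z : ℝ × R3) :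
    rhsA φ ε z * ((1 - α * ε) * φ z.2 + 2 * ((1 - α * ε) ^ 2 / α + 1) * z.1) ≤
      energyRate ε α * potential φ ε α z := by
  set c := 1 - α * ε with hc
  set κ := c ^ 2 / α + 1 with hκ
  have hκ0 : 0 < κ := by positivity
  set f := φ z.2
  set l := z.1
  have h1 := le_potential (φ := φ) (ε := ε) hα z
  set K₀ := |c| + (2 * κ + ε * |c|) with hK₀
  have hK0 : 0 ≤ K₀ := by positivity
  have hfl : |f * l| ≤ f ^ 2 + l ^ 2 := by
    rw [abs_mul]; nlinarith [sq_abs f, sq_abs l, sq_nonneg (|f| - |l|), abs_nonneg f, abs_nonneg l]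
  have h2 : rhsA φ ε z * (c * f + 2 * κ * l) ≤ K₀ * (f ^ 2 + l ^ 2) := by
    have e : rhsA φ ε z * (c * f + 2 * κ * l) =
        c * f ^ 2 + (2 * κ - ε * c) * (f * l) - 2 * ε * κ * l ^ 2 := by
      simp only [rhsA]; ring
    have e1 : c * f ^ 2 ≤ |c| * f ^ 2 := mul_le_mul_of_nonneg_right (le_abs_self c) (sq_nonneg f)
    have e2 : (2 * κ - ε * c) * (f * l) ≤ (2 * κ + ε * |c|) * (f ^ 2 + l ^ 2) := by
      refine (le_abs_self _).trans ?_
      rw [abs_mul]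
      refine mul_le_mul ?_ hfl (abs_nonneg _) (by positivity)
      refine (abs_sub _ _).trans ?_
      rw [abs_of_pos (by positivity : 0 < 2 * κ), abs_mul, abs_of_pos hε]
    have e3 : 0 ≤ 2 * ε * κ * l ^ 2 := by positivity
    have e4 : 0 ≤ |c| * l ^ 2 := by positivity
    rw [e, hK₀]
    nlinarith
  have h3 : f ^ 2 + l ^ 2 ≤ (4 / α + 1) * (α / 4 * f ^ 2 + l ^ 2) := by
    have e : (4 / α + 1) * (α / 4 * f ^ 2 + l ^ 2) =
        f ^ 2 + l ^ 2 + (4 / α * l ^ 2 + α / 4 * f ^ 2) := by field_simp; ring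
    rw [e]
    have : 0 ≤ 4 / α * l ^ 2 + α / 4 * f ^ 2 := by positivity
    linarith
  have h4 : (0 : ℝ) ≤ 4 / α + 1 := by positivity
  calc _ ≤ K₀ * (f ^ 2 + l ^ 2) := h2
    _ ≤ K₀ * ((4 / α + 1) * (α / 4 * f ^ 2 + l ^ 2)) := by gcongr
    _ ≤ K₀ * ((4 / α + 1) * potential φ ε α z) := by gcongr
    _ = energyRate ε α * potential φ ε α z := by rw [energyRate]; ring

theorem hasDerivAt_comp_gradient (hφ : ContDiff ℝ 1 φ) {c : ℝ → R3} {c' : R3} {s : ℝ}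
    (hc : HasDerivAt c c' s) :
    HasDerivAt (fun r => φ (c r)) (inner ℝ (gradient φ (c s)) c') s := by
  have h1 := ((hφ.differentiable one_ne_zero) (c s)).hasGradientAt.hasFDerivAt
  exact HasDerivAt.congr_deriv (h1.comp_hasDerivAt s hc) (InnerProductSpace.toDual_apply_apply ..)

theorem continuous_potential (hφ : ContDiff ℝ 1 φ) : Continuous (potential φ ε α) := by
  have := hφ.continuous
  unfold potential
  fun_prop

theorem continuous_rhsA (hφ : ContDiff ℝ 1 φ) : Continuous (rhsA φ ε) := by
  have := hφ.continuous
  unfold rhsA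
  fun_prop

theorem continuous_rhsB (hφ : ContDiff ℝ 1 φ) : Continuous (rhsB φ ε α) := by
  have := hφ.continuous
  have := continuous_gradient hφ
  unfold rhsB
  fun_prop

/-- The time derivative of the zeroth order part of the energy density. -/
def potentialRate (φ : R3 → ℝ) (ε α : ℝ) (z : ℝ × R3) (v : R3) : ℝ :=
  ((1 - α * ε) * z.1 + α * φ z.2) * inner ℝ (gradient φ z.2) v +
    rhsA φ ε z * ((1 - α * ε) * φ z.2 + 2 * ((1 - α * ε) ^ 2 / α + 1) * z.1)

theorem IsStrong.hasDerivAt_potential (hφ : ContDiff ℝ 1 φ)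
    (h : IsStrong (rhsA φ ε) (rhsB φ ε α) T lam gam gs gt) {t s : ℝ} (ht : t ∈ Icc (0 : ℝ) 1)
    (hs : s ∈ Ioc 0 T) :
    HasDerivAt (fun r => potential φ ε α (lam t r, gam t r))
      (potentialRate φ ε α (lam t s, gam t s) (gs t s)) s := by
  have h1 := h.lam_deriv t ht s hs
  have h2 := hasDerivAt_comp_gradient hφ (h.gam_deriv t ht s hs)
  have h3 := (((h1.const_mul (1 - α * ε)).mul h2).add ((h2.pow 2).const_mul (α / 2))).add
    ((h1.pow 2).const_mul ((1 - α * ε) ^ 2 / α + 1))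
  refine HasDerivAt.congr_deriv h3 ?_
  simp only [potentialRate]
  push_cast
  ring

theorem IsStrong.continuousOn_potentialRate (hφ : ContDiff ℝ 1 φ)
    (h : IsStrong (rhsA φ ε) (rhsB φ ε α) T lam gam gs gt) :
    ContinuousOn (fun p : ℝ × ℝ => potentialRate φ ε α (lam p.1 p.2, gam p.1 p.2) (gs p.1 p.2))
      (Icc 0 1 ×ˢ Ioc 0 T) := by
  have hc : Continuous fun q : (ℝ × R3) × R3 => potentialRate φ ε α q.1 q.2 := by
    have := hφ.continuous
    have := continuous_gradient hφ
    have := continuous_rhsA (ε := ε) hφ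
    unfold potentialRate
    fun_prop
  exact hc.comp_continuousOn (h.continuousOn_state.prodMk h.gs_cont)

theorem IsStrong.continuousOn_potential (hφ : ContDiff ℝ 1 φ)
    (h : IsStrong (rhsA φ ε) (rhsB φ ε α) T lam gam gs gt) {s : ℝ} (hs : s ∈ Ioc 0 T) :
    ContinuousOn (fun t => potential φ ε α (lam t s, gam t s)) (Icc 0 1) :=
  (continuous_potential hφ).comp_continuousOn (continuousOn_slice h.continuousOn_state hs)

theorem IsStrong.hasDerivAt_integral_potential (hφ : ContDiff ℝ 1 φ)
    (h : IsStrong (rhsA φ ε) (rhsB φ ε α) T lam gam gs gt) {s : ℝ} (hs : s ∈ Ioo 0 T) :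
    HasDerivAt (fun r => ∫ t in 0..1, potential φ ε α (lam t r, gam t r))
      (∫ t in 0..1, potentialRate φ ε α (lam t s, gam t s) (gs t s)) s := by
  obtain ⟨M, hM⟩ := exists_bound_on_compact (h.continuousOn_potentialRate hφ) hs
  have hJ : ∀ r ∈ Icc (s / 2) ((s + T) / 2), r ∈ Ioc 0 T := fun r hr =>
    ⟨by linarith [hs.1, hr.1], by linarith [hs.2, hr.2]⟩
  have hnhds : Icc (s / 2) ((s + T) / 2) ∈ 𝓝 s :=
    Icc_mem_nhds (by linarith [hs.1]) (by linarith [hs.2])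
  refine (intervalIntegral.hasDerivAt_integral_of_dominated_loc_of_deriv_le (bound := fun _ => M)
    (F := fun r t => potential φ ε α (lam t r, gam t r))
    (F' := fun r t => potentialRate φ ε α (lam t r, gam t r) (gs t r)) hnhds ?_ ?_ ?_ ?_
    intervalIntegrable_const ?_).2
  · filter_upwards [hnhds] with r hr
    exact (intervalIntegrable_iff.1 (intervalIntegrable_of_continuousOn_Icc
      (h.continuousOn_potential hφ (hJ r hr)))).aestronglyMeasurable
  · exact intervalIntegrable_of_continuousOn_Icc
      (h.continuousOn_potential hφ (Ioo_subset_Ioc_self hs))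
  · exact (intervalIntegrable_iff.1 (intervalIntegrable_of_continuousOn_Icc (continuousOn_slice
      (h.continuousOn_potentialRate hφ) (Ioo_subset_Ioc_self hs)))).aestronglyMeasurable
  · refine ae_of_all _ fun t ht r hr => ?_
    rw [uIoc_of_le zero_le_one] at ht
    exact hM t (Ioc_subset_Icc_self ht) r hr
  · refine ae_of_all _ fun t ht r hr => ?_
    rw [uIoc_of_le zero_le_one] at ht
    exact h.hasDerivAt_potential hφ (Ioc_subset_Icc_self ht) (hJ r hr)

/-- The energy inequality: the energy decreases by `∫ ‖gs‖²`, up to a term that it controls. -/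
theorem IsStrong.exists_hasDerivAt_energy (hφ : ContDiff ℝ 1 φ) (hε : 0 < ε) (hα : 0 < α)
    (h : IsStrong (rhsA φ ε) (rhsB φ ε α) T lam gam gs gt) {p q : R3}
    (hb : ∀ s ∈ Icc 0 T, gam 0 s = p ∧ gam 1 s = q) {s : ℝ} (hs : s ∈ Ioo 0 T) :
    ∃ e', HasDerivAt (energy φ ε α lam gam gt) e' s ∧
      e' ≤ energyRate ε α * energy φ ε α lam gam gt s := by
  have hs' := Ioo_subset_Ioc_self hs
  have h1 := (h.hasDerivAt_dirichlet (continuous_rhsB hφ) hb hs).const_mul (1 / 2)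
  refine ⟨_, h1.add (h.hasDerivAt_integral_potential hφ hs), ?_⟩
  have hgs := continuousOn_slice h.gs_cont hs'
  have hI1 : IntervalIntegrable (fun t => -(2 * inner ℝ (gs t s)
      (gs t s - rhsB φ ε α (lam t s, gam t s)))) volume 0 1 :=
    intervalIntegrable_of_continuousOn_Icc ((continuousOn_const.mul (ContinuousOn.inner (𝕜 := ℝ) hgs
      (continuousOn_slice (h.continuousOn_gtt (continuous_rhsB hφ)) hs'))).neg)
  have hI2 := intervalIntegrable_of_continuousOn_Icc
    (continuousOn_slice (h.continuousOn_potentialRate hφ) hs')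
  have hI3 := intervalIntegrable_of_continuousOn_Icc (h.continuousOn_potential hφ hs')
  have hrate : 0 ≤ energyRate ε α := by unfold energyRate; positivity
  rw [← intervalIntegral.integral_const_mul,
    ← intervalIntegral.integral_add (hI1.const_mul _) hI2, energy, mul_add]
  have h0 : 0 ≤ energyRate ε α * (1 / 2 * ∫ t in 0..1, ‖gt t s‖ ^ 2) := by
    have : 0 ≤ ∫ t in (0 : ℝ)..1, ‖gt t s‖ ^ 2 :=
      intervalIntegral.integral_nonneg zero_le_one fun t _ => sq_nonneg _
    positivity
  refine le_trans ?_ (le_add_of_nonneg_left h0)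
  rw [← intervalIntegral.integral_const_mul]
  refine intervalIntegral.integral_mono_on zero_le_one ((hI1.const_mul _).add hI2)
    (hI3.const_mul _) fun t _ => ?_
  have hprod := production_le (φ := φ) hε hα (lam t s, gam t s)
  have e : inner ℝ (gs t s) (gs t s - rhsB φ ε α (lam t s, gam t s)) =
      ‖gs t s‖ ^ 2 + ((1 - α * ε) * lam t s + α * φ (gam t s)) *
        inner ℝ (gradient φ (gam t s)) (gs t s) := by
    rw [rhsB, sub_neg_eq_add, inner_add_right, real_inner_self_eq_norm_sq, real_inner_smul_right,
      real_inner_comm]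
  -- the first term of `potentialRate` cancels against the last term of `e`
  rw [e, potentialRate]
  simp only at hprod ⊢
  nlinarith [sq_nonneg ‖gs t s‖]

/-- The energy bounds the curve in the supremum norm. -/
theorem IsStrong.norm_sub_le_energy (hα : 0 < α)
    (h : IsStrong (rhsA φ ε) (rhsB φ ε α) T lam gam gs gt) {s : ℝ} (hs : s ∈ Ioc 0 T) {t : ℝ}
    (ht : t ∈ Icc (0 : ℝ) 1) :
    ‖gam t s - gam 0 s‖ ≤ 1 / 2 + energy φ ε α lam gam gt s := by
  have hc := continuousOn_slice h.gam_cont (Ioc_subset_Icc_self hs)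
  have hsub : Icc 0 t ⊆ Icc (0 : ℝ) 1 := Icc_subset_Icc_right ht.2
  have hi : IntervalIntegrable (fun t => gt t s) volume 0 t :=
    ContinuousOn.intervalIntegrable (by rw [uIcc_of_le ht.1]; exact (h.gt_cont s hs).mono hsub)
  have h1 := intervalIntegral.integral_eq_sub_of_hasDerivAt_of_le ht.1 (hc.mono hsub)
    (fun x hx => h.gam_space s hs x ⟨hx.1, hx.2.trans_le ht.2⟩) hi
  have hsq : IntervalIntegrable (fun x => ‖gt x s‖ ^ 2) volume 0 1 :=
    intervalIntegrable_of_continuousOn_Icc ((h.gt_cont s hs).norm.pow 2)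
  have hgb : ContinuousOn (fun t => 1 / 2 + 1 / 2 * ‖gt t s‖ ^ 2) (Icc 0 1) :=
    continuousOn_const.add (continuousOn_const.mul ((h.gt_cont s hs).norm.pow 2))
  have hgi : IntervalIntegrable (fun t => 1 / 2 + 1 / 2 * ‖gt t s‖ ^ 2) volume 0 t :=
    ContinuousOn.intervalIntegrable (by rw [uIcc_of_le ht.1]; exact hgb.mono hsub)
  have h2 : ‖∫ x in 0..t, gt x s‖ ≤ ∫ x in 0..t, (1 / 2 + 1 / 2 * ‖gt x s‖ ^ 2) :=
    intervalIntegral.norm_integral_le_of_norm_le ht.1 (ae_of_all _ fun x _ => by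
      nlinarith [sq_nonneg (‖gt x s‖ - 1)]) hgi
  have h3 : ∫ x in 0..t, (1 / 2 + 1 / 2 * ‖gt x s‖ ^ 2) ≤
      ∫ x in 0..1, (1 / 2 + 1 / 2 * ‖gt x s‖ ^ 2) :=
    intervalIntegral.integral_mono_interval le_rfl ht.1 ht.2
      (ae_of_all _ fun x => by positivity) (intervalIntegrable_of_continuousOn_Icc hgb)
  have h4 : ∫ x in (0 : ℝ)..1, (1 / 2 + 1 / 2 * ‖gt x s‖ ^ 2) =
      1 / 2 + 1 / 2 * ∫ x in 0..1, ‖gt x s‖ ^ 2 := by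
    rw [intervalIntegral.integral_add intervalIntegrable_const (hsq.const_mul _),
      intervalIntegral.integral_const_mul]
    simp
  have h5 : 0 ≤ ∫ x in 0..1, potential φ ε α (lam x s, gam x s) :=
    intervalIntegral.integral_nonneg zero_le_one fun x _ =>
      le_trans (by positivity) (le_potential hα (lam x s, gam x s))
  rw [← h1, energy]
  linarith

/-- The a priori bound: the distance to the end point grows at most exponentially. -/
theorem IsStrong.norm_sub_le_exp (hφ : ContDiff ℝ 1 φ) (hε : 0 < ε) (hα : 0 < α)
    (h : IsStrong (rhsA φ ε) (rhsB φ ε α) T lam gam gs gt) {p q : R3}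
    (hb : ∀ s ∈ Icc 0 T, gam 0 s = p ∧ gam 1 s = q) {s₀ s : ℝ} (hs₀ : 0 < s₀) (hs₀s : s₀ ≤ s)
    (hsT : s < T) {t : ℝ} (ht : t ∈ Icc (0 : ℝ) 1) :
    ‖gam t s - p‖ ≤ 1 / 2 +
      Real.exp (energyRate ε α * (s - s₀)) * energy φ ε α lam gam gt s₀ := by
  have hs : s ∈ Ioc 0 T := ⟨hs₀.trans_le hs₀s, hsT.le⟩
  have h1 := h.norm_sub_le_energy hα hs ht
  rw [(hb s (Ioc_subset_Icc_self hs)).1] at h1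
  refine h1.trans (add_le_add le_rfl ?_)
  set K := energyRate ε α
  set H := energy φ ε α lam gam gt
  have hder : ∀ r ∈ Ioo 0 T,
      ∃ e', HasDerivAt (fun r => Real.exp (-(K * r)) * H r) e' r ∧ e' ≤ 0 := by
    intro r hr
    obtain ⟨e', he, hle⟩ := h.exists_hasDerivAt_energy hφ hε hα hb hr
    have h2 : HasDerivAt (fun r => Real.exp (-(K * r)) * H r)
        (Real.exp (-(K * r)) * (-(K * 1)) * H r + Real.exp (-(K * r)) * e') r :=
      (((hasDerivAt_id r).const_mul K).neg.exp).mul he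
    refine ⟨_, h2, ?_⟩
    have := mul_le_mul_of_nonneg_left hle (Real.exp_pos (-(K * r))).le
    linarith
  have hanti : AntitoneOn (fun r => Real.exp (-(K * r)) * H r) (Ioo 0 T) := by
    refine antitoneOn_of_deriv_nonpos (convex_Ioo 0 T) (fun r hr => ?_) (fun r hr => ?_)
      fun r hr => ?_
    · obtain ⟨e', he, -⟩ := hder r hr
      exact he.continuousAt.continuousWithinAt
    · obtain ⟨e', he, -⟩ := hder r (by simpa using hr)
      exact he.differentiableAt.differentiableWithinAt
    · obtain ⟨e', he, hle⟩ := hder r (by simpa using hr)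
      rw [he.deriv]; exact hle
  have h2 : Real.exp (-(K * s)) * H s ≤ Real.exp (-(K * s₀)) * H s₀ :=
    hanti ⟨hs₀, hs₀s.trans_lt hsT⟩ ⟨hs.1, hsT⟩ hs₀s
  have h3 : Real.exp (K * s) * (Real.exp (-(K * s)) * H s) ≤
      Real.exp (K * s) * (Real.exp (-(K * s₀)) * H s₀) := by gcongr
  rw [← mul_assoc, ← mul_assoc, ← Real.exp_add, ← Real.exp_add] at h3
  rw [show K * (s - s₀) = K * s + -(K * s₀) by ring]
  simpa using h3

/-- The multiplier stays bounded as long as `φ` does along the curve. -/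
theorem IsInterior.abs_lam_le {B : ℝ × R3 → R3} (hε : 0 < ε)
    (h : IsInterior (rhsA φ ε) B T lam gam) {M : ℝ} {t : ℝ} (ht : t ∈ Icc (0 : ℝ) 1) {s : ℝ}
    (hs : s ∈ Icc 0 T) (hM : ∀ r ∈ Ioo 0 s, |φ (gam t r)| ≤ M) :
    |lam t s| ≤ |lam t 0| + s * M := by
  rcases hs.1.eq_or_lt with h0 | h0
  · rw [← h0]; simp
  have hc : ContinuousOn (fun r => Real.exp (ε * r) * lam t r) (Icc 0 s) := by
    have h1 : ContinuousOn (lam t) (Icc 0 s) :=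
      h.lam_cont.comp (f := fun r : ℝ => (t, r)) (by fun_prop)
        fun r hr => ⟨ht, hr.1, hr.2.trans hs.2⟩
    exact (by fun_prop : Continuous fun r => Real.exp (ε * r)).continuousOn.mul h1
  obtain ⟨r, hr, hslope⟩ := exists_hasDerivAt_eq_slope (fun r => Real.exp (ε * r) * lam t r)
    (fun r => Real.exp (ε * r) * φ (gam t r)) h0 hc (fun r hr => by
      have h1 := (((hasDerivAt_id r).const_mul ε).exp).mul
        (h.lam_deriv t ht r ⟨hr.1, hr.2.le.trans hs.2⟩)
      refine HasDerivAt.congr_deriv h1 ?_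
      simp only [rhsA, id]
      ring)
  have he := Real.exp_pos (ε * s)
  have h2 : Real.exp (ε * s) * lam t s = lam t 0 + s * (Real.exp (ε * r) * φ (gam t r)) := by
    rw [hslope]; field_simp; simp; ring
  have h3 : Real.exp (ε * s) * |lam t s| ≤ Real.exp (ε * s) * (|lam t 0| + s * M) := by
    have h4 : Real.exp (ε * s) * |lam t s| = |Real.exp (ε * s) * lam t s| := by
      rw [abs_mul, abs_of_pos he]
    rw [h4, h2, mul_add]
    have h5 : 1 ≤ Real.exp (ε * s) := Real.one_le_exp (by positivity)
    have h6 : Real.exp (ε * r) ≤ Real.exp (ε * s) :=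
      Real.exp_le_exp.2 (mul_le_mul_of_nonneg_left hr.2.le hε.le)
    refine (abs_add_le _ _).trans (add_le_add (le_mul_of_one_le_left (abs_nonneg _) h5) ?_)
    rw [abs_mul, abs_mul, abs_of_pos h0, abs_of_pos (Real.exp_pos _), mul_left_comm]
    have := hM r hr
    gcongr
  exact le_of_mul_le_mul_left h3 he

end Energy

/-! ### Global existence -/

/-- A bound that is strict initially holds throughout or up to a first time of exit. -/
theorem forall_lt_or_exists_exit {f : ℝ × ℝ → ℝ} {R S : ℝ}
    (hf : ContinuousOn f (Icc 0 1 ×ˢ Icc 0 S)) (hinit : ∀ t ∈ Icc (0 : ℝ) 1, f (t, 0) < R) :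
    (∀ t ∈ Icc (0 : ℝ) 1, ∀ s ∈ Icc 0 S, f (t, s) < R) ∨
      ∃ s₁ ∈ Ioc 0 S, (∀ t ∈ Icc (0 : ℝ) 1, ∀ s ∈ Ico 0 s₁, f (t, s) < R) ∧
        ∃ t ∈ Icc (0 : ℝ) 1, R ≤ f (t, s₁) := by
  refine or_iff_not_imp_left.2 fun hcon => ?_
  push Not at hcon
  obtain ⟨t₀, ht₀, s₀, hs₀, hR₀⟩ := hcon
  have hcompact : IsCompact ((Icc (0 : ℝ) 1 ×ˢ Icc 0 S) ∩ f ⁻¹' Ici R) :=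
    (isCompact_Icc.prod isCompact_Icc).of_isClosed_subset
      (hf.preimage_isClosed_of_isClosed (isClosed_Icc.prod isClosed_Icc) isClosed_Ici)
      inter_subset_left
  obtain ⟨⟨t₁, s₁⟩, ⟨⟨ht₁, hs₁⟩, hR₁⟩, hmin⟩ := hcompact.exists_isMinOn
    ⟨(t₀, s₀), ⟨ht₀, hs₀⟩, hR₀⟩ continuous_snd.continuousOn
  simp only [mem_preimage, mem_Ici] at hR₁ ht₁ hs₁
  have hpos : 0 < s₁ := by
    rcases hs₁.1.eq_or_lt with h | h
    · rw [← h] at hR₁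
      exact absurd (hinit t₁ ht₁) (not_lt.2 hR₁)
    · exact h
  refine ⟨s₁, ⟨hpos, hs₁.2⟩, fun t ht s hs => ?_, t₁, ht₁, hR₁⟩
  by_contra! hle
  exact absurd (hmin ⟨⟨ht, hs.1, hs.2.le.trans hs₁.2⟩, hle⟩ : s₁ ≤ s) (not_le.2 hs.2)

theorem forall_le_of_forall_Ico_le {f : ℝ → ℝ} {R s₁ : ℝ} (hs₁ : 0 < s₁)
    (hf : ContinuousOn f (Icc 0 s₁)) (h : ∀ s ∈ Ico 0 s₁, f s ≤ R) : ∀ s ∈ Icc 0 s₁, f s ≤ R := by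
  intro s hs
  have hcl : s ∈ closure (Ico 0 s₁) := by rwa [closure_Ico hs₁.ne]
  exact ContinuousWithinAt.closure_le hcl ((hf s hs).mono Ico_subset_Icc_self)
    continuousWithinAt_const h

/-- Open-closed argument in time: a bound that is strict initially, and that is strict at a time as
soon as it holds weakly up to that time, holds throughout. -/
theorem forall_lt_of_forall_exit {f : ℝ × ℝ → ℝ} {R S : ℝ}
    (hf : ContinuousOn f (Icc 0 1 ×ˢ Icc 0 S)) (hinit : ∀ t ∈ Icc (0 : ℝ) 1, f (t, 0) < R)
    (hstep : ∀ s₁ ∈ Ioc 0 S, (∀ t ∈ Icc (0 : ℝ) 1, ∀ s ∈ Icc 0 s₁, f (t, s) ≤ R) →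
      ∀ t ∈ Icc (0 : ℝ) 1, f (t, s₁) < R) :
    ∀ t ∈ Icc (0 : ℝ) 1, ∀ s ∈ Icc 0 S, f (t, s) < R := by
  refine (forall_lt_or_exists_exit hf hinit).resolve_right ?_
  rintro ⟨s₁, hs₁, hbefore, t₁, ht₁, hR₁⟩
  refine absurd (hstep s₁ hs₁ (fun t ht => ?_) t₁ ht₁) (not_lt.2 hR₁)
  exact forall_le_of_forall_Ico_le hs₁.1
    (hf.comp (f := fun s : ℝ => (t, s)) (by fun_prop) fun s hs => ⟨ht, hs.1, hs.2.trans hs₁.2⟩)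
    fun s hs => (hbefore t ht s hs).le

/-- A strict bound at the initial time persists for a short time. -/
theorem exists_forall_lt_of_initial {f : ℝ × ℝ → ℝ} {R : ℝ}
    (hf : ContinuousOn f (Icc 0 1 ×ˢ Icc 0 1)) (hinit : ∀ t ∈ Icc (0 : ℝ) 1, f (t, 0) < R) :
    ∃ s₀, 0 < s₀ ∧ ∀ t ∈ Icc (0 : ℝ) 1, ∀ s ∈ Icc 0 s₀, f (t, s) < R := by
  rcases forall_lt_or_exists_exit hf hinit with h | ⟨s₁, hs₁, h, -⟩
  · exact ⟨1, one_pos, h⟩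
  · exact ⟨s₁ / 2, half_pos hs₁.1, fun t ht s hs =>
      h t ht s ⟨hs.1, hs.2.trans_lt (half_lt_self hs₁.1)⟩⟩

section Strong
variable {E : Type*} [NormedAddCommGroup E] [NormedSpace ℝ E] {A A' : ℝ × E → ℝ}
  {B B' : ℝ × E → E} {T T' : ℝ} {lam lam' : ℝ → ℝ → ℝ} {gam gs gt gam' gs' gt' : ℝ → ℝ → E}

theorem IsStrong.congr (h : IsStrong A B T lam gam gs gt)
    (he : ∀ t ∈ Icc (0 : ℝ) 1, ∀ s ∈ Icc 0 T, A (lam t s, gam t s) = A' (lam t s, gam t s) ∧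
      B (lam t s, gam t s) = B' (lam t s, gam t s)) : IsStrong A' B' T lam gam gs gt where
  lam_cont := h.lam_cont
  gam_cont := h.gam_cont
  lam_deriv t ht s hs := (he t ht s (Ioc_subset_Icc_self hs)).1 ▸ h.lam_deriv t ht s hs
  gs_cont := h.gs_cont
  gam_deriv := h.gam_deriv
  gt_cont := h.gt_cont
  gam_space := h.gam_space
  gt_space s hs t ht :=
    (he t (Ioo_subset_Icc_self ht) s (Ioc_subset_Icc_self hs)).2 ▸ h.gt_space s hs t ht

theorem IsStrong.mono (h : IsStrong A B T lam gam gs gt) (hT : T' ≤ T) :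
    IsStrong A B T' lam gam gs gt where
  lam_cont := h.lam_cont.mono (prod_mono le_rfl (Icc_subset_Icc_right hT))
  gam_cont := h.gam_cont.mono (prod_mono le_rfl (Icc_subset_Icc_right hT))
  lam_deriv t ht s hs := h.lam_deriv t ht s (Ioc_subset_Ioc_right hT hs)
  gs_cont := h.gs_cont.mono (prod_mono le_rfl (Ioc_subset_Ioc_right hT))
  gam_deriv t ht s hs := h.gam_deriv t ht s (Ioc_subset_Ioc_right hT hs)
  gt_cont s hs := h.gt_cont s (Ioc_subset_Ioc_right hT hs)
  gam_space s hs := h.gam_space s (Ioc_subset_Ioc_right hT hs)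
  gt_space s hs := h.gt_space s (Ioc_subset_Ioc_right hT hs)

theorem IsStrong.gt_eq (h : IsStrong A B T lam gam gs gt) (h' : IsStrong A' B' T' lam' gam' gs' gt')
    {s : ℝ} (hs : s ∈ Ioc 0 T) (hs' : s ∈ Ioc 0 T')
    (he : ∀ t ∈ Icc (0 : ℝ) 1, gam t s = gam' t s) : ∀ t ∈ Ioo (0 : ℝ) 1, gt t s = gt' t s := by
  intro t ht
  refine (h.gam_space s hs t ht).unique ((h'.gam_space s hs' t ht).congr_of_eventuallyEq ?_)
  filter_upwards [Icc_mem_nhds ht.1 ht.2] with x hx using he x hx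

end Strong

theorem IsStrong.energy_eq {A A' : ℝ × R3 → ℝ} {B B' : ℝ × R3 → R3} {T T' : ℝ}
    {lam lam' : ℝ → ℝ → ℝ} {gam gs gt gam' gs' gt' : ℝ → ℝ → R3} (φ : R3 → ℝ) (ε α : ℝ)
    (h : IsStrong A B T lam gam gs gt) (h' : IsStrong A' B' T' lam' gam' gs' gt')
    {s : ℝ} (hs : s ∈ Ioc 0 T) (hs' : s ∈ Ioc 0 T')
    (he : ∀ t ∈ Icc (0 : ℝ) 1, lam t s = lam' t s ∧ gam t s = gam' t s) :
    energy φ ε α lam gam gt s = energy φ ε α lam' gam' gt' s := by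
  have hgt := h.gt_eq h' hs hs' fun t ht => (he t ht).2
  unfold energy
  congr 1
  · congr 1
    rw [intervalIntegral.integral_of_le zero_le_one, intervalIntegral.integral_of_le zero_le_one,
      integral_Ioc_eq_integral_Ioo, integral_Ioc_eq_integral_Ioo]
    exact setIntegral_congr_fun measurableSet_Ioo fun t ht => by simp only [hgt t ht]
  · refine intervalIntegral.integral_congr fun t ht => ?_
    rw [uIcc_of_le zero_le_one] at ht
    simp only [(he t ht).1, (he t ht).2]

/-- For each radius there is a global flow that follows the system inside the ball. -/
theorem exists_truncated_flow {φ : R3 → ℝ} (hφ : ContDiff ℝ 1 φ)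
    (hgrad : LocallyLipschitz (gradient φ)) (ε α : ℝ) {lam0 : ℝ → ℝ} {gam0 : ℝ → R3}
    (hlam0 : ContinuousOn lam0 (Icc 0 1)) (hgam0 : ContinuousOn gam0 (Icc 0 1)) (R : ℝ) :
    ∃ lam gam gs gt,
      (∀ T, (∀ t ∈ Icc (0 : ℝ) 1, ∀ s ∈ Icc 0 T, ‖(lam t s, gam t s)‖ ≤ R) →
        IsStrong (rhsA φ ε) (rhsB φ ε α) T lam gam gs gt) ∧
      ContinuousOn (fun p : ℝ × ℝ => (lam p.1 p.2, gam p.1 p.2)) (Icc 0 1 ×ˢ Ici 0) ∧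
      (∀ t ∈ Icc (0 : ℝ) 1, lam t 0 = lam0 t ∧ gam t 0 = gam0 t) ∧
      ∀ s, 0 ≤ s → gam 0 s = gam0 0 ∧ gam 1 s = gam0 1 := by
  obtain ⟨A, LA, MA, hA, hAM, hAe⟩ := exists_truncation (locallyLipschitz_rhsA hφ ε) R
  obtain ⟨B, LB, MB, hB, hBM, hBe⟩ := exists_truncation (locallyLipschitz_rhsB hφ hgrad ε α) R
  obtain ⟨lam, gam, gs, gt, hs, hinit, hbdry⟩ := exists_isStrong (L := max LA LB) (M := max MA MB)
    (hA.weaken (le_max_left _ _)) (hB.weaken (le_max_right _ _))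
    (fun z => (hAM z).trans (le_max_left _ _)) (fun z => (hBM z).trans (le_max_right _ _))
    hlam0 hgam0
  refine ⟨lam, gam, gs, gt, fun T hT => (hs T).congr fun t ht s hs' => ⟨hAe _ (hT t ht s hs'),
    hBe _ (hT t ht s hs')⟩, ?_, hinit, hbdry⟩
  refine continuousOn_of_locally_continuousOn fun x hx => ⟨univ ×ˢ Iio (x.2 + 1),
    isOpen_univ.prod isOpen_Iio, ⟨mem_univ _, lt_add_one x.2⟩, ?_⟩
  exact ((hs (x.2 + 1)).lam_cont.prodMk (hs (x.2 + 1)).gam_cont).mono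
    fun y hy => ⟨hy.1.1, hy.1.2, hy.2.2.le⟩

/-- Solutions for the same initial data coincide, the end points of the curve staying fixed. -/
theorem IsInterior.unique_of_data {φ : R3 → ℝ} (hφ : ContDiff ℝ 1 φ)
    (hgrad : LocallyLipschitz (gradient φ)) {ε α T : ℝ} {lam0 : ℝ → ℝ} {gam0 : ℝ → R3}
    {lam lam' : ℝ → ℝ → ℝ} {gam gam' : ℝ → ℝ → R3}
    (h : IsInterior (rhsA φ ε) (rhsB φ ε α) T lam gam)
    (h' : IsInterior (rhsA φ ε) (rhsB φ ε α) T lam' gam')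
    (hinit : ∀ t ∈ Icc (0 : ℝ) 1, lam t 0 = lam0 t ∧ gam t 0 = gam0 t)
    (hbdry : ∀ s, 0 ≤ s → gam 0 s = gam0 0 ∧ gam 1 s = gam0 1)
    (hinit' : ∀ t ∈ Icc (0 : ℝ) 1, lam' t 0 = lam0 t ∧ gam' t 0 = gam0 t)
    (hbdry' : ∀ s, 0 ≤ s → gam' 0 s = gam0 0 ∧ gam' 1 s = gam0 1) :
    ∀ t ∈ Icc (0 : ℝ) 1, ∀ s ∈ Icc 0 T, lam t s = lam' t s ∧ gam t s = gam' t s :=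
  IsInterior.unique (locallyLipschitz_rhsA hφ ε) (locallyLipschitz_rhsB hφ hgrad ε α) h h'
    (fun t ht => ⟨(hinit t ht).1.trans (hinit' t ht).1.symm,
      (hinit t ht).2.trans (hinit' t ht).2.symm⟩)
    fun s hs => ⟨(hbdry s hs.1).1.trans (hbdry' s hs.1).1.symm,
      (hbdry s hs.1).2.trans (hbdry' s hs.1).2.symm⟩

/-- The energy bounds the truncated flow independently of the radius, so that for a large radius the
truncation is not felt up to the prescribed time. -/
theorem exists_isStrong_upto {φ : R3 → ℝ} (hφ : ContDiff ℝ 1 φ)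
    (hgrad : LocallyLipschitz (gradient φ)) {ε α : ℝ} (hε : 0 < ε) (hα : 0 < α) {lam0 : ℝ → ℝ}
    {gam0 : ℝ → R3} (hlam0 : ContinuousOn lam0 (Icc 0 1)) (hgam0 : ContinuousOn gam0 (Icc 0 1))
    (S : ℝ) :
    ∃ lam gam gs gt, IsStrong (rhsA φ ε) (rhsB φ ε α) S lam gam gs gt ∧
      (∀ t ∈ Icc (0 : ℝ) 1, lam t 0 = lam0 t ∧ gam t 0 = gam0 t) ∧
      ∀ s, 0 ≤ s → gam 0 s = gam0 0 ∧ gam 1 s = gam0 1 := by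
  obtain ⟨R₀', hR₀'⟩ := isCompact_Icc.exists_bound_of_continuousOn (hlam0.prodMk hgam0)
  -- a solution on a short time interval serves as a reference: its energy at the time `s₀` bounds
  -- the energy of all truncated flows with larger radius
  set R₀ := R₀' + 1
  obtain ⟨lam₁, gam₁, gs₁, gt₁, hst₁, hc₁, hin₁, hbd₁⟩ :=
    exists_truncated_flow hφ hgrad ε α hlam0 hgam0 R₀
  obtain ⟨s₀, hs₀, hsmall⟩ := exists_forall_lt_of_initial (R := R₀)
    (hc₁.norm.mono (prod_mono le_rfl fun s hs => hs.1))
    (fun t ht => by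
      simp only [(hin₁ t ht).1, (hin₁ t ht).2]
      exact (hR₀' t ht).trans_lt (lt_add_one _))
  have hU₁ := hst₁ s₀ fun t ht s hs => (hsmall t ht s hs).le
  -- the bounds on the curve and on the multiplier up to time `S`
  set K := energyRate ε α
  have hK : 0 ≤ K := by simp only [K]; unfold energyRate; positivity
  set D := max R₀ (‖gam0 0‖ + (1 / 2 + Real.exp (K * S) * |energy φ ε α lam₁ gam₁ gt₁ s₀|))
  obtain ⟨M, hM⟩ := (isCompact_closedBall (0 : R3) D).exists_bound_of_continuousOn
    hφ.continuous.continuousOn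
  set R := max D (R₀ + S * M) + 1
  obtain ⟨lam, gam, gs, gt, hst, hc, hin, hbd⟩ :=
    exists_truncated_flow hφ hgrad ε α hlam0 hgam0 R
  have hD : R₀ ≤ D := le_max_left _ _
  have hDR : D < R := (le_max_left _ _).trans_lt (lt_add_one _)
  have hR₀ : ∀ t ∈ Icc (0 : ℝ) 1, ‖(lam t 0, gam t 0)‖ < R₀ := fun t ht => by
    rw [(hin t ht).1, (hin t ht).2]
    exact (hR₀' t ht).trans_lt (lt_add_one _)
  have hM0 : 0 ≤ M := (norm_nonneg _).trans (hM (gam 0 0) (by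
    rw [mem_closedBall_zero_iff]
    exact (norm_snd_le (lam 0 0, gam 0 0)).trans ((hR₀ 0 (by simp)).le.trans hD)))
  refine ⟨lam, gam, gs, gt, hst S fun t ht s hs => le_of_lt ?_, hin, hbd⟩
  refine forall_lt_of_forall_exit (f := fun p : ℝ × ℝ => ‖(lam p.1 p.2, gam p.1 p.2)‖)
    (hc.norm.mono (prod_mono le_rfl fun s hs => hs.1))
    (fun t ht => (hR₀ t ht).trans (hD.trans_lt hDR)) (fun s₁ hs₁ hle => ?_) t ht s hs
  have hU := hst s₁ hle
  have hS : 0 ≤ S := hs₁.1.le.trans hs₁.2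
  have hagree : ∀ t ∈ Icc (0 : ℝ) 1, ∀ s ∈ Icc 0 (min s₀ s₁),
      lam t s = lam₁ t s ∧ gam t s = gam₁ t s :=
    IsInterior.unique_of_data hφ hgrad (hU.mono (min_le_right _ _)).isInterior
      (hU₁.mono (min_le_left _ _)).isInterior hin hbd hin₁ hbd₁
  have hgam : ∀ t ∈ Icc (0 : ℝ) 1, ∀ s ∈ Ico 0 s₁, ‖gam t s‖ ≤ D := by
    intro t ht s hs
    rcases le_or_gt s s₀ with h | h
    · rw [(hagree t ht s ⟨hs.1, le_min h hs.2.le⟩).2]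
      exact (norm_snd_le (lam₁ t s, gam₁ t s)).trans ((hsmall t ht s ⟨hs.1, h⟩).le.trans hD)
    · have h1 := hU.norm_sub_le_exp hφ hε hα (fun s hs => hbd s hs.1) hs₀ h.le hs.2 ht
      rw [hU.energy_eq φ ε α hU₁ ⟨hs₀, h.le.trans hs.2.le⟩ ⟨hs₀, le_rfl⟩ fun t ht =>
        hagree t ht s₀ ⟨hs₀.le, le_min le_rfl (h.le.trans hs.2.le)⟩] at h1
      have h2 : Real.exp (K * (s - s₀)) * energy φ ε α lam₁ gam₁ gt₁ s₀ ≤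
          Real.exp (K * S) * |energy φ ε α lam₁ gam₁ gt₁ s₀| := by
        have : s - s₀ ≤ S := by linarith [hs.2, hs₁.2]
        have h3 := le_abs_self (energy φ ε α lam₁ gam₁ gt₁ s₀)
        calc _ ≤ Real.exp (K * (s - s₀)) * |energy φ ε α lam₁ gam₁ gt₁ s₀| := by gcongr
          _ ≤ _ := by gcongr
      have h3 := norm_le_norm_add_norm_sub' (gam t s) (gam0 0)
      exact le_max_of_le_right (by linarith)
  intro t ht
  have hgam₁ : ‖gam t s₁‖ ≤ D := by
    have hct : ContinuousOn (fun s => gam t s) (Icc 0 s₁) :=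
      hU.gam_cont.comp (f := fun s : ℝ => (t, s)) (by fun_prop) fun s hs => ⟨ht, hs⟩
    exact forall_le_of_forall_Ico_le hs₁.1 hct.norm (hgam t ht) s₁ ⟨hs₁.1.le, le_rfl⟩
  have hlam₁ : |lam t s₁| ≤ R₀ + S * M := by
    refine (hU.isInterior.abs_lam_le hε ht ⟨hs₁.1.le, le_rfl⟩ (M := M) fun r hr =>
      hM _ (mem_closedBall_zero_iff.2 (hgam t ht r (Ioo_subset_Ico_self hr)))).trans ?_
    refine add_le_add ((norm_fst_le (lam t 0, gam t 0)).trans (hR₀ t ht).le) ?_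
    exact mul_le_mul_of_nonneg_right hs₁.2 hM0
  exact (max_le (hlam₁.trans (le_max_right _ _)) (hgam₁.trans (le_max_left _ _))).trans_lt
    (lt_add_one _)

/-! ### Classical solutions -/

section
variable {φ : R3 → ℝ} {ε α : ℝ} {p q : R3} {lam0 : ℝ → ℝ} {gam0 : ℝ → R3}

theorem IsSolution.isInterior {lam : ℝ → ℝ → ℝ} {gam : ℝ → ℝ → R3}
    (h : IsSolution φ ε α p q lam0 gam0 lam gam) (T : ℝ) :
    IsInterior (rhsA φ ε) (rhsB φ ε α) T lam gam where
  lam_cont := h.regular.lam_cont.mono (prod_mono le_rfl Icc_subset_Ici_self)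
  gam_cont := h.regular.gam_cont.mono (prod_mono le_rfl Icc_subset_Ici_self)
  lam_deriv t ht s hs :=
    (h.regular.lam_diff t ht s hs.1).hasDerivAt.congr_deriv (h.eq_lam t ht s hs.1)
  gam_deriv s hs := by
    have hC2 := (contDiffOn_succ_iff_deriv_of_isOpen isOpen_Ioo (n := 1)).1
      (by rw [one_add_one_eq_two]; exact h.regular.gam_C2 s hs.1)
    have hC1 := (contDiffOn_succ_iff_deriv_of_isOpen isOpen_Ioo (n := 0)).1
      (by rw [zero_add]; exact hC2.2.2)
    refine ⟨deriv fun x => gam x s, fun t ht => ⟨?_, partialS gam (t, s),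
      secondDeriv (fun x => gam x s) t, ?_, ?_, ?_⟩⟩
    · exact (hC2.1.differentiableAt (Ioo_mem_nhds ht.1 ht.2)).hasDerivAt
    · exact (h.regular.gam_diff t ht s hs.1).hasDerivAt
    · exact (hC1.1.differentiableAt (Ioo_mem_nhds ht.1 ht.2)).hasDerivAt
    · rw [h.eq_gam t ht s hs.1, rhsGam, rhsB]
      abel

theorem contDiffOn_two_of_hasDerivAt {E : Type*} [NormedAddCommGroup E] [NormedSpace ℝ E]
    {c c' c'' : ℝ → E}
    (h : ∀ t ∈ Ioo (0 : ℝ) 1, HasDerivAt c (c' t) t)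
    (h' : ∀ t ∈ Ioo (0 : ℝ) 1, HasDerivAt c' (c'' t) t) (hc : ContinuousOn c'' (Ioo 0 1)) :
    ContDiffOn ℝ 2 c (Ioo 0 1) ∧ ∀ t ∈ Ioo (0 : ℝ) 1, deriv (deriv c) t = c'' t := by
  have e : ∀ t ∈ Ioo (0 : ℝ) 1, deriv c t = c' t := fun t ht => (h t ht).deriv
  have h1 : ∀ t ∈ Ioo (0 : ℝ) 1, HasDerivAt (deriv c) (c'' t) t := fun t ht =>
    (h' t ht).congr_of_eventuallyEq
      (eventually_of_mem (Ioo_mem_nhds ht.1 ht.2) e)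
  refine ⟨?_, fun t ht => (h1 t ht).deriv⟩
  rw [← one_add_one_eq_two, contDiffOn_succ_iff_deriv_of_isOpen isOpen_Ioo]
  refine ⟨fun t ht => (h t ht).differentiableAt.differentiableWithinAt, by simp, ?_⟩
  rw [← zero_add (1 : WithTop ℕ∞), contDiffOn_succ_iff_deriv_of_isOpen isOpen_Ioo]
  refine ⟨fun t ht => (h1 t ht).differentiableAt.differentiableWithinAt, by simp, ?_⟩
  rw [contDiffOn_zero]
  exact hc.congr fun t ht => (h1 t ht).deriv

theorem continuousOn_of_forall_lt {F : Type*} [TopologicalSpace F] {f : ℝ × ℝ → F} {I J : Set ℝ}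
    (h : ∀ S, ContinuousOn f (I ×ˢ (J ∩ Iio S))) : ContinuousOn f (I ×ˢ J) :=
  continuousOn_of_locally_continuousOn fun x _ => ⟨univ ×ˢ Iio (x.2 + 1),
    isOpen_univ.prod isOpen_Iio, ⟨mem_univ _, lt_add_one x.2⟩,
    (h (x.2 + 1)).mono fun _ hy => ⟨hy.1.1, hy.1.2, hy.2.2⟩⟩

/-- A pair that agrees with a strong solution up to every time is a classical solution. -/
theorem isSolution_of_forall_isStrong (hφ : ContDiff ℝ 1 φ) {lam : ℝ → ℝ → ℝ}
    {gam : ℝ → ℝ → R3}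
    (h : ∀ S, ∃ lam' gam' gs gt, IsStrong (rhsA φ ε) (rhsB φ ε α) S lam' gam' gs gt ∧
      ∀ t ∈ Icc (0 : ℝ) 1, ∀ s ∈ Icc 0 S, lam t s = lam' t s ∧ gam t s = gam' t s)
    (hinit : ∀ t ∈ Icc (0 : ℝ) 1, lam t 0 = lam0 t ∧ gam t 0 = gam0 t)
    (hbdry : ∀ s, 0 ≤ s → gam 0 s = p ∧ gam 1 s = q) :
    IsSolution φ ε α p q lam0 gam0 lam gam := by
  have hlam : ContinuousOn (fun p : ℝ × ℝ => lam p.1 p.2) (Icc 0 1 ×ˢ Ici 0) :=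
    continuousOn_of_forall_lt fun S => by
      obtain ⟨lam', gam', gs, gt, hs, he⟩ := h S
      exact (hs.lam_cont.mono (prod_mono le_rfl fun s hs => ⟨hs.1, hs.2.le⟩)).congr
        fun x hx => (he x.1 hx.1 x.2 ⟨hx.2.1, hx.2.2.le⟩).1
  have hgam : ContinuousOn (fun p : ℝ × ℝ => gam p.1 p.2) (Icc 0 1 ×ˢ Ici 0) :=
    continuousOn_of_forall_lt fun S => by
      obtain ⟨lam', gam', gs, gt, hs, he⟩ := h S
      exact (hs.gam_cont.mono (prod_mono le_rfl fun s hs => ⟨hs.1, hs.2.le⟩)).congr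
        fun x hx => (he x.1 hx.1 x.2 ⟨hx.2.1, hx.2.2.le⟩).2
  have hstate : ContinuousOn (fun p : ℝ × ℝ => (lam p.1 p.2, gam p.1 p.2)) (Icc 0 1 ×ˢ Ioi 0) :=
    (hlam.prodMk hgam).mono (prod_mono le_rfl Ioi_subset_Ici_self)
  have hdl : ∀ t ∈ Icc (0 : ℝ) 1, ∀ s ∈ Ioi (0 : ℝ),
      HasDerivAt (lam t) (rhsA φ ε (lam t s, gam t s)) s := by
    intro t ht s hs
    obtain ⟨lam', gam', gs, gt, hst, he⟩ := h (s + 1)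
    have hs0 : 0 < s := hs
    rw [(he t ht s ⟨hs0.le, by linarith⟩).1, (he t ht s ⟨hs0.le, by linarith⟩).2]
    refine (hst.lam_deriv t ht s ⟨hs, by linarith⟩).congr_of_eventuallyEq ?_
    filter_upwards [Icc_mem_nhds hs0 (lt_add_one s)] with r hr using (he t ht r hr).1
  -- the time and space derivatives of the curve up to any given time
  have hloc : ∀ S, ∃ gs : ℝ → ℝ → R3,
      ContinuousOn (fun p : ℝ × ℝ => gs p.1 p.2) (Icc 0 1 ×ˢ (Ioi 0 ∩ Iio S)) ∧
      (∀ t ∈ Icc (0 : ℝ) 1, ∀ s ∈ Ioi (0 : ℝ) ∩ Iio S, HasDerivAt (gam t) (gs t s) s) ∧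
      ∀ s ∈ Ioi (0 : ℝ) ∩ Iio S, ContDiffOn ℝ 2 (fun t => gam t s) (Ioo 0 1) ∧
        ∀ t ∈ Ioo (0 : ℝ) 1, secondDeriv (fun t => gam t s) t =
          gs t s - rhsB φ ε α (lam t s, gam t s) := by
    intro S
    obtain ⟨lam', gam', gs, gt, hst, he⟩ := h S
    have hIoc : Ioi (0 : ℝ) ∩ Iio S ⊆ Ioc 0 S := fun s hs => ⟨hs.1, hs.2.le⟩
    refine ⟨gs, hst.gs_cont.mono (prod_mono le_rfl hIoc), fun t ht s hs => ?_, fun s hs => ?_⟩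
    · refine (hst.gam_deriv t ht s (hIoc hs)).congr_of_eventuallyEq ?_
      filter_upwards [Icc_mem_nhds hs.1 hs.2] with r hr using (he t ht r hr).2
    · have hs' := Ioc_subset_Icc_self (hIoc hs)
      refine contDiffOn_two_of_hasDerivAt (c' := fun t => gt t s) (fun t ht => ?_)
        (fun t ht => ?_) ?_
      · refine (hst.gam_space s (hIoc hs) t ht).congr_of_eventuallyEq ?_
        filter_upwards [Icc_mem_nhds ht.1 ht.2] with x hx using (he x hx s hs').2
      · have ht' := Ioo_subset_Icc_self ht
        rw [(he t ht' s hs').1, (he t ht' s hs').2]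
        exact hst.gt_space s (hIoc hs) t ht
      · exact ((continuousOn_slice hst.gs_cont (hIoc hs)).sub
          ((continuous_rhsB hφ).comp_continuousOn
            (continuousOn_slice hstate hs.1))).mono Ioo_subset_Icc_self
  have hmem : ∀ {s : ℝ}, s ∈ Ioi (0 : ℝ) → s ∈ Ioi (0 : ℝ) ∩ Iio (s + 1) := fun {s} hs =>
    ⟨hs, lt_add_one s⟩
  have hgs : ContinuousOn (partialS gam) (Ioo 0 1 ×ˢ Ioi 0) :=
    continuousOn_of_forall_lt fun S => by
      obtain ⟨gs, hc, hd, -⟩ := hloc S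
      exact (hc.mono (prod_mono Ioo_subset_Icc_self le_rfl)).congr
        fun x hx => (hd x.1 (Ioo_subset_Icc_self hx.1) x.2 hx.2).deriv
  have heq : ∀ t ∈ Ioo (0 : ℝ) 1, ∀ s ∈ Ioi (0 : ℝ),
      secondDeriv (fun t => gam t s) t = partialS gam (t, s) - rhsB φ ε α (lam t s, gam t s) := by
    intro t ht s hs
    obtain ⟨gs, -, hd, hd2⟩ := hloc (s + 1)
    rw [(hd2 s (hmem hs)).2 t ht, partialS, (hd t (Ioo_subset_Icc_self ht) s (hmem hs)).deriv]
  refine ⟨⟨hlam, hgam, fun t ht s hs => (hdl t ht s hs).differentiableAt, ?_, fun t ht s hs => ?_,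
    hgs, fun s hs => ?_, ?_⟩, fun t ht s hs => (hdl t ht s hs).deriv, fun t ht s hs => ?_,
    fun s hs => (hbdry s hs).1, fun s hs => (hbdry s hs).2, fun t ht => (hinit t ht).1,
    fun t ht => (hinit t ht).2⟩
  · exact ((continuous_rhsA hφ).comp_continuousOn hstate).congr
      fun x hx => (hdl x.1 hx.1 x.2 hx.2).deriv
  · obtain ⟨gs, -, hd, -⟩ := hloc (s + 1)
    exact (hd t (Ioo_subset_Icc_self ht) s (hmem hs)).differentiableAt
  · obtain ⟨gs, -, -, hd2⟩ := hloc (s + 1)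
    exact (hd2 s (hmem hs)).1
  · exact (hgs.sub ((continuous_rhsB hφ).comp_continuousOn
      (hstate.mono (prod_mono Ioo_subset_Icc_self le_rfl)))).congr
        fun x hx => heq x.1 hx.1 x.2 hx.2
  · rw [rhsGam, heq t ht s hs, rhsB]
    abel

theorem exists_isSolution (hφ : ContDiff ℝ 1 φ) (hgrad : LocallyLipschitz (gradient φ))
    (hε : 0 < ε) (hα : 0 < α) (hlam0 : ContinuousOn lam0 (Icc 0 1))
    (hgam0 : ContinuousOn gam0 (Icc 0 1)) :
    ∃ lam gam, IsSolution φ ε α (gam0 0) (gam0 1) lam0 gam0 lam gam := by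
  -- the values at time `s` are those of the solution up to time `s + 1`
  choose lamS gamS gs gt hS hin hbd using exists_isStrong_upto hφ hgrad hε hα hlam0 hgam0
  refine ⟨fun t s => lamS (s + 1) t s, fun t s => gamS (s + 1) t s,
    isSolution_of_forall_isStrong hφ (fun S => ⟨_, _, _, _, hS S, fun t ht s hs => ?_⟩)
    (fun t ht => hin _ t ht) fun s hs => hbd _ s hs⟩
  exact IsInterior.unique_of_data hφ hgrad
    ((hS (s + 1)).mono (min_le_left _ _)).isInterior ((hS S).mono (min_le_right _ _)).isInterior
    (hin _) (hbd _) (hin _) (hbd _) t ht s ⟨hs.1, le_min (lt_add_one s).le hs.2⟩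

theorem IsSolution.unique (hφ : ContDiff ℝ 1 φ) (hgrad : LocallyLipschitz (gradient φ))
    {lam lam' : ℝ → ℝ → ℝ} {gam gam' : ℝ → ℝ → R3}
    (h : IsSolution φ ε α p q lam0 gam0 lam gam)
    (h' : IsSolution φ ε α p q lam0 gam0 lam' gam') :
    ∀ t ∈ Icc (0 : ℝ) 1, ∀ s ∈ Ici (0 : ℝ), lam t s = lam' t s ∧ gam t s = gam' t s :=
  fun t ht s hs => IsInterior.unique (locallyLipschitz_rhsA hφ ε)
    (locallyLipschitz_rhsB hφ hgrad ε α) (h.isInterior s) (h'.isInterior s)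
    (fun t ht => ⟨(h.init_lam t ht).trans (h'.init_lam t ht).symm,
      (h.init_gam t ht).trans (h'.init_gam t ht).symm⟩)
    (fun r hr => ⟨(h.left_end r hr.1).trans (h'.left_end r hr.1).symm,
      (h.right_end r hr.1).trans (h'.right_end r hr.1).symm⟩) t ht s ⟨hs, le_rfl⟩

end

end GeodesicFlow

end

theorem mainTheorem4 (φ : R3 → ℝ) (hφ : ContDiff ℝ 1 φ) (ε : ℝ) (hε : 0 < ε) :
    -- each relaxed update is exactly an explicit Euler step of the PDE system, with time steps
    -- `τ_lam / (1 + ε τ_lam)` and `τ_gam`, and with `α = (1 + ω) τ_lam / (1 + ε τ_lam)`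
    (∀ τl τg ω α : ℝ, 0 < τl → 0 < τg → α = (1 + ω) * (τl / (1 + ε * τl)) →
      ∀ (lam lam' : ℝ → ℝ) (gam gam' : ℝ → R3),
        (∀ t ∈ Set.Icc (0 : ℝ) 1,
          lam' t = GeodesicFlow.updateLam φ ε τl lam gam t ↔
            (lam' t - lam t) / (τl / (1 + ε * τl)) = GeodesicFlow.rhsLam φ ε lam gam t) ∧
        (∀ t ∈ Set.Ioo (0 : ℝ) 1,
          gam' t = GeodesicFlow.updateGam φ ε ω τl τg lam gam t ↔
            τg⁻¹ • (gam' t - gam t) = GeodesicFlow.rhsGam φ ε α lam gam t)) ∧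
    -- consistency as the step sizes tend to zero: for every regular pair, the local truncation
    -- error of the update converges locally uniformly to the residual of the PDE system; in
    -- particular it tends to zero along the solutions of the PDE system
    (∀ (α : ℝ) (τl τg ω : ℕ → ℝ), (∀ n, 0 < τl n) → (∀ n, 0 < τg n) →
      Filter.Tendsto τl Filter.atTop (nhds 0) → Filter.Tendsto τg Filter.atTop (nhds 0) →
      Filter.Tendsto (fun n => (1 + ω n) * (τl n / (1 + ε * τl n))) Filter.atTop (nhds α) →
      ∀ (lam : ℝ → ℝ → ℝ) (gam : ℝ → ℝ → R3), GeodesicFlow.IsRegular lam gam →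
        TendstoLocallyUniformlyOn
          (fun n (x : ℝ × ℝ) =>
            (lam x.1 (x.2 + τl n / (1 + ε * τl n)) -
              GeodesicFlow.updateLam φ ε (τl n) (fun t => lam t x.2) (fun t => gam t x.2) x.1) /
              (τl n / (1 + ε * τl n)))
          (fun x => GeodesicFlow.partialS lam x -
            GeodesicFlow.rhsLam φ ε (fun t => lam t x.2) (fun t => gam t x.2) x.1)
          Filter.atTop (Set.Icc 0 1 ×ˢ Set.Ioi 0) ∧
        TendstoLocallyUniformlyOn
          (fun n (x : ℝ × ℝ) =>
            (τg n)⁻¹ • (gam x.1 (x.2 + τg n) -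
              GeodesicFlow.updateGam φ ε (ω n) (τl n) (τg n)
                (fun t => lam t x.2) (fun t => gam t x.2) x.1))
          (fun x => GeodesicFlow.partialS gam x -
            GeodesicFlow.rhsGam φ ε α (fun t => lam t x.2) (fun t => gam t x.2) x.1)
          Filter.atTop (Set.Ioo 0 1 ×ˢ Set.Ioi 0)) ∧
    -- global existence and uniqueness when the gradient is Lipschitz continuous
    ((∃ K : NNReal, LipschitzWith K (gradient φ)) →
      ∀ α : ℝ, 0 < α → ∀ (p q : R3) (lam0 : ℝ → ℝ) (gam0 : ℝ → R3),
        ContinuousOn lam0 (Set.Icc 0 1) → ContinuousOn gam0 (Set.Icc 0 1) →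
        gam0 0 = p → gam0 1 = q →
        ∃ (lam : ℝ → ℝ → ℝ) (gam : ℝ → ℝ → R3),
          GeodesicFlow.IsSolution φ ε α p q lam0 gam0 lam gam ∧
          ∀ (lam' : ℝ → ℝ → ℝ) (gam' : ℝ → ℝ → R3),
            GeodesicFlow.IsSolution φ ε α p q lam0 gam0 lam' gam' →
            ∀ t ∈ Set.Icc (0 : ℝ) 1, ∀ s ∈ Set.Ici (0 : ℝ),
              lam' t s = lam t s ∧ gam' t s = gam t s) ∧
    -- the equilibria
    (∀ α : ℝ, 0 < α → ∀ (p q : R3) (lam : ℝ → ℝ) (gam : ℝ → R3),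
      GeodesicFlow.IsEquilibrium φ ε α p q lam gam ↔
        (ContinuousOn lam (Set.Icc 0 1) ∧ ContinuousOn gam (Set.Icc 0 1) ∧
          ContDiffOn ℝ 2 gam (Set.Ioo 0 1) ∧ gam 0 = p ∧ gam 1 = q ∧
          (∀ t ∈ Set.Icc (0 : ℝ) 1, ε * lam t = φ (gam t)) ∧
          (∀ t ∈ Set.Ioo (0 : ℝ) 1, GeodesicFlow.secondDeriv gam t =
            ((1 - α * ε) * lam t + α * φ (gam t)) • gradient φ (gam t)))) := by
  refine ⟨fun τl τg ω α hτl hτg hα lam lam' gam gam' => ⟨fun t _ => ?_, fun t _ => ?_⟩,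
    fun α τl τg ω hτl hτg hτl0 hτg0 hα lam gam hr =>
      ⟨GeodesicFlow.lam_consistent hε hτl hτl0 hr,
        GeodesicFlow.gam_consistent hφ hε hτl hτg hτg0 hα hr⟩,
    fun ⟨K, hK⟩ α hα p q lam0 gam0 hlam0 hgam0 hp hq => ?_,
    fun α _ p q lam gam => GeodesicFlow.isEquilibrium_iff φ ε α p q lam gam⟩
  · have hh : 0 < τl / (1 + ε * τl) := by positivity
    rw [GeodesicFlow.updateLam_eq φ hε hτl, div_eq_iff hh.ne', sub_eq_iff_eq_add', mul_comm]
  · rw [GeodesicFlow.updateGam_eq φ hε hτl, ← hα, inv_smul_eq_iff₀ hτg.ne', sub_eq_iff_eq_add']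
  · subst hp hq
    obtain ⟨lam, gam, h⟩ :=
      GeodesicFlow.exists_isSolution hφ hK.locallyLipschitz hε hα hlam0 hgam0
    exact ⟨lam, gam, h, fun lam' gam' h' => h'.unique hφ hK.locallyLipschitz h⟩
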